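/- An instance of Ext-TSP consists of an undirected graph $G=(V,E)$ with positive real edge weights $w:E\to\mathbb{R}_{>0}$, a parameter $k\in\mathbb{N}$, and a non-increasing discount function $f:\{1,2,3,\dots\}\to\mathbb{R}$ with $f(1)=1$ and $f(i)=0$ for all $i>k$ (so necessarily $k\ge 1$). A sequencing is a bijection $d:V\to\{1,\dots,|V|\}$, and the goal is to find a sequencing maximizing $$\sum_{\{u,v\}\in E} f(|d_u-d_v|)\, w(u,v).$$ Theorem. Ext-TSP can be solved optimally on trees in $n^{O(k)}$ time, more precisely in $O(n^{2k+3})$ time. That is, there are a single algorithm and an absolute constant $C$ such that, for every instance $(G,w,k,f)$ in which $G$ is a tree with $n$ vertices (given by $n$, $k$, a list of the edges with their weights, and the values $f(1),\dots,f(k)$), the algorithm outputs a sequencing of maximum objective value after at most $C\,n^{2k+3}$ steps. Here an algorithm is a fixed finite program for a unit-cost random access machine whose integer memory (initialized to zero apart from the input) supports addition, subtraction, comparison and indirect addressing, and whose real memory, which holds the weights and the discounts, supports addition, subtraction, multiplication and comparison. -/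

import Mathlib

/-! ### The Ext-TSP problem -/

/-- An instance of Ext-TSP on the vertex set `{0, …, n-1}`: an undirected graph with positive edge
weights, a parameter `k`, and a discount function `f` on the distances `1, 2, 3, …` that is
non-increasing, has `f 1 = 1`, and vanishes beyond `k`. Distance `0` never occurs, so `f 0` is
irrelevant. -/
structure ExtTSP (n : ℕ) where
  graph : SimpleGraph (Fin n)
  weight : Sym2 (Fin n) → ℝ
  weight_pos : ∀ e ∈ graph.edgeSet, 0 < weight e
  k : ℕ
  f : ℕ → ℝ
  f_one : f 1 = 1
  f_anti : AntitoneOn f (Set.Ici 1)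
  f_far : ∀ i, k < i → f i = 0

/-- A sequencing of the vertices: `d v ∈ {1, …, n}` is the position of `v`. -/
abbrev Sequencing (n : ℕ) : Type := Fin n ≃ Finset.Icc 1 n

/-- The distance `|d_u - d_v|` between the endpoints of an edge. -/
def Sequencing.gap {n : ℕ} (d : Sequencing n) : Sym2 (Fin n) → ℕ :=
  Sym2.lift ⟨fun u v => (((d u : ℕ) : ℤ) - ((d v : ℕ) : ℤ)).natAbs,
    fun _ _ => by dsimp only; omega⟩

open Classical in
/-- The objective `∑_{uv ∈ E} f(|d_u - d_v|) w(u,v)`. -/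
noncomputable def ExtTSP.objective {n : ℕ} (I : ExtTSP n) (d : Sequencing n) : ℝ :=
  ∑ e ∈ I.graph.edgeFinset, I.f (d.gap e) * I.weight e

def ExtTSP.IsOptimal {n : ℕ} (I : ExtTSP n) (d : Sequencing n) : Prop :=
  ∀ d' : Sequencing n, I.objective d' ≤ I.objective d

/-! ### The machine model: a unit-cost random access machine with real registers

The machine has an integer part (natural numbers with addition, truncated subtraction and
comparison, and indirect addressing) and a real part (real numbers with ring operations and
comparison). There is no integer multiplication, no rounding and no conversion between the two
parts, and the only constants in a program are natural numbers. Programs are finite structured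
programs. Memory is organised in scalar variables and arrays, both named by natural numbers; a
program refers to finitely many of them. -/

namespace RAM

structure Store where
  ivar : ℕ → ℕ
  iarr : ℕ → ℕ → ℕ
  rvar : ℕ → ℝ
  rarr : ℕ → ℕ → ℝ

/-- Integer expressions; `get a e` reads entry `e` of the integer array `a`. -/
inductive IExp : Type
  | lit (m : ℕ)
  | var (x : ℕ)
  | get (a : ℕ) (e : IExp)
  | add (e₁ e₂ : IExp)
  | sub (e₁ e₂ : IExp)

/-- Real expressions; `get a e` reads entry `e` of the real array `a`. -/
inductive RExp : Type
  | lit (m : ℕ)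
  | var (x : ℕ)
  | get (a : ℕ) (e : IExp)
  | add (e₁ e₂ : RExp)
  | sub (e₁ e₂ : RExp)
  | mul (e₁ e₂ : RExp)

/-- Tests. -/
inductive BExp : Type
  | ilt (e₁ e₂ : IExp)
  | ieq (e₁ e₂ : IExp)
  | rlt (e₁ e₂ : RExp)
  | neg (b : BExp)
  | and (b₁ b₂ : BExp)
  | or (b₁ b₂ : BExp)

/-- Programs. -/
inductive Prog : Type
  | skip
  | setIVar (x : ℕ) (e : IExp)
  | setIArr (a : ℕ) (i e : IExp)
  | setRVar (x : ℕ) (e : RExp)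
  | setRArr (a : ℕ) (i : IExp) (e : RExp)
  | seq (p q : Prog)
  | ite (b : BExp) (p q : Prog)
  | while (b : BExp) (p : Prog)

def IExp.eval (s : Store) : IExp → ℕ
  | .lit m => m
  | .var x => s.ivar x
  | .get a e => s.iarr a (e.eval s)
  | .add e₁ e₂ => e₁.eval s + e₂.eval s
  | .sub e₁ e₂ => e₁.eval s - e₂.eval s

noncomputable def RExp.eval (s : Store) : RExp → ℝ
  | .lit m => (m : ℝ)
  | .var x => s.rvar x
  | .get a e => s.rarr a (e.eval s)
  | .add e₁ e₂ => e₁.eval s + e₂.eval s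
  | .sub e₁ e₂ => e₁.eval s - e₂.eval s
  | .mul e₁ e₂ => e₁.eval s * e₂.eval s

def BExp.eval (s : Store) : BExp → Prop
  | .ilt e₁ e₂ => e₁.eval s < e₂.eval s
  | .ieq e₁ e₂ => e₁.eval s = e₂.eval s
  | .rlt e₁ e₂ => e₁.eval s < e₂.eval s
  | .neg b => ¬ b.eval s
  | .and b₁ b₂ => b₁.eval s ∧ b₂.eval s
  | .or b₁ b₂ => b₁.eval s ∨ b₂.eval s

/-- Number of steps to evaluate an integer expression: one per constant, memory access and
operation. -/
def IExp.cost : IExp → ℕ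
  | .lit _ => 1
  | .var _ => 1
  | .get _ e => e.cost + 1
  | .add e₁ e₂ => e₁.cost + e₂.cost + 1
  | .sub e₁ e₂ => e₁.cost + e₂.cost + 1

/-- Number of steps to evaluate a real expression. -/
def RExp.cost : RExp → ℕ
  | .lit _ => 1
  | .var _ => 1
  | .get _ e => e.cost + 1
  | .add e₁ e₂ => e₁.cost + e₂.cost + 1
  | .sub e₁ e₂ => e₁.cost + e₂.cost + 1
  | .mul e₁ e₂ => e₁.cost + e₂.cost + 1

/-- Number of steps to evaluate a test. -/
def BExp.cost : BExp → ℕ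
  | .ilt e₁ e₂ => e₁.cost + e₂.cost + 1
  | .ieq e₁ e₂ => e₁.cost + e₂.cost + 1
  | .rlt e₁ e₂ => e₁.cost + e₂.cost + 1
  | .neg b => b.cost + 1
  | .and b₁ b₂ => b₁.cost + b₂.cost + 1
  | .or b₁ b₂ => b₁.cost + b₂.cost + 1

def Store.setIVar (s : Store) (x v : ℕ) : Store :=
  { s with ivar := Function.update s.ivar x v }

def Store.setIArr (s : Store) (a i v : ℕ) : Store :=
  { s with iarr := Function.update s.iarr a (Function.update (s.iarr a) i v) }

def Store.setRVar (s : Store) (x : ℕ) (v : ℝ) : Store :=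
  { s with rvar := Function.update s.rvar x v }

def Store.setRArr (s : Store) (a i : ℕ) (v : ℝ) : Store :=
  { s with rarr := Function.update s.rarr a (Function.update (s.rarr a) i v) }

/-- `Exec p s s' t`: program `p`, started in store `s`, halts in store `s'` after exactly `t`
steps. Execution is deterministic, and a program that does not halt has no such `s'` and `t`. -/
inductive Exec : Prog → Store → Store → ℕ → Prop
  | skip (s : Store) : Exec .skip s s 1
  | setIVar (s : Store) (x : ℕ) (e : IExp) :
      Exec (.setIVar x e) s (s.setIVar x (e.eval s)) (e.cost + 1)
  | setIArr (s : Store) (a : ℕ) (i e : IExp) :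
      Exec (.setIArr a i e) s (s.setIArr a (i.eval s) (e.eval s)) (i.cost + e.cost + 1)
  | setRVar (s : Store) (x : ℕ) (e : RExp) :
      Exec (.setRVar x e) s (s.setRVar x (e.eval s)) (e.cost + 1)
  | setRArr (s : Store) (a : ℕ) (i : IExp) (e : RExp) :
      Exec (.setRArr a i e) s (s.setRArr a (i.eval s) (e.eval s)) (i.cost + e.cost + 1)
  | seq {p q : Prog} {s s₁ s₂ : Store} {t₁ t₂ : ℕ} :
      Exec p s s₁ t₁ → Exec q s₁ s₂ t₂ → Exec (.seq p q) s s₂ (t₁ + t₂)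
  | iteTrue {b : BExp} {p q : Prog} {s s₁ : Store} {t : ℕ} :
      b.eval s → Exec p s s₁ t → Exec (.ite b p q) s s₁ (b.cost + 1 + t)
  | iteFalse {b : BExp} {p q : Prog} {s s₁ : Store} {t : ℕ} :
      ¬ b.eval s → Exec q s s₁ t → Exec (.ite b p q) s s₁ (b.cost + 1 + t)
  | whileFalse {b : BExp} {p : Prog} {s : Store} :
      ¬ b.eval s → Exec (.while b p) s s (b.cost + 1)
  | whileTrue {b : BExp} {p : Prog} {s s₁ s₂ : Store} {t₁ t₂ : ℕ} :
      b.eval s → Exec p s s₁ t₁ → Exec (.while b p) s₁ s₂ t₂ →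
        Exec (.while b p) s s₂ (b.cost + 1 + t₁ + t₂)

end RAM

/-! ### Input and output conventions -/

/-- `l` lists every edge of `G` exactly once, in an arbitrary order and with an arbitrary
orientation. -/
def IsEdgeList {n : ℕ} (G : SimpleGraph (Fin n)) (l : List (Fin n × Fin n)) : Prop :=
  (l.map (fun p => s(p.1, p.2))).Nodup ∧
    ∀ u v : Fin n, s(u, v) ∈ l.map (fun p => s(p.1, p.2)) ↔ G.Adj u v

/-- The initial store for an instance whose edges are listed in `l`. Integer variables 0, 1, 2 hold
the number of vertices, the parameter `k` and the number of edges; integer arrays 0 and 1 and real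
array 0 hold the two endpoints and the weight of each listed edge; real array 1 holds
`f 1, …, f k` at the indices `1, …, k`. All other cells are zero. -/
noncomputable def ExtTSP.input {n : ℕ} (I : ExtTSP n) (l : List (Fin n × Fin n)) : RAM.Store where
  ivar x := if x = 0 then n else if x = 1 then I.k else if x = 2 then l.length else 0
  iarr a i :=
    if h : i < l.length then
      if a = 0 then ((l[i]).1 : ℕ) else if a = 1 then ((l[i]).2 : ℕ) else 0
    else 0
  rvar _ := 0
  rarr a i :=
    if a = 0 then (if h : i < l.length then I.weight s((l[i]).1, (l[i]).2) else 0)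
    else if a = 1 then (if 1 ≤ i ∧ i ≤ I.k then I.f i else 0)
    else 0

/-- The final store `s` presents the sequencing `d`: entry `v` of integer array 2 is the position
of the vertex `v`. -/
def Outputs {n : ℕ} (s : RAM.Store) (d : Sequencing n) : Prop :=
  ∀ v : Fin n, s.iarr 2 v = (d v : ℕ)

/-! Root the tree at vertex 1 and write `x ↦ wt x` for the weight of the edge from `x` to its
parent. Put K = min(k, n). An edge longer than K earns nothing, so a sequencing cuts the tree into
connected pieces, each with a top vertex, in which every other vertex lies within K of its parent.
Conversely, pieces can be sequenced one after another: squeezing out the gaps inside a piece only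
shortens its edges, f is non-increasing, and edges between pieces earn at least 0 because f
decreases to 0.

Two observations make the search for the best piece cheap. First, a piece is recognised locally. In
a sequence of symbols and blanks, suppose that no vertex repeats within distance 2K, that every
vertex except the top has its parent within distance K, and that the top occurs exactly once. Then
no vertex repeats at all (`Layout.inj`): two copies of x would both lie within K of the parent,
which occurs only once by induction on the rank, so the copies would be within 2K of each other.
Hence a dynamic program whose state is the last 2K symbols never has to remember which vertices have
been used.

Second, it need not know which subtrees hang below the piece. Let OPT(v) be the optimum of the
subtree of v, and let -H(v) be OPT(v) minus the sum of OPT(c) over the children c. Then -Σ H over a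
subtree is its optimum, and the recursion for OPT telescopes to: -H(v) is the maximum, over layouts
with top v, of Σ (f(distance) · w + H(x)) over the vertices x ≠ v placed. The hanging subtrees
cancel, and only placed vertices are charged.

Optimality is a duality argument. `sum_le_neg_potential` decomposes an arbitrary sequencing into
pieces and bounds its objective by -Σ H. `Placed.place` appends an optimal layout for each vertex
not yet placed, parents first, and keeps the earned amount at least -Σ H over the placed vertices.
`objective_eq_sum` identifies these sums with the objective.

The dynamic program has 2n + 2K layers and (n+1)^(2K+1) windows for each of the n tops. Since K ≤ n,
(n+1)^(2K) is at most a constant times n^(2K), which gives O(n^(2k+3)). `value_le_table` and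
`layout_of_table` show that the tables compute the maximum. The rest verifies a concrete program in
a small Hoare logic: `Runs` for cost and postcondition, `Frame` for what stays unchanged, `Prog.wp`
for straight-line code and `Runs.for` for loops. -/

/-! ### Execution with a time bound and a postcondition -/

namespace RAM

/-- `p` halts from `s` after at most `T` steps in a store satisfying `Q`. -/
def Runs (p : Prog) (s : Store) (T : ℕ) (Q : Store → Prop) : Prop :=
  ∃ s' t, Exec p s s' t ∧ t ≤ T ∧ Q s'

/-! Variables and arrays that a program may write. -/

def Prog.writesIVar : Prog → ℕ → Bool
  | .setIVar x _, y => x == y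
  | .seq p q, y => p.writesIVar y || q.writesIVar y
  | .ite _ p q, y => p.writesIVar y || q.writesIVar y
  | .while _ p, y => p.writesIVar y
  | _, _ => false

def Prog.writesIArr : Prog → ℕ → Bool
  | .setIArr x _ _, y => x == y
  | .seq p q, y => p.writesIArr y || q.writesIArr y
  | .ite _ p q, y => p.writesIArr y || q.writesIArr y
  | .while _ p, y => p.writesIArr y
  | _, _ => false

def Prog.writesRVar : Prog → ℕ → Bool
  | .setRVar x _, y => x == y
  | .seq p q, y => p.writesRVar y || q.writesRVar y
  | .ite _ p q, y => p.writesRVar y || q.writesRVar y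
  | .while _ p, y => p.writesRVar y
  | _, _ => false

def Prog.writesRArr : Prog → ℕ → Bool
  | .setRArr x _ _, y => x == y
  | .seq p q, y => p.writesRArr y || q.writesRArr y
  | .ite _ p q, y => p.writesRArr y || q.writesRArr y
  | .while _ p, y => p.writesRArr y
  | _, _ => false

/-- `s'` agrees with `s` on everything that `p` does not write. -/
structure Frame (p : Prog) (s s' : Store) : Prop where
  ivar : ∀ x, p.writesIVar x = false → s'.ivar x = s.ivar x
  iarr : ∀ x, p.writesIArr x = false → s'.iarr x = s.iarr x
  rvar : ∀ x, p.writesRVar x = false → s'.rvar x = s.rvar x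
  rarr : ∀ x, p.writesRArr x = false → s'.rarr x = s.rarr x

theorem Frame.refl (p : Prog) (s : Store) : Frame p s s :=
  ⟨fun _ _ => rfl, fun _ _ => rfl, fun _ _ => rfl, fun _ _ => rfl⟩

theorem Frame.trans {p : Prog} {s s' s'' : Store} (h : Frame p s s') (h' : Frame p s' s'') :
    Frame p s s'' :=
  ⟨fun x hx => (h'.ivar x hx).trans (h.ivar x hx), fun x hx => (h'.iarr x hx).trans (h.iarr x hx),
    fun x hx => (h'.rvar x hx).trans (h.rvar x hx), fun x hx => (h'.rarr x hx).trans (h.rarr x hx)⟩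

theorem Frame.mono {p q : Prog} {s s' : Store} (h : Frame p s s')
    (h₁ : ∀ x, q.writesIVar x = false → p.writesIVar x = false)
    (h₂ : ∀ x, q.writesIArr x = false → p.writesIArr x = false)
    (h₃ : ∀ x, q.writesRVar x = false → p.writesRVar x = false)
    (h₄ : ∀ x, q.writesRArr x = false → p.writesRArr x = false) : Frame q s s' :=
  ⟨fun x hx => h.ivar x (h₁ x hx), fun x hx => h.iarr x (h₂ x hx),
    fun x hx => h.rvar x (h₃ x hx), fun x hx => h.rarr x (h₄ x hx)⟩

/-- Lets specifications mention only what changes. The write sets are computable Booleans, so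
preservation of a given cell is later discharged by `rfl`. -/
theorem Exec.frame {p : Prog} {s s' : Store} {t : ℕ} (h : Exec p s s' t) : Frame p s s' := by
  induction h with
  | skip s => exact Frame.refl _ _
  | setIVar s x e =>
    refine ⟨fun y hy => ?_, fun _ _ => rfl, fun _ _ => rfl, fun _ _ => rfl⟩
    simp only [Prog.writesIVar, beq_eq_false_iff_ne] at hy
    simp [Store.setIVar, Function.update_of_ne (Ne.symm hy)]
  | setIArr s a i e =>
    refine ⟨fun _ _ => rfl, fun y hy => ?_, fun _ _ => rfl, fun _ _ => rfl⟩
    simp only [Prog.writesIArr, beq_eq_false_iff_ne] at hy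
    simp [Store.setIArr, Function.update_of_ne (Ne.symm hy)]
  | setRVar s x e =>
    refine ⟨fun _ _ => rfl, fun _ _ => rfl, fun y hy => ?_, fun _ _ => rfl⟩
    simp only [Prog.writesRVar, beq_eq_false_iff_ne] at hy
    simp [Store.setRVar, Function.update_of_ne (Ne.symm hy)]
  | setRArr s a i e =>
    refine ⟨fun _ _ => rfl, fun _ _ => rfl, fun _ _ => rfl, fun y hy => ?_⟩
    simp only [Prog.writesRArr, beq_eq_false_iff_ne] at hy
    simp [Store.setRArr, Function.update_of_ne (Ne.symm hy)]
  | seq _ _ ih₁ ih₂ =>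
    refine (ih₁.mono ?_ ?_ ?_ ?_).trans (ih₂.mono ?_ ?_ ?_ ?_) <;>
      intro x hx <;>
      simp only [Prog.writesIVar, Prog.writesIArr, Prog.writesRVar, Prog.writesRArr,
        Bool.or_eq_false_iff] at hx <;> first | exact hx.1 | exact hx.2
  | iteTrue _ _ ih =>
    refine ih.mono ?_ ?_ ?_ ?_ <;> intro x hx <;>
      simp only [Prog.writesIVar, Prog.writesIArr, Prog.writesRVar, Prog.writesRArr,
        Bool.or_eq_false_iff] at hx <;> exact hx.1
  | iteFalse _ _ ih =>
    refine ih.mono ?_ ?_ ?_ ?_ <;> intro x hx <;>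
      simp only [Prog.writesIVar, Prog.writesIArr, Prog.writesRVar, Prog.writesRArr,
        Bool.or_eq_false_iff] at hx <;> exact hx.2
  | whileFalse _ => exact Frame.refl _ _
  | whileTrue _ _ _ ih₁ ih₂ =>
    exact Frame.trans (ih₁.mono (fun _ h => h) (fun _ h => h) (fun _ h => h) (fun _ h => h)) ih₂

theorem Runs.imp {p : Prog} {s : Store} {T T' : ℕ} {Q Q' : Store → Prop} (h : Runs p s T Q)
    (hT : T ≤ T') (hQ : ∀ s', Frame p s s' → Q s' → Q' s') : Runs p s T' Q' := by
  obtain ⟨s', t, he, ht, hq⟩ := h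
  exact ⟨s', t, he, ht.trans hT, hQ s' he.frame hq⟩

theorem Runs.seq {p q : Prog} {s : Store} {T₁ T₂ : ℕ} {R Q : Store → Prop}
    (h₁ : Runs p s T₁ R) (h₂ : ∀ s', Frame p s s' → R s' → Runs q s' T₂ Q) :
    Runs (.seq p q) s (T₁ + T₂) Q := by
  obtain ⟨s', t, he, ht, hq⟩ := h₁
  obtain ⟨s'', t', he', ht', hq'⟩ := h₂ s' he.frame hq
  exact ⟨s'', _, .seq he he', by omega, hq'⟩

theorem Runs.ite {b : BExp} {p q : Prog} {s : Store} {T : ℕ} {Q : Store → Prop}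
    (h₁ : b.eval s → Runs p s T Q) (h₂ : ¬ b.eval s → Runs q s T Q) :
    Runs (.ite b p q) s (b.cost + 1 + T) Q := by
  by_cases hb : b.eval s
  · obtain ⟨s', t, he, ht, hq⟩ := h₁ hb
    exact ⟨s', _, .iteTrue hb he, by omega, hq⟩
  · obtain ⟨s', t, he, ht, hq⟩ := h₂ hb
    exact ⟨s', _, .iteFalse hb he, by omega, hq⟩

/-! Programs without loops. -/

def Prog.loopFree : Prog → Bool
  | .seq p q => p.loopFree && q.loopFree
  | .ite _ p q => p.loopFree && q.loopFree
  | .while _ _ => false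
  | _ => true

/-- An upper bound for the running time of a program without loops. -/
def Prog.bound : Prog → ℕ
  | .skip => 1
  | .setIVar _ e => e.cost + 1
  | .setIArr _ i e => i.cost + e.cost + 1
  | .setRVar _ e => e.cost + 1
  | .setRArr _ i e => i.cost + e.cost + 1
  | .seq p q => p.bound + q.bound
  | .ite b p q => b.cost + 1 + (p.bound + q.bound)
  | .while _ _ => 0

/-- The weakest precondition of a program without loops. -/
def Prog.wp : Prog → (Store → Prop) → Store → Prop
  | .skip, Q, s => Q s
  | .setIVar x e, Q, s => Q (s.setIVar x (e.eval s))
  | .setIArr a i e, Q, s => Q (s.setIArr a (i.eval s) (e.eval s))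
  | .setRVar x e, Q, s => Q (s.setRVar x (e.eval s))
  | .setRArr a i e, Q, s => Q (s.setRArr a (i.eval s) (e.eval s))
  | .seq p q, Q, s => p.wp (q.wp Q) s
  | .ite b p q, Q, s => (b.eval s → p.wp Q s) ∧ (¬ b.eval s → q.wp Q s)
  | .while _ _, _, _ => False

/-- Reduces straight-line code to a computation with `Prog.wp`. `Prog.bound` adds the costs of both
branches of a conditional, a crude bound that suffices up to constants. -/
theorem Prog.exec_of_wp (p : Prog) (hp : p.loopFree = true) :
    ∀ (s : Store) (Q : Store → Prop), p.wp Q s → Runs p s p.bound Q := by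
  induction p with
  | skip => exact fun s Q h => ⟨s, _, .skip s, le_rfl, h⟩
  | setIVar x e => exact fun s Q h => ⟨_, _, .setIVar s x e, le_rfl, h⟩
  | setIArr a i e => exact fun s Q h => ⟨_, _, .setIArr s a i e, le_rfl, h⟩
  | setRVar x e => exact fun s Q h => ⟨_, _, .setRVar s x e, le_rfl, h⟩
  | setRArr a i e => exact fun s Q h => ⟨_, _, .setRArr s a i e, le_rfl, h⟩
  | seq p q ihp ihq =>
    simp only [Prog.loopFree, Bool.and_eq_true] at hp
    exact fun s Q h => (ihp hp.1 s _ h).seq fun s' _ h' => ihq hp.2 s' Q h'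
  | ite b p q ihp ihq =>
    simp only [Prog.loopFree, Bool.and_eq_true] at hp
    exact fun s Q h => Runs.ite
      (fun hb => (ihp hp.1 s Q (h.1 hb)).imp (Nat.le_add_right _ _) fun _ _ h => h)
      (fun hb => (ihq hp.2 s Q (h.2 hb)).imp (Nat.le_add_left _ _) fun _ _ h => h)
  | _ => simp [Prog.loopFree] at hp

theorem Runs.of_wp {p : Prog} {s : Store} {T : ℕ} {Q : Store → Prop} (hp : p.loopFree = true)
    (hT : p.bound ≤ T) (h : p.wp Q s) : Runs p s T Q :=
  (p.exec_of_wp hp s Q h).imp hT fun _ _ h => h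

/-! Counting loops. -/

theorem Runs.while_count {b : BExp} {p : Prog} {T m : ℕ} (Inv : ℕ → Store → Prop) (s₀ : Store)
    (hstep : ∀ i < m, ∀ s, Frame p s₀ s → Inv i s → b.eval s ∧ Runs p s T (Inv (i + 1)))
    (hend : ∀ s, Frame p s₀ s → Inv m s → ¬ b.eval s) (h₀ : Inv 0 s₀) :
    Runs (.while b p) s₀ (m * (T + b.cost + 1) + b.cost + 1) (Inv m) := by
  suffices h : ∀ j i s, i + j = m → Frame p s₀ s → Inv i s →
      Runs (.while b p) s (j * (T + b.cost + 1) + b.cost + 1) (Inv m) from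
    h m 0 s₀ (by omega) (Frame.refl _ _) h₀
  intro j
  induction j with
  | zero =>
    intro i s hi hf hinv
    obtain rfl : i = m := by omega
    exact ⟨s, _, .whileFalse (hend s hf hinv), by omega, hinv⟩
  | succ j ih =>
    intro i s hi hf hinv
    obtain ⟨hb, s', t, he, ht, hq⟩ := hstep i (by omega) s hf hinv
    obtain ⟨s'', t', he', ht', hq'⟩ := ih (i + 1) s' (by omega) (hf.trans he.frame) hq
    refine ⟨s'', _, .whileTrue hb he he', ?_, hq'⟩
    rw [Nat.succ_mul]
    omega

/-- `for x := 0 to e - 1 do p`. -/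
def Prog.for (x : ℕ) (e : IExp) (p : Prog) : Prog :=
  .seq (.setIVar x (.lit 0))
    (.while (.ilt (.var x) e) (.seq p (.setIVar x (.add (.var x) (.lit 1)))))

/-- A counting loop; the invariant may not depend on the loop variable `x`, which the body may not
write. -/
theorem Runs.for {x : ℕ} {e : IExp} {p : Prog} {T T' m : ℕ} {s : Store} (Inv : ℕ → Store → Prop)
    (hx : p.writesIVar x = false)
    (he : ∀ s', Frame (.for x e p) s s' → e.eval s' = m)
    (hInv : ∀ i s' v, Inv i s' → Inv i (s'.setIVar x v))
    (h₀ : Inv 0 s)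
    (hstep : ∀ i < m, ∀ s', Frame (.for x e p) s s' → s'.ivar x = i → Inv i s' →
      Runs p s' T (Inv (i + 1)))
    (hT : T + e.cost + 7 ≤ T') :
    Runs (.for x e p) s (m * T' + e.cost + 5) (Inv m) := by
  have hF : ∀ s', Frame (.seq p (.setIVar x (.add (.var x) (.lit 1)))) (s.setIVar x 0) s' →
      Frame (.for x e p) s s' := by
    intro s' h
    refine Frame.trans (s' := s.setIVar x 0) ?_ (h.mono ?_ ?_ ?_ ?_)
    · exact (Exec.setIVar s x (.lit 0)).frame.mono
        (fun y hy => by simp_all [Prog.for, Prog.writesIVar])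
        (fun y hy => by simp_all [Prog.writesIArr])
        (fun y hy => by simp_all [Prog.writesRVar])
        (fun y hy => by simp_all [Prog.writesRArr])
    · exact fun y hy => by simp_all [Prog.for, Prog.writesIVar]
    · exact fun y hy => by simp_all [Prog.for, Prog.writesIArr]
    · exact fun y hy => by simp_all [Prog.for, Prog.writesRVar]
    · exact fun y hy => by simp_all [Prog.for, Prog.writesRArr]
  have hw := Runs.while_count (b := .ilt (.var x) e)
    (p := .seq p (.setIVar x (.add (.var x) (.lit 1)))) (T := T + 4) (m := m)
    (fun i s' => Inv i s' ∧ s'.ivar x = i) (s.setIVar x 0) ?_ ?_ ?_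
  · have h1 : Runs (.setIVar x (.lit 0)) s 2 (fun s' => s' = s.setIVar x 0) :=
      ⟨_, _, .setIVar s x (.lit 0), by simp [IExp.cost], rfl⟩
    refine (h1.seq (Q := Inv m)
      (T₂ := m * (T + 4 + (BExp.ilt (.var x) e).cost + 1) + (BExp.ilt (.var x) e).cost + 1)
      (fun s' _ h => ?_)).imp ?_ fun _ _ h => h
    · subst h
      exact hw.imp le_rfl fun _ _ h => h.1
    · have h2 := Nat.mul_le_mul_left m hT
      have h3 : m * (T + 4 + (BExp.ilt (.var x) e).cost + 1) = m * (T + e.cost + 7) := by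
        simp only [BExp.cost, IExp.cost]; ring
      have h4 : (BExp.ilt (.var x) e).cost = e.cost + 2 := by
        simp only [BExp.cost, IExp.cost]; ring
      omega
  · rintro i hi s' hf ⟨hinv, hxi⟩
    refine ⟨?_, ?_⟩
    · simp only [BExp.eval, IExp.eval, hxi, he s' (hF s' hf), hi]
    · refine (hstep i hi s' (hF s' hf) hxi hinv).seq fun s'' hf' h => ?_
      refine ⟨_, _, .setIVar _ _ _, by simp [IExp.cost], hInv _ _ _ h, ?_⟩
      simp [Store.setIVar, IExp.eval, hf'.ivar x hx, hxi]
  · rintro s' hf ⟨-, hxi⟩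
    simp only [BExp.eval, IExp.eval, hxi, he s' (hF s' hf), lt_irrefl, not_false_iff]
  · exact ⟨hInv _ _ _ h₀, by simp [Store.setIVar]⟩

end RAM

/-! ### Windows of symbols and their codes -/

namespace TreeTSP

/-- The number with the digits `b j, …, b (j + m - 1)` in base `N`, the last one least
significant. -/
def code (N : ℕ) (b : ℕ → ℕ) (j : ℕ) : ℕ → ℕ
  | 0 => 0
  | m + 1 => code N b j m * N + b (j + m)

def digit (N w i : ℕ) : ℕ := w / N ^ i % N

section Code

variable {N : ℕ} {b : ℕ → ℕ}

theorem code_lt (hb : ∀ t, b t < N) (j m : ℕ) : code N b j m < N ^ m := by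
  induction m with
  | zero => simp [code]
  | succ m ih =>
    have h1 := Nat.mul_le_mul_right N (Nat.succ_le_of_lt ih)
    have h2 := hb (j + m)
    rw [code, pow_succ]
    rw [Nat.succ_mul] at h1
    omega

/-- For a window of 2K + 1 symbols, dividing by the base drops the newest symbol and leaves the
state before the step. Its counterpart `code_mod_pow` drops the oldest symbol and leaves the state
after it. -/
theorem code_div (hb : ∀ t, b t < N) (j m : ℕ) : code N b j (m + 1) / N = code N b j m := by
  rw [code, mul_comm, Nat.mul_add_div (by have := hb 0; omega), Nat.div_eq_of_lt (hb _), add_zero]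

theorem code_mod (hb : ∀ t, b t < N) (j m : ℕ) : code N b j (m + 1) % N = b (j + m) := by
  rw [code, mul_comm, Nat.mul_add_mod, Nat.mod_eq_of_lt (hb _)]

theorem code_div_pow (hb : ∀ t, b t < N) (j m i : ℕ) :
    code N b j (m + i) / N ^ i = code N b j m := by
  induction i with
  | zero => simp
  | succ i ih =>
    rw [pow_succ', ← Nat.div_div_eq_div_mul, ← add_assoc, code_div hb, ih]

theorem digit_code (hb : ∀ t, b t < N) {j m i : ℕ} (hi : i ≤ m) :
    digit N (code N b j (m + 1)) i = b (j + m - i) := by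
  obtain ⟨a, rfl⟩ := Nat.exists_eq_add_of_le' hi
  rw [digit, show a + i + 1 = a + 1 + i by ring, code_div_pow hb, code_mod hb,
    show j + (a + i) - i = j + a by omega]

theorem code_succ' (j m : ℕ) :
    code N b j (m + 1) = b j * N ^ m + code N b (j + 1) m := by
  induction m with
  | zero => simp [code]
  | succ m ih =>
    rw [code, ih, code, pow_succ, show j + 1 + m = j + (m + 1) by ring]
    ring

theorem code_mod_pow (hb : ∀ t, b t < N) (j m : ℕ) :
    code N b j (m + 1) % N ^ m = code N b (j + 1) m := by
  rw [code_succ', mul_comm, Nat.mul_add_mod, Nat.mod_eq_of_lt (code_lt hb _ _)]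

theorem code_eq_zero {j m : ℕ} (h : ∀ i < m, b (j + i) = 0) : code N b j m = 0 := by
  induction m with
  | zero => rfl
  | succ m ih =>
    rw [code, ih fun i hi => h i (by omega), h m (by omega), zero_mul]

theorem eq_zero_of_code (hN : 0 < N) {j m : ℕ} (h : code N b j m = 0) : ∀ i < m, b (j + i) = 0 := by
  induction m with
  | zero => omega
  | succ m ih =>
    rw [code] at h
    have h1 : code N b j m * N = 0 := by omega
    have h2 : code N b j m = 0 := by
      rcases Nat.mul_eq_zero.mp h1 with h | h <;> omega
    intro i hi
    rcases Nat.lt_succ_iff_lt_or_eq.mp hi with hi | rfl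
    · exact ih h2 i hi
    · omega

end Code

/-! ### Rooted trees and layouts of connected pieces

The vertices of a tree are the symbols `1, …, n`, with root `1`; the symbol `0` is a blank. A
layout of a piece with top vertex `v` is a sequence of symbols. -/

/-- `par` is the parent function of a rooted tree; `rk` increases away from the root. -/
structure Rooted (n : ℕ) (par rk : ℕ → ℕ) : Prop where
  root : par 1 = n + 1
  one_le : ∀ x, 1 < x → x ≤ n → 1 ≤ par x
  le : ∀ x, 1 < x → x ≤ n → par x ≤ n
  rk_par : ∀ x, 1 < x → x ≤ n → rk (par x) < rk x
  rk_lt : ∀ x, 1 ≤ x → x ≤ n → rk x < n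

/-- The newest symbol of the window `w` does not occur elsewhere in `w`. -/
def WinNew (n K w : ℕ) : Prop :=
  ∀ i, 0 < i → i ≤ 2 * K → digit (n + 1) w 0 ≠ 0 → digit (n + 1) w i ≠ digit (n + 1) w 0

/-- The parent of the central symbol of the window `w` occurs in `w`. -/
def WinFound (n K : ℕ) (par : ℕ → ℕ) (w : ℕ) : Prop :=
  ∃ i ≤ 2 * K, digit (n + 1) w i = par (digit (n + 1) w K)

/-- The window `w` may arise by appending the symbol number `j` of a layout with top `v`. -/
def Admissible (n K : ℕ) (par : ℕ → ℕ) (v j w : ℕ) : Prop :=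
  WinNew n K w ∧ (digit (n + 1) w 0 = v ↔ j = n) ∧
    (digit (n + 1) w K = 0 ∨ digit (n + 1) w K = v ∨ WinFound n K par w)

/-- `fw w` is the contribution of the edge from the central symbol of `w` to its parent. -/
def EdgeGain (n K : ℕ) (par : ℕ → ℕ) (F wt : ℕ → ℝ) (fw : ℕ → ℝ) : Prop :=
  ∀ w < (n + 1) ^ (2 * K + 1),
    (WinFound n K par w → ∃ i ≤ 2 * K, digit (n + 1) w i = par (digit (n + 1) w K) ∧
      fw w = F ((i - K) + (K - i)) * wt (digit (n + 1) w K)) ∧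
    (¬ WinFound n K par w → fw w = 0)

/-- The top earns nothing: its parent edge leaves the piece, and its own potential is the number
being computed. Every other vertex pays its potential, which stands for the marginal optimum it
gives up by joining this piece. -/
noncomputable def gain (n K : ℕ) (fw H : ℕ → ℝ) (v w : ℕ) : ℝ :=
  if digit (n + 1) w K = v then 0 else fw w + H (digit (n + 1) w K)

/-- `b` is a layout with top `v`, preceded by `2 K` blanks. -/
structure Layout (n K : ℕ) (par : ℕ → ℕ) (v : ℕ) (b : ℕ → ℕ) : Prop where
  le : ∀ t, b t ≤ n
  pre : ∀ t < 2 * K, b t = 0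
  post : ∀ t, 2 * n + 2 * K ≤ t → b t = 0
  step : ∀ j < 2 * n + 2 * K, Admissible n K par v j (code (n + 1) b j (2 * K + 1))

/-- Each symbol of a layout is central in exactly one window, and at that moment all symbols within
K on both sides are visible, so its parent edge can be priced. -/
noncomputable def value (n K : ℕ) (fw H : ℕ → ℝ) (v : ℕ) (b : ℕ → ℕ) : ℝ :=
  ∑ j ∈ Finset.range (2 * n + 2 * K), gain n K fw H v (code (n + 1) b j (2 * K + 1))

namespace Layout

variable {n K : ℕ} {par rk : ℕ → ℕ} {v : ℕ} {b : ℕ → ℕ}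

theorem lt_succ (hb : Layout n K par v b) (t : ℕ) : b t < n + 1 := Nat.lt_succ_of_le (hb.le t)

theorem digit_eq (hb : Layout n K par v b) {j i : ℕ} (hi : i ≤ 2 * K) :
    digit (n + 1) (code (n + 1) b j (2 * K + 1)) i = b (j + 2 * K - i) :=
  digit_code hb.lt_succ hi

theorem ne_of_near (hb : Layout n K par v b) {t t' : ℕ} (h : t < t') (h' : t' ≤ t + 2 * K)
    (h0 : b t' ≠ 0) : b t ≠ b t' := by
  have h1 : 2 * K ≤ t' := by
    by_contra hlt
    exact h0 (hb.pre t' (by omega))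
  have h2 : t' < 2 * n + 2 * K := by
    by_contra hlt
    exact h0 (hb.post t' (by omega))
  have := (hb.step (t' - 2 * K) (by omega)).1 (t' - t) (by omega) (by omega)
  rw [hb.digit_eq (by omega), hb.digit_eq (by omega),
    show t' - 2 * K + 2 * K - 0 = t' by omega,
    show t' - 2 * K + 2 * K - (t' - t) = t by omega] at this
  exact this h0

/-- The newest symbol of window number j has index j + 2K, so the clause `j = n` of `Admissible`
pins the top to one index. This uniqueness is the base case of `inj`. -/
theorem eq_top_iff (hb : Layout n K par v b) (hv : v ≠ 0) (hvn : v ≤ n) {t : ℕ} :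
    b t = v ↔ t = n + 2 * K := by
  by_cases h1 : t < 2 * K
  · rw [hb.pre t h1]
    omega
  by_cases h2 : 2 * n + 2 * K ≤ t
  · rw [hb.post t h2]
    omega
  have := (hb.step (t - 2 * K) (by omega)).2.1
  rw [hb.digit_eq (by omega), show t - 2 * K + 2 * K - 0 = t by omega] at this
  rw [this]
  omega

theorem exists_par (hb : Layout n K par v b) {t : ℕ} (h0 : b t ≠ 0) (hv : b t ≠ v) :
    ∃ t', b t' = par (b t) ∧ t' ≤ t + K ∧ t ≤ t' + K := by
  have h1 : 2 * K ≤ t := by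
    by_contra hlt
    exact h0 (hb.pre t (by omega))
  have h2 : t < 2 * n + 2 * K := by
    by_contra hlt
    exact h0 (hb.post t (by omega))
  have := (hb.step (t - K) (by omega)).2.2
  rw [WinFound, hb.digit_eq (by omega), show t - K + 2 * K - K = t by omega] at this
  obtain ⟨i, hi, h⟩ := (this.resolve_left h0).resolve_left hv
  rw [hb.digit_eq hi] at h
  exact ⟨_, h, by omega, by omega⟩

/-- The root has the parent n + 1, which is not a symbol, so the root can occur only as the top. -/
theorem one_lt (hb : Layout n K par v b) (hT : Rooted n par rk) {t : ℕ} (h0 : b t ≠ 0)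
    (hv : b t ≠ v) : 1 < b t := by
  by_contra h
  obtain ⟨t', h', -⟩ := hb.exists_par h0 hv
  rw [show b t = 1 by omega, hT.root] at h'
  have := hb.le t'
  omega

/-- Induction on the rank. Two copies of a vertex have their parents at the same index, by
induction. Both copies are within K of it, hence within 2K of each other, which `ne_of_near`
excludes. This is where local checks yield a global property. -/
theorem inj (hb : Layout n K par v b) (hT : Rooted n par rk) (hv : v ≠ 0) (hvn : v ≤ n) :
    ∀ t t', b t ≠ 0 → b t = b t' → t = t' := by
  suffices h : ∀ r t t', rk (b t) = r → b t ≠ 0 → b t = b t' → t = t' from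
    fun t t' => h _ t t' rfl
  intro r
  induction r using Nat.strong_induction_on with
  | _ r ih =>
    intro t t' hr h0 he
    by_cases htv : b t = v
    · rw [(hb.eq_top_iff hv hvn).mp htv, (hb.eq_top_iff (t := t') hv hvn).mp (by rw [← he]; exact htv)]
    obtain ⟨u, hu, hu1, hu2⟩ := hb.exists_par h0 htv
    obtain ⟨u', hu', hu1', hu2'⟩ := hb.exists_par (by rw [← he]; exact h0) (by rw [← he]; exact htv)
    have h1 := hb.one_lt hT h0 htv
    have h2 := hT.rk_par _ h1 (hb.le t)
    have h3 := hT.one_le _ h1 (hb.le t)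
    have h4 : u = u' := ih _ (by rw [← hr]; exact h2) u u' (by rw [hu]) (by omega) (by rw [hu, hu', he])
    rcases lt_trichotomy t t' with h | h | h
    · exact absurd he (hb.ne_of_near h (by omega) (by rw [← he]; exact h0))
    · exact h
    · exact absurd he.symm (hb.ne_of_near h (by omega) h0)

/-- Following parents inside the layout lowers the rank and can end only at the top. Consequently
potentials may be computed in order of decreasing rank. -/
theorem rk_lt (hb : Layout n K par v b) (hT : Rooted n par rk) :
    ∀ t, b t ≠ 0 → b t ≠ v → rk v < rk (b t) := by
  suffices h : ∀ r t, rk (b t) = r → b t ≠ 0 → b t ≠ v → rk v < rk (b t) from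
    fun t => h _ t rfl
  intro r
  induction r using Nat.strong_induction_on with
  | _ r ih =>
    intro t hr h0 htv
    obtain ⟨u, hu, -⟩ := hb.exists_par h0 htv
    have h1 := hb.one_lt hT h0 htv
    have h2 := hT.rk_par _ h1 (hb.le t)
    have h3 := hT.one_le _ h1 (hb.le t)
    by_cases huv : b u = v
    · rwa [← huv, hu]
    · have := ih _ (by rw [hu, ← hr]; exact h2) u rfl (by omega) huv
      rw [hu] at this
      omega

/-- The value of a layout in terms of the vertices `X` it places and their positions. -/
theorem value_eq (hb : Layout n K par v b) (hT : Rooted n par rk) (hv : v ≠ 0) (hvn : v ≤ n)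
    {F wt fw H : ℕ → ℝ} (hfw : EdgeGain n K par F wt fw) (hwt : wt 0 = 0) (hH : H 0 = 0)
    {X : Finset ℕ} {pos : ℕ → ℕ} (hX : ∀ x, x ∈ X ↔ x ≠ 0 ∧ ∃ t, b t = x)
    (hpos : ∀ x ∈ X, b (pos x) = x) :
    value n K fw H v b = ∑ x ∈ X.erase v,
      (F ((pos x - pos (par x)) + (pos (par x) - pos x)) * wt x + H x) := by
  set T : ℕ → ℝ := fun x => F ((pos x - pos (par x)) + (pos (par x) - pos x)) * wt x + H x with hTdef
  have hinj := hb.inj hT hv hvn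
  have key : ∀ j ∈ Finset.range (2 * n + 2 * K), gain n K fw H v (code (n + 1) b j (2 * K + 1)) =
      if b (j + K) ≠ 0 ∧ b (j + K) ≠ v then T (b (j + K)) else 0 := by
    intro j hj
    rw [Finset.mem_range] at hj
    have hw := hfw _ (code_lt hb.lt_succ j (2 * K + 1))
    have hcen : digit (n + 1) (code (n + 1) b j (2 * K + 1)) K = b (j + K) := by
      rw [hb.digit_eq (by omega), show j + 2 * K - K = j + K by omega]
    rw [gain, hcen]
    rw [hcen] at hw
    by_cases h1 : b (j + K) = v
    · simp [h1]
    -- A blank at the centre contributes nothing because `wt 0` and `H 0` vanish, whatever `par 0`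
    -- is.
    by_cases h0 : b (j + K) = 0
    · rw [if_neg h1, if_neg (by simp [h0]), h0, hH, add_zero]
      by_cases hf : WinFound n K par (code (n + 1) b j (2 * K + 1))
      · obtain ⟨i, -, -, h⟩ := hw.1 hf
        rw [h, h0, hwt, mul_zero]
      · exact hw.2 hf
    · rw [if_neg h1, if_pos ⟨h0, h1⟩, hTdef]
      dsimp only
      congr 1
      have hf := (((hb.step j hj).2.2.resolve_left (by rwa [hcen])).resolve_left (by rwa [hcen]))
      obtain ⟨i, hi, hpar, h⟩ := hw.1 hf
      rw [h]
      congr 2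
      rw [hb.digit_eq hi] at hpar
      have hx := hb.one_lt hT h0 h1
      have h3 := hT.one_le _ hx (hb.le _)
      have e1 : pos (b (j + K)) = j + K := by
        refine (hinj _ _ h0 ?_).symm
        rw [hpos _ ((hX _).mpr ⟨h0, _, rfl⟩)]
      have e2 : pos (par (b (j + K))) = j + 2 * K - i := by
        refine (hinj _ _ (by omega) ?_).symm
        rw [hpos _ ((hX _).mpr ⟨by omega, _, hpar⟩), hpar]
      rw [e1, e2]
      omega
  rw [value, Finset.sum_congr rfl key, ← Finset.sum_filter]
  have himg : X.erase v = ((Finset.range (2 * n + 2 * K)).filter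
      (fun j => b (j + K) ≠ 0 ∧ b (j + K) ≠ v)).image (fun j => b (j + K)) := by
    ext x
    simp only [Finset.mem_erase, Finset.mem_image, Finset.mem_filter, Finset.mem_range, hX]
    constructor
    · rintro ⟨hxv, h0, t, rfl⟩
      have h1 : 2 * K ≤ t := by
        by_contra hlt
        exact h0 (hb.pre t (by omega))
      have h2 : t < 2 * n + 2 * K := by
        by_contra hlt
        exact h0 (hb.post t (by omega))
      have h3 : t - K + K = t := by omega
      exact ⟨t - K, by rw [h3]; exact ⟨by omega, h0, hxv⟩, by rw [h3]⟩
    · rintro ⟨j, ⟨-, h0, h1⟩, rfl⟩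
      exact ⟨h1, h0, _, rfl⟩
  rw [himg, Finset.sum_image]
  intro i hi j hj hij
  have := hinj (i + K) (j + K) (by simpa using (Finset.mem_filter.mp hi).2.1) hij
  omega

/-- The value depends only on the potentials of the proper descendants of the top. -/
theorem value_congr (hb : Layout n K par v b) (hT : Rooted n par rk)
    {fw H H' : ℕ → ℝ} (h0 : H 0 = H' 0) (h : ∀ x, x ≤ n → rk v < rk x → H x = H' x) :
    value n K fw H v b = value n K fw H' v b := by
  refine Finset.sum_congr rfl fun j _ => ?_
  rw [gain, gain]
  have hcen : digit (n + 1) (code (n + 1) b j (2 * K + 1)) K = b (j + K) := by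
    rw [hb.digit_eq (by omega), show j + 2 * K - K = j + K by omega]
  rw [hcen]
  split_ifs with h1
  · rfl
  · congr 1
    by_cases h2 : b (j + K) = 0
    · rw [h2, h0]
    · exact h _ (hb.le _) (hb.rk_lt hT _ h2 h1)

end Layout

/-- A set of vertices, connected through its parents, whose positions `δ` are close along edges
gives a layout. -/
theorem exists_layout {n K v : ℕ} {par δ : ℕ → ℕ} {X : Finset ℕ}
    (hX : ∀ x ∈ X, 1 ≤ x ∧ x ≤ n) (hδ : ∀ x ∈ X, 1 ≤ δ x ∧ δ x ≤ n)
    (hinj : ∀ x ∈ X, ∀ y ∈ X, δ x = δ y → x = y) (hv : v ∈ X)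
    (hpar : ∀ x ∈ X, x ≠ v → par x ∈ X ∧ δ x ≤ δ (par x) + K ∧ δ (par x) ≤ δ x + K) :
    ∃ b, Layout n K par v b ∧
      ∀ t x, x ≠ 0 → (b t = x ↔ x ∈ X ∧ t + δ v = 2 * K + n + δ x) := by
  classical
  -- The vertex x goes to index 2K + n + δ x - δ v, which puts v at n + 2K. Since |δ x - δ v| < n,
  -- all vertices stay between the leading and the trailing blanks.
  let b : ℕ → ℕ := fun t =>
    if h : ∃ x ∈ X, t + δ v = 2 * K + n + δ x then h.choose else 0
  have hb : ∀ t x, x ≠ 0 → (b t = x ↔ x ∈ X ∧ t + δ v = 2 * K + n + δ x) := by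
    intro t x hx
    by_cases h : ∃ x ∈ X, t + δ v = 2 * K + n + δ x
    · have hbt : b t = h.choose := dif_pos h
      obtain ⟨h1, h2⟩ := h.choose_spec
      constructor
      · intro e
        rw [← e, hbt]
        exact ⟨h1, h2⟩
      · rintro ⟨h3, h4⟩
        rw [hbt]
        exact hinj _ h1 _ h3 (by omega)
    · have hbt : b t = 0 := dif_neg h
      rw [hbt]
      exact ⟨fun e => absurd e.symm hx, fun e => absurd ⟨x, e⟩ h⟩
  have hne : ∀ t, b t ≠ 0 → b t ∈ X ∧ t + δ v = 2 * K + n + δ (b t) := fun t h =>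
    (hb t _ h).mp rfl
  have hle : ∀ t, b t ≤ n := by
    intro t
    by_cases h : b t = 0
    · omega
    · exact (hX _ (hne t h).1).2
  have hv1 := hX v hv
  have hδv := hδ v hv
  refine ⟨b, ⟨hle, ?_, ?_, ?_⟩, hb⟩
  · intro t ht
    by_contra h
    obtain ⟨h1, h2⟩ := hne t h
    have := hδ _ h1
    omega
  · intro t ht
    by_contra h
    obtain ⟨h1, h2⟩ := hne t h
    have := hδ _ h1
    omega
  · intro j hj
    have hd : ∀ i ≤ 2 * K, digit (n + 1) (code (n + 1) b j (2 * K + 1)) i = b (j + 2 * K - i) :=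
      fun i hi => digit_code (fun t => Nat.lt_succ_of_le (hle t)) hi
    refine ⟨?_, ?_, ?_⟩
    · intro i hi hi2 h0 he
      rw [hd 0 (by omega)] at h0 he
      rw [hd i hi2] at he
      have h1 := (hne _ h0).2
      have h2 := (hne (j + 2 * K - i) (by rw [he]; exact h0)).2
      rw [he] at h2
      omega
    · rw [hd 0 (by omega), hb _ _ (by omega)]
      constructor
      · rintro ⟨-, h⟩; omega
      · rintro rfl; exact ⟨hv, by omega⟩
    · rw [WinFound, hd K (by omega), show j + 2 * K - K = j + K by omega]
      by_cases h0 : b (j + K) = 0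
      · exact Or.inl h0
      by_cases h1 : b (j + K) = v
      · exact Or.inr (Or.inl h1)
      refine Or.inr (Or.inr ?_)
      obtain ⟨h2, h3⟩ := hne _ h0
      obtain ⟨h4, h5, h6⟩ := hpar _ h2 h1
      have h7 := hδ _ h2
      have h8 := hδ _ h4
      -- Digit i of the window is the symbol at index j + 2K - i. The parent sits at j + K + δ(par
      -- x) - δ x, and equating the two gives this i.
      refine ⟨δ (b (j + K)) + K - δ (par (b (j + K))), by omega, ?_⟩
      rw [hd _ (by omega), hb _ _ (by have := hX _ h4; omega)]
      exact ⟨h4, by omega⟩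

/-! ### Optimality of potentials -/

/-- Weak duality: a potential that no layout can beat bounds the objective. -/
theorem sum_le_neg_potential {n K : ℕ} {par rk δ : ℕ → ℕ} {F wt fw H : ℕ → ℝ}
    (hT : Rooted n par rk) (hfw : EdgeGain n K par F wt fw) (hwt : wt 0 = 0) (hwt1 : wt 1 = 0)
    (hH : H 0 = 0) (hF : ∀ a, K < a → a < n → F a = 0)
    (hopt : ∀ v, 1 ≤ v → v ≤ n → ∀ b, Layout n K par v b → H v + value n K fw H v b ≤ 0)
    (hδ : ∀ x ∈ Finset.Icc 1 n, 1 ≤ δ x ∧ δ x ≤ n)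
    (hinj : ∀ x ∈ Finset.Icc 1 n, ∀ y ∈ Finset.Icc 1 n, δ x = δ y → x = y) :
    ∑ x ∈ Finset.Icc 1 n, F ((δ x - δ (par x)) + (δ (par x) - δ x)) * wt x ≤
      - ∑ x ∈ Finset.Icc 1 n, H x := by
  classical
  set V := Finset.Icc 1 n with hV
  have memV : ∀ x, x ∈ V ↔ 1 ≤ x ∧ x ≤ n := fun x => by rw [hV, Finset.mem_Icc]
  set g : ℕ → ℝ := fun x => F ((δ x - δ (par x)) + (δ (par x) - δ x)) * wt x with hg
  -- The cut vertices are the tops of the pieces. The root is one of them by convention, so every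
  -- vertex has a cut ancestor.
  let cut : ℕ → Prop := fun x => x = 1 ∨ K < (δ x - δ (par x)) + (δ (par x) - δ x)
  let φ : ℕ → ℕ := fun x => if cut x then x else par x
  have φcut : ∀ x, cut x → φ x = x := fun x h => if_pos h
  have φnot : ∀ x, ¬ cut x → φ x = par x := fun x h => if_neg h
  have parV : ∀ x ∈ V, x ≠ 1 → par x ∈ V := by
    intro x hx h1
    rw [memV] at hx ⊢
    exact ⟨hT.one_le x (by omega) hx.2, hT.le x (by omega) hx.2⟩
  have φV : ∀ x ∈ V, φ x ∈ V := by
    intro x hx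
    by_cases h : cut x
    · rwa [φcut x h]
    · rw [φnot x h]
      exact parV x hx fun h1 => h (Or.inl h1)
  have φiterV : ∀ m, ∀ x ∈ V, φ^[m] x ∈ V := by
    intro m
    induction m with
    | zero => exact fun x hx => hx
    | succ m ih => exact fun x hx => by rw [Function.iterate_succ_apply]; exact ih _ (φV x hx)
  have φfix : ∀ m, ∀ x ∈ V, rk x ≤ m → cut (φ^[m] x) := by
    intro m
    induction m with
    | zero =>
      intro x hx hr
      by_contra h
      have hx1 : x ≠ 1 := fun h1 => h (Or.inl h1)
      rw [memV] at hx
      have := hT.rk_par x (by omega) hx.2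
      omega
    | succ m ih =>
      intro x hx hr
      by_cases h : cut x
      · have : ∀ i, φ^[i] x = x := fun i => Function.iterate_fixed (φcut x h) i
        rwa [this]
      · rw [Function.iterate_succ_apply]
        refine ih _ (φV x hx) ?_
        have hx1 : x ≠ 1 := fun h1 => h (Or.inl h1)
        rw [memV] at hx
        have := hT.rk_par x (by omega) hx.2
        rw [φnot x h]
        omega
  -- Ranks are below n and drop at each uncut step, so n iterations reach the cut ancestor.
  let top : ℕ → ℕ := φ^[n]
  have topcut : ∀ x ∈ V, cut (top x) := fun x hx =>
    φfix n x hx (hT.rk_lt x ((memV x).mp hx).1 ((memV x).mp hx).2).le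
  have topφ : ∀ x ∈ V, top (φ x) = top x := by
    intro x hx
    have : φ^[n] (φ x) = φ (φ^[n] x) := by
      rw [← Function.iterate_succ_apply, Function.iterate_succ_apply']
    exact this.trans (φcut _ (topcut x hx))
  have topfix : ∀ x, cut x → top x = x := fun x h => Function.iterate_fixed (φcut x h) n
  have topV : ∀ x ∈ V, top x ∈ V := φiterV n
  have gcut : ∀ x ∈ V, cut x → g x = 0 := by
    intro x hx h
    by_cases h1 : x = 1
    · simp [hg, h1, hwt1]
    · have h2 := h.resolve_left h1
      have h3 := hδ x hx
      have h4 := hδ _ (parV x hx h1)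
      simp only [hg]
      rw [hF _ h2 (by omega), zero_mul]
  -- Each piece is a layout of its top, and the top's own edge earns 0 because it is cut, so the
  -- optimality of `H` bounds the piece.
  have piece : ∀ v ∈ V, ∑ x ∈ V with top x = v, (H x + g x) ≤ 0 := by
    intro v hv
    by_cases hvc : cut v
    · set X := V.filter (fun x => top x = v) with hX
      have hvX : v ∈ X := Finset.mem_filter.mpr ⟨hv, topfix v hvc⟩
      have hXV : ∀ x ∈ X, x ∈ V := fun x hx => (Finset.mem_filter.mp hx).1
      obtain ⟨b, hb, hbx⟩ := exists_layout (n := n) (K := K) (par := par) (δ := δ) (X := X) (v := v)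
        (fun x hx => (memV x).mp (hXV x hx)) (fun x hx => hδ x (hXV x hx))
        (fun x hx y hy => hinj x (hXV x hx) y (hXV y hy)) hvX (by
          intro x hx hxv
          obtain ⟨h1, h2⟩ := Finset.mem_filter.mp hx
          have hnc : ¬ cut x := fun h => hxv (by rw [← h2, topfix x h])
          have hx1 : x ≠ 1 := fun h1 => hnc (Or.inl h1)
          have hle : ¬ K < (δ x - δ (par x)) + (δ (par x) - δ x) := fun h1 => hnc (Or.inr h1)
          refine ⟨Finset.mem_filter.mpr ⟨parV x h1 hx1, ?_⟩, by omega, by omega⟩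
          rw [← φnot x hnc, topφ x h1, h2])
      have hv1 := (memV v).mp hv
      have hδv := hδ v hv
      have hval := hb.value_eq hT (by omega) hv1.2 hfw hwt hH (X := X)
        (pos := fun x => 2 * K + n + δ x - δ v) (by
          intro x
          constructor
          · intro hx
            have h1 := (memV x).mp (hXV x hx)
            refine ⟨by omega, 2 * K + n + δ x - δ v, ?_⟩
            rw [hbx _ _ (by omega)]
            exact ⟨hx, by omega⟩
          · rintro ⟨h0, t, ht⟩
            exact ((hbx t x h0).mp ht).1) (by
          intro x hx
          have h1 := (memV x).mp (hXV x hx)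
          rw [hbx _ _ (by omega)]
          exact ⟨hx, by omega⟩)
      have hle := hopt v hv1.1 hv1.2 b hb
      rw [hval] at hle
      rw [← Finset.add_sum_erase _ _ hvX, gcut v hv hvc, add_zero]
      refine le_trans (le_of_eq ?_) hle
      congr 1
      refine Finset.sum_congr rfl fun x hx => ?_
      rw [add_comm, hg]
      dsimp only
      congr 3
      have := hδ _ (hXV x (Finset.mem_of_mem_erase hx))
      by_cases hx1 : par x ∈ V
      · have := hδ _ hx1
        omega
      · exfalso
        refine hx1 (parV x (hXV x (Finset.mem_of_mem_erase hx)) ?_)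
        rintro rfl
        have h2 := (Finset.mem_filter.mp (Finset.mem_of_mem_erase hx)).2
        exact (Finset.ne_of_mem_erase hx) (by rw [← h2, topfix 1 (Or.inl rfl)])
    · rw [Finset.filter_false_of_mem, Finset.sum_empty]
      intro x hx h
      exact hvc (h ▸ topcut x hx)
  have total : ∑ x ∈ V, (H x + g x) ≤ 0 := by
    rw [← Finset.sum_fiberwise_of_maps_to topV]
    exact Finset.sum_nonpos piece
  rw [Finset.sum_add_distrib] at total
  linarith

/-! ### Assembling layouts into a sequencing -/

/-- The vertices in `P` have been placed at the positions `1, …, cnt`, such that the edges to their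
parents account for their potentials. -/
structure Placed (n : ℕ) (par : ℕ → ℕ) (F wt H : ℕ → ℝ) (P : Finset ℕ) (pos : ℕ → ℕ) (cnt : ℕ) :
    Prop where
  mem : ∀ x, x ∈ P ↔ 1 ≤ x ∧ x ≤ n ∧ pos x ≠ 0
  inj : ∀ x ∈ P, ∀ y ∈ P, pos x = pos y → x = y
  le : ∀ x ∈ P, pos x ≤ cnt
  card : P.card = cnt
  closed : ∀ x ∈ P, x ≠ 1 → par x ∈ P
  potential : 0 ≤ ∑ x ∈ P, (H x + F ((pos x - pos (par x)) + (pos (par x) - pos x)) * wt x)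

theorem count_add_le (p : ℕ → Prop) [DecidablePred p] (a b : ℕ) :
    Nat.count p (a + b) ≤ Nat.count p a + b := by
  rw [Nat.count_add]
  exact Nat.add_le_add_left (Nat.count_le _) _

/-- The new layout is disjoint from `P`: `P` is closed under parents, so a common vertex would drag
the top v into `P`. New positions count the non-blank symbols, which never lengthens an edge, so the
value certified by `hval` is still earned. -/
theorem Placed.place {n K : ℕ} {par rk : ℕ → ℕ} {F wt H fw : ℕ → ℝ} {P : Finset ℕ}
    {pos pos' b : ℕ → ℕ} {cnt v : ℕ} (hP : Placed n par F wt H P pos cnt)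
    (hT : Rooted n par rk) (hfw : EdgeGain n K par F wt fw) (hwt : wt 0 = 0) (hwt1 : wt 1 = 0)
    (hwt0 : ∀ x, 0 ≤ wt x) (hH : H 0 = 0) (hF0 : ∀ a, 0 ≤ F a)
    (hF : ∀ a a', 1 ≤ a → a ≤ a' → F a' ≤ F a)
    (hb : Layout n K par v b) (hv : 1 ≤ v) (hvn : v ≤ n) (hvP : v ∉ P)
    (hvpar : v ≠ 1 → par v ∈ P) (hval : 0 ≤ H v + value n K fw H v b)
    (h₁ : ∀ t, b t ≠ 0 → pos' (b t) = cnt + Nat.count (fun t => b t ≠ 0) t + 1)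
    (h₂ : ∀ x, x ≠ 0 → (∀ t, b t ≠ x) → pos' x = pos x) :
    ∃ P', P ⊆ P' ∧ v ∈ P' ∧ Placed n par F wt H P' pos'
      (cnt + Nat.count (fun t => b t ≠ 0) (2 * n + 2 * K)) := by
  classical
  set X := ((Finset.range (2 * n + 2 * K)).filter (fun t => b t ≠ 0)).image b with hXdef
  have hlt : ∀ t, b t ≠ 0 → t < 2 * n + 2 * K := by
    intro t h
    by_contra hlt
    exact h (hb.post t (by omega))
  have hX : ∀ x, x ∈ X ↔ x ≠ 0 ∧ ∃ t, b t = x := by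
    intro x
    simp only [hXdef, Finset.mem_image, Finset.mem_filter, Finset.mem_range]
    constructor
    · rintro ⟨t, ⟨-, h⟩, rfl⟩
      exact ⟨h, t, rfl⟩
    · rintro ⟨h, t, rfl⟩
      exact ⟨t, ⟨hlt t h, h⟩, rfl⟩
  have hinj := hb.inj hT (by omega) hvn
  have hcardX : X.card = Nat.count (fun t => b t ≠ 0) (2 * n + 2 * K) := by
    rw [Nat.count_eq_card_filter_range, hXdef, Finset.card_image_of_injOn]
    intro s hs t ht hst
    exact hinj s t (by simpa using (Finset.mem_filter.mp hs).2) hst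
  have hvX : v ∈ X := by
    refine (hX v).mpr ⟨by omega, n + 2 * K, ?_⟩
    rw [hb.eq_top_iff (by omega) hvn]
  have hparX : ∀ x ∈ X, x ≠ v → 1 < x ∧ x ≤ n ∧ par x ∈ X := by
    intro x hx hxv
    obtain ⟨h0, t, rfl⟩ := (hX x).mp hx
    obtain ⟨t', ht', -⟩ := hb.exists_par h0 hxv
    have h1 := hb.one_lt hT h0 hxv
    have h2 := hT.one_le _ h1 (hb.le _)
    exact ⟨h1, hb.le _, (hX _).mpr ⟨by omega, t', ht'⟩⟩
  have hdisj : ∀ x ∈ X, x ∉ P := by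
    suffices h : ∀ r x, rk x = r → x ∈ X → x ∉ P from fun x => h _ x rfl
    intro r
    induction r using Nat.strong_induction_on with
    | _ r ih =>
      intro x hr hx hxP
      by_cases hxv : x = v
      · exact hvP (hxv ▸ hxP)
      obtain ⟨h1, h2, h3⟩ := hparX x hx hxv
      exact ih _ (hr ▸ hT.rk_par x h1 h2) _ rfl h3 (hP.closed x hxP (by omega))
  have hD : Disjoint P X := Finset.disjoint_right.mpr hdisj
  have hpos0 : ∀ x ∈ P, pos' x = pos x := by
    intro x hx
    have := (hP.mem x).mp hx
    refine h₂ x (by omega) fun t ht => hdisj x ((hX x).mpr ⟨by omega, t, ht⟩) hx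
  have hposX : ∀ x ∈ X, ∃ t, b t = x ∧ pos' x = cnt + Nat.count (fun t => b t ≠ 0) t + 1 := by
    intro x hx
    obtain ⟨h0, t, rfl⟩ := (hX x).mp hx
    exact ⟨t, rfl, h₁ t h0⟩
  have hcount : ∀ t, b t ≠ 0 → Nat.count (fun t => b t ≠ 0) t <
      Nat.count (fun t => b t ≠ 0) (2 * n + 2 * K) := fun t h =>
    Nat.count_strict_mono (p := fun t => b t ≠ 0) h (hlt t h)
  refine ⟨P ∪ X, Finset.subset_union_left, Finset.mem_union_right _ hvX, ?_, ?_, ?_, ?_, ?_, ?_⟩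
  · intro x
    rw [Finset.mem_union]
    by_cases hx : x ∈ X
    · obtain ⟨t, rfl, h⟩ := hposX x hx
      have h0 := ((hX _).mp hx).1
      have := hb.le t
      simp only [hx, or_true, true_iff]
      omega
    · simp only [hx, or_false]
      rw [hP.mem]
      by_cases h0 : x = 0
      · simp [h0]
      · rw [h₂ x h0 fun t ht => hx ((hX x).mpr ⟨h0, t, ht⟩)]
  · have hPX : ∀ x ∈ P, ∀ y ∈ X, pos' x ≠ pos' y := by
      intro x hx y hy
      obtain ⟨t, -, h⟩ := hposX y hy
      rw [hpos0 x hx, h]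
      have := hP.le x hx
      omega
    intro x hx y hy hxy
    rcases Finset.mem_union.mp hx with hx | hx <;> rcases Finset.mem_union.mp hy with hy | hy
    · rw [hpos0 x hx, hpos0 y hy] at hxy
      exact hP.inj x hx y hy hxy
    · exact absurd hxy (hPX x hx y hy)
    · exact absurd hxy.symm (hPX y hy x hx)
    · obtain ⟨t, rfl, h⟩ := hposX x hx
      obtain ⟨t', rfl, h'⟩ := hposX y hy
      have h0 := ((hX _).mp hx).1
      have h0' := ((hX _).mp hy).1
      rcases lt_trichotomy t t' with hlt | rfl | hlt
      · have := Nat.count_strict_mono (p := fun t => b t ≠ 0) h0 hlt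
        omega
      · rfl
      · have := Nat.count_strict_mono (p := fun t => b t ≠ 0) h0' hlt
        omega
  · intro x hx
    rcases Finset.mem_union.mp hx with hx | hx
    · rw [hpos0 x hx]
      have := hP.le x hx
      omega
    · obtain ⟨t, rfl, h⟩ := hposX x hx
      have := hcount t ((hX _).mp hx).1
      omega
  · rw [Finset.card_union_of_disjoint hD, hP.card, hcardX]
  · intro x hx h1
    rcases Finset.mem_union.mp hx with hx | hx
    · exact Finset.mem_union_left _ (hP.closed x hx h1)
    · by_cases hxv : x = v
      · subst hxv
        exact Finset.mem_union_left _ (hvpar h1)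
      · exact Finset.mem_union_right _ (hparX x hx hxv).2.2
  · rw [Finset.sum_union hD]
    refine add_nonneg ?_ ?_
    · refine hP.potential.trans (le_of_eq (Finset.sum_congr rfl fun x hx => ?_))
      by_cases h1 : x = 1
      · rw [h1, hwt1, mul_zero, mul_zero]
      · rw [hpos0 x hx, hpos0 _ (hP.closed x hx h1)]
    · let tm : ℕ → ℕ := fun x => if h : ∃ t, b t = x then h.choose else 0
      have htm : ∀ x ∈ X, b (tm x) = x := by
        intro x hx
        have h := ((hX x).mp hx).2
        have : tm x = h.choose := dif_pos h
        rw [this]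
        exact h.choose_spec
      rw [hb.value_eq hT (by omega) hvn hfw hwt hH hX htm] at hval
      rw [← Finset.add_sum_erase _ _ hvX]
      -- The top's edge to its already placed parent was not counted in the layout value; it adds a
      -- nonnegative amount. The remaining edges are compared one by one.
      refine hval.trans (add_le_add ?_ (Finset.sum_le_sum fun x hx => ?_))
      · exact le_add_of_nonneg_right (mul_nonneg (hF0 _) (hwt0 _))
      · rw [add_comm]
        refine add_le_add le_rfl (mul_le_mul_of_nonneg_right ?_ (hwt0 _))
        have hxX := Finset.mem_of_mem_erase hx
        obtain ⟨h1, h2, h3⟩ := hparX x hxX (Finset.ne_of_mem_erase hx)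
        have e1 := h₁ (tm x) (by rw [htm x hxX]; omega)
        have e2 := h₁ (tm (par x)) (by rw [htm _ h3]; have := hT.one_le x h1 h2; omega)
        have b1 : b (tm x) ≠ 0 := by rw [htm x hxX]; omega
        have b2 : b (tm (par x)) ≠ 0 := by
          rw [htm _ h3]; have := hT.one_le x h1 h2; omega
        have hne : tm x ≠ tm (par x) := by
          intro h
          have h4 := htm x hxX
          rw [h, htm _ h3] at h4
          have := hT.rk_par x h1 h2
          rw [h4] at this
          omega
        rw [htm x hxX] at e1
        rw [htm _ h3] at e2
        rw [e1, e2]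
        -- The new distance is the number of non-blanks from one endpoint to the other, so it is at
        -- most the index difference. It is also at least 1, which is needed because `F` is monotone
        -- only from 1 on.
        rcases lt_or_gt_of_ne hne with hlt | hlt
        · have h5 := Nat.count_strict_mono (p := fun t => b t ≠ 0) b1 hlt
          have h6 := count_add_le (fun t => b t ≠ 0) (tm x) (tm (par x) - tm x)
          rw [show tm x + (tm (par x) - tm x) = tm (par x) by omega] at h6
          exact hF _ _ (by omega) (by omega)
        · have h5 := Nat.count_strict_mono (p := fun t => b t ≠ 0) b2 hlt
          have h6 := count_add_le (fun t => b t ≠ 0) (tm (par x)) (tm x - tm (par x))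
          rw [show tm (par x) + (tm x - tm (par x)) = tm x by omega] at h6
          exact hF _ _ (by omega) (by omega)

theorem Placed.empty (n : ℕ) (par : ℕ → ℕ) (F wt H : ℕ → ℝ) {pos : ℕ → ℕ}
    (h : ∀ x, 1 ≤ x → x ≤ n → pos x = 0) : Placed n par F wt H ∅ pos 0 where
  mem x := by
    constructor
    · simp
    · rintro ⟨h1, h2, h3⟩
      exact absurd (h x h1 h2) h3
  inj := by simp
  le := by simp
  card := by simp
  closed := by simp
  potential := by simp

/-! ### The objective as a sum over parent edges -/

/-- The edges of a tree correspond to the vertices other than the root. -/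
theorem objective_eq_sum {n : ℕ} (I : ExtTSP n) (hI : I.graph.IsTree) {par rk : ℕ → ℕ}
    {wt F : ℕ → ℝ} (hT : Rooted n par rk) (hn : 0 < n)
    (hedge : ∀ u v : Fin n, (u : ℕ) ≠ 0 → par (u + 1) = v + 1 →
      I.graph.Adj u v ∧ wt (u + 1) = I.weight s(u, v))
    (hwt1 : wt 1 = 0) (hF : ∀ a, 1 ≤ a → F a = I.f a) (d : Sequencing n) {δ : ℕ → ℕ}
    (hδ : ∀ u : Fin n, δ (u + 1) = d u) :
    I.objective d =
      ∑ x ∈ Finset.Icc 1 n, F ((δ x - δ (par x)) + (δ (par x) - δ x)) * wt x := by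
  classical
  let r : Fin n := ⟨0, hn⟩
  have hp : ∀ u : Fin n, ∃ v : Fin n, u ≠ r → par (u + 1) = v + 1 := by
    intro u
    by_cases hu : u = r
    · exact ⟨r, fun h => absurd hu h⟩
    · have hu0 : (u : ℕ) ≠ 0 := fun h => hu (Fin.ext h)
      have h1 := hT.one_le (u + 1) (by omega) u.2
      have h2 := hT.le (u + 1) (by omega) u.2
      exact ⟨⟨par (u + 1) - 1, by omega⟩, fun _ => by dsimp only; omega⟩
  choose p hp using hp
  have hne0 : ∀ u : Fin n, u ≠ r → (u : ℕ) ≠ 0 := fun u h h' => h (Fin.ext h')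
  have hrk : ∀ u, u ≠ r → rk (p u + 1) < rk (u + 1) := by
    intro u hu
    have := hT.rk_par (u + 1) (by have := hne0 u hu; omega) u.2
    rwa [hp u hu] at this
  -- If two vertices shared their parent edge with roles exchanged, each would be the parent of the
  -- other, against the ranks.
  have hinj : Set.InjOn (fun u => s(u, p u)) (Finset.univ.erase r : Finset (Fin n)) := by
    intro u hu u' hu' h
    have hur : u ≠ r := by simpa using hu
    have hur' : u' ≠ r := by simpa using hu'
    rcases Sym2.eq_iff.mp h with ⟨h, -⟩ | ⟨h1, h2⟩
    · exact h
    · have h3 := hrk u hur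
      have h4 := hrk u' hur'
      rw [h2] at h3
      rw [← h1] at h4
      omega
  have hE : I.graph.edgeFinset = (Finset.univ.erase r).image (fun u => s(u, p u)) := by
    symm
    refine Finset.eq_of_subset_of_card_le ?_ ?_
    · intro e he
      obtain ⟨u, hu, rfl⟩ := Finset.mem_image.mp he
      rw [SimpleGraph.mem_edgeFinset, SimpleGraph.mem_edgeSet]
      have hur := Finset.ne_of_mem_erase hu
      exact (hedge u (p u) (hne0 u hur) (hp u hur)).1
    -- The n - 1 parent edges are distinct, and a tree has exactly n - 1 edges, so there are no
    -- others.
    · rw [Finset.card_image_of_injOn hinj, Finset.card_erase_of_mem (Finset.mem_univ _),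
        Finset.card_univ]
      have := hI.card_edgeFinset
      omega
  have hsum : ∑ x ∈ Finset.Icc 1 n, F ((δ x - δ (par x)) + (δ (par x) - δ x)) * wt x =
      ∑ u : Fin n, F ((δ (u + 1) - δ (par (u + 1))) + (δ (par (u + 1)) - δ (u + 1))) *
        wt (u + 1) := by
    rw [Fin.sum_univ_eq_sum_range (fun u =>
      F ((δ (u + 1) - δ (par (u + 1))) + (δ (par (u + 1)) - δ (u + 1))) * wt (u + 1)) n,
      Finset.range_eq_Ico, Finset.sum_Ico_add' (fun x =>
        F ((δ x - δ (par x)) + (δ (par x) - δ x)) * wt x) 0 n 1]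
    rfl
  rw [hsum, ExtTSP.objective]
  have hE' : ∀ inst : Fintype I.graph.edgeSet, @SimpleGraph.edgeFinset _ I.graph inst =
      (Finset.univ.erase r).image (fun u => s(u, p u)) := by
    intro inst
    rw [← hE]
    congr!
  rw [hE', Finset.sum_image hinj, ← Finset.add_sum_erase _ _ (Finset.mem_univ r)]
  have hr : wt ((r : ℕ) + 1) = 0 := hwt1
  rw [hr, mul_zero, zero_add]
  refine Finset.sum_congr rfl fun u hu => ?_
  have hur := Finset.ne_of_mem_erase hu
  obtain ⟨hadj, hw⟩ := hedge u (p u) (hne0 u hur) (hp u hur)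
  rw [hw, hp u hur, hδ, hδ]
  congr 1
  have hdne : (d u : ℕ) ≠ d (p u) := by
    intro h
    exact hadj.ne (d.injective (Subtype.ext h))
  rw [hF _ (by omega)]
  congr 1
  simp only [Sequencing.gap, Sym2.lift_mk]
  omega

theorem Placed.exists_sequencing {n : ℕ} {par : ℕ → ℕ} {F wt H : ℕ → ℝ} {P : Finset ℕ}
    {pos : ℕ → ℕ} {cnt : ℕ} (hP : Placed n par F wt H P pos cnt)
    (hall : ∀ x, 1 ≤ x → x ≤ n → x ∈ P) : ∃ d : Sequencing n, ∀ u : Fin n, pos (u + 1) = d u := by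
  have hPe : P = Finset.Icc 1 n := by
    ext x
    rw [Finset.mem_Icc]
    exact ⟨fun h => ⟨((hP.mem x).mp h).1, ((hP.mem x).mp h).2.1⟩, fun h => hall x h.1 h.2⟩
  have hcnt : cnt = n := by rw [← hP.card, hPe]; simp
  have hmem : ∀ u : Fin n, (u : ℕ) + 1 ∈ P := fun u => hall _ (by omega) u.2
  let e : Fin n → Finset.Icc 1 n := fun u => ⟨pos (u + 1), by
    have h1 := (hP.mem _).mp (hmem u)
    have h2 := hP.le _ (hmem u)
    rw [Finset.mem_Icc]
    omega⟩
  have he : Function.Injective e := by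
    intro u v h
    have := hP.inj _ (hmem u) _ (hmem v) (congrArg Subtype.val h)
    exact Fin.ext (by omega)
  have hbij : Function.Bijective e :=
    (Fintype.bijective_iff_injective_and_card e).mpr ⟨he, by simp⟩
  exact ⟨Equiv.ofBijective e hbij, fun u => rfl⟩

/-! ### Dynamic programming tables -/

/-- The first layer of the tables: only the state `0` is reachable. -/
structure TableBase (M : ℕ) (ok : ℕ → ℕ) (D : ℕ → ℝ) : Prop where
  ok_iff : ∀ c < M, ok c = 1 ↔ c = 0
  zero : D 0 = 0

/-- Layer `j + 1` of the tables is the correct continuation of layer `j`, as far as the windows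
below `m` are concerned. The cell of the state `c` in layer `j` is `j * M + c`. -/
structure TableStep (n K : ℕ) (par : ℕ → ℕ) (fw H : ℕ → ℝ) (v j m : ℕ) (ok bp : ℕ → ℕ)
    (D : ℕ → ℝ) : Prop where
  complete : ∀ w < m, Admissible n K par v j w →
    ok (j * (n + 1) ^ (2 * K) + w / (n + 1)) = 1 →
    ok ((j + 1) * (n + 1) ^ (2 * K) + w % (n + 1) ^ (2 * K)) = 1 ∧
    D (j * (n + 1) ^ (2 * K) + w / (n + 1)) + gain n K fw H v w ≤
      D ((j + 1) * (n + 1) ^ (2 * K) + w % (n + 1) ^ (2 * K))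
  sound : ∀ c < (n + 1) ^ (2 * K), ok ((j + 1) * (n + 1) ^ (2 * K) + c) ≠ 0 →
    ok ((j + 1) * (n + 1) ^ (2 * K) + c) = 1 ∧
    ∃ w < m, bp ((j + 1) * (n + 1) ^ (2 * K) + c) = w ∧ Admissible n K par v j w ∧
      w % (n + 1) ^ (2 * K) = c ∧ ok (j * (n + 1) ^ (2 * K) + w / (n + 1)) = 1 ∧
      D ((j + 1) * (n + 1) ^ (2 * K) + c) =
        D (j * (n + 1) ^ (2 * K) + w / (n + 1)) + gain n K fw H v w

/-- The states met when following the back pointers from the last layer `S`. -/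
def back (N M S : ℕ) (bp : ℕ → ℕ) : ℕ → ℕ
  | 0 => 0
  | i + 1 => bp ((S - i) * M + back N M S bp i) / N

section Tables

variable {n K : ℕ} {par : ℕ → ℕ} {fw H : ℕ → ℝ} {v : ℕ} {ok bp : ℕ → ℕ} {D : ℕ → ℝ}

/-- The windows of `b` trace a path through the layers. It starts and ends at state 0 because of the
blanks on both sides, and `complete` applies at each step. -/
theorem value_le_table (h₀ : TableBase ((n + 1) ^ (2 * K)) ok D)
    (h : ∀ j < 2 * n + 2 * K, TableStep n K par fw H v j ((n + 1) ^ (2 * K + 1)) ok bp D)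
    {b : ℕ → ℕ} (hb : Layout n K par v b) :
    ok ((2 * n + 2 * K) * (n + 1) ^ (2 * K)) = 1 ∧
      value n K fw H v b ≤ D ((2 * n + 2 * K) * (n + 1) ^ (2 * K)) := by
  have hM : 0 < (n + 1) ^ (2 * K) := by positivity
  have key : ∀ j ≤ 2 * n + 2 * K,
      ok (j * (n + 1) ^ (2 * K) + code (n + 1) b j (2 * K)) = 1 ∧
      ∑ i ∈ Finset.range j, gain n K fw H v (code (n + 1) b i (2 * K + 1)) ≤
        D (j * (n + 1) ^ (2 * K) + code (n + 1) b j (2 * K)) := by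
    intro j
    induction j with
    | zero =>
      intro _
      rw [code_eq_zero fun i hi => hb.pre _ (by omega)]
      simp [h₀.zero, (h₀.ok_iff 0 hM).mpr rfl]
    | succ j ih =>
      intro hj
      obtain ⟨h1, h2⟩ := ih (by omega)
      have h3 := (h j (by omega)).complete _ (code_lt hb.lt_succ j _) (hb.step j (by omega))
      rw [code_div hb.lt_succ, code_mod_pow hb.lt_succ] at h3
      obtain ⟨h4, h5⟩ := h3 h1
      refine ⟨h4, ?_⟩
      rw [Finset.sum_range_succ]
      linarith
  obtain ⟨h1, h2⟩ := key _ le_rfl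
  rw [code_eq_zero fun i hi => hb.post _ (by omega), add_zero] at h1 h2
  exact ⟨h1, h2⟩

/-- The sequence with `2 K` leading blanks and then `y 0, …, y (2 n + 2 K - 1)`. -/
def padded (n K : ℕ) (y : ℕ → ℕ) (t : ℕ) : ℕ :=
  if t < 2 * K then 0 else if t < 2 * n + 2 * K + 2 * K then y (t - 2 * K) else 0

theorem padded_add {y : ℕ → ℕ} {j : ℕ} (hj : j < 2 * n + 2 * K) :
    padded n K y (j + 2 * K) = y j := by
  rw [padded, if_neg (by omega), if_pos (by omega), Nat.add_sub_cancel]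

/-- `sound` makes the source of a back pointer reachable again, so the walk back from the last layer
never leaves the valid cells. -/
theorem back_reachable (h : ∀ j < 2 * n + 2 * K,
      TableStep n K par fw H v j ((n + 1) ^ (2 * K + 1)) ok bp D)
    (hok : ok ((2 * n + 2 * K) * (n + 1) ^ (2 * K)) = 1) {i : ℕ} (hi : i ≤ 2 * n + 2 * K) :
    back (n + 1) ((n + 1) ^ (2 * K)) (2 * n + 2 * K) bp i < (n + 1) ^ (2 * K) ∧
      ok ((2 * n + 2 * K - i) * (n + 1) ^ (2 * K) +
        back (n + 1) ((n + 1) ^ (2 * K)) (2 * n + 2 * K) bp i) = 1 := by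
  have hM : 0 < (n + 1) ^ (2 * K) := by positivity
  induction i with
  | zero => exact ⟨hM, by simpa [back] using hok⟩
  | succ i ih =>
    obtain ⟨h1, h2⟩ := ih (by omega)
    have e : 2 * n + 2 * K - i = (2 * n + 2 * K - (i + 1)) + 1 := by omega
    rw [e] at h2
    obtain ⟨-, w, hw, hbp, -, -, h4, -⟩ :=
      (h (2 * n + 2 * K - (i + 1)) (by omega)).sound _ h1 (by rw [h2]; exact one_ne_zero)
    rw [back, e, hbp]
    refine ⟨?_, h4⟩
    rw [Nat.div_lt_iff_lt_mul (by omega), ← pow_succ]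
    exact hw

theorem back_pointer_lt (h : ∀ j < 2 * n + 2 * K,
      TableStep n K par fw H v j ((n + 1) ^ (2 * K + 1)) ok bp D)
    (hok : ok ((2 * n + 2 * K) * (n + 1) ^ (2 * K)) = 1) {i : ℕ} (hi : i < 2 * n + 2 * K) :
    bp ((2 * n + 2 * K - i) * (n + 1) ^ (2 * K) +
      back (n + 1) ((n + 1) ^ (2 * K)) (2 * n + 2 * K) bp i) < (n + 1) ^ (2 * K + 1) := by
  obtain ⟨h1, h2⟩ := back_reachable h hok hi.le
  have e : 2 * n + 2 * K - i = (2 * n + 2 * K - (i + 1)) + 1 := by omega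
  rw [e] at h2 ⊢
  obtain ⟨-, w, hw, hbp, -⟩ :=
    (h (2 * n + 2 * K - (i + 1)) (by omega)).sound _ h1 (by rw [h2]; exact one_ne_zero)
  rwa [hbp]

/-- The newest symbols along the back pointers, read forwards, form the layout. Consecutive back
pointers overlap in 2K symbols, so the windows of the resulting sequence are exactly the stored ones
and inherit admissibility. -/
theorem layout_of_table (h₀ : TableBase ((n + 1) ^ (2 * K)) ok D)
    (h : ∀ j < 2 * n + 2 * K, TableStep n K par fw H v j ((n + 1) ^ (2 * K + 1)) ok bp D)
    (hok : ok ((2 * n + 2 * K) * (n + 1) ^ (2 * K)) = 1) {y : ℕ → ℕ}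
    (hy : ∀ i < 2 * n + 2 * K, y (2 * n + 2 * K - 1 - i) =
      bp ((2 * n + 2 * K - i) * (n + 1) ^ (2 * K) +
        back (n + 1) ((n + 1) ^ (2 * K)) (2 * n + 2 * K) bp i) % (n + 1)) :
    Layout n K par v (padded n K y) ∧
      value n K fw H v (padded n K y) = D ((2 * n + 2 * K) * (n + 1) ^ (2 * K)) := by
  set M := (n + 1) ^ (2 * K) with hMdef
  set S := 2 * n + 2 * K with hS
  set bk := back (n + 1) M S bp with hbk
  have hbs : ∀ i, bk (i + 1) = bp ((S - i) * M + bk i) / (n + 1) := fun i => rfl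
  have reach : ∀ i ≤ S, bk i < M ∧ ok ((S - i) * M + bk i) = 1 := fun i hi =>
    back_reachable h hok hi
  -- The window used in the transition from layer j to layer j + 1.
  let w : ℕ → ℕ := fun j => bp ((j + 1) * M + bk (S - 1 - j))
  have hw : ∀ j < S, w j < (n + 1) ^ (2 * K + 1) ∧ Admissible n K par v j (w j) ∧
      w j % M = bk (S - (j + 1)) ∧ w j / (n + 1) = bk (S - j) ∧ w j % (n + 1) = y j ∧
      D ((j + 1) * M + bk (S - (j + 1))) =
        D (j * M + bk (S - j)) + gain n K fw H v (w j) := by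
    intro j hj
    obtain ⟨h1, h2⟩ := reach (S - 1 - j) (by omega)
    have e : S - (S - 1 - j) = j + 1 := by omega
    rw [e] at h2
    obtain ⟨-, w', hw', hbp, hadm, hmod, h4, h5⟩ :=
      (h j hj).sound _ h1 (by rw [h2]; exact one_ne_zero)
    have hww : w j = w' := hbp
    have hdiv : w j / (n + 1) = bk (S - j) := by
      rw [show S - j = S - 1 - j + 1 by omega, hbs, e]
    have e2 : S - (j + 1) = S - 1 - j := by omega
    rw [← hww] at hw' hadm hmod h5
    refine ⟨hw', hadm, by rw [e2]; exact hmod, hdiv, ?_, ?_⟩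
    · have := hy (S - 1 - j) (by omega)
      rw [show S - 1 - (S - 1 - j) = j by omega, e] at this
      exact this.symm
    · rw [e2, h5, hdiv]
  set b := padded n K y with hb
  have hble : ∀ t, b t ≤ n := by
    intro t
    rw [hb, padded]
    split_ifs with h1 h2
    · omega
    · rw [← (hw (t - 2 * K) (by omega)).2.2.2.2.1]
      exact Nat.le_of_lt_succ (Nat.mod_lt _ (by omega))
    · omega
  have hblt : ∀ t, b t < n + 1 := fun t => Nat.lt_succ_of_le (hble t)
  have hpre : ∀ t < 2 * K, b t = 0 := fun t ht => if_pos ht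
  have hnext : ∀ j < S, code (n + 1) b j (2 * K) = bk (S - j) →
      code (n + 1) b j (2 * K + 1) = w j := by
    intro j hj hc
    rw [code, hc, hb, padded_add hj, ← (hw j hj).2.2.2.1, ← (hw j hj).2.2.2.2.1]
    exact Nat.div_add_mod' _ _
  -- The only reachable state of layer 0 is the blank one, which matches the leading blanks; `hnext`
  -- then propagates the agreement.
  have hcode : ∀ j ≤ S, code (n + 1) b j (2 * K) = bk (S - j) := by
    intro j
    induction j with
    | zero =>
      intro _
      rw [code_eq_zero fun i hi => hpre _ (by omega)]
      obtain ⟨h1, h2⟩ := reach S le_rfl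
      rw [Nat.sub_self, zero_mul, zero_add] at h2
      exact ((h₀.ok_iff _ h1).mp h2).symm
    | succ j ih =>
      intro hj
      rw [← code_mod_pow hblt, hnext j (by omega) (ih (by omega))]
      exact (hw j (by omega)).2.2.1
  have hwin : ∀ j < S, code (n + 1) b j (2 * K + 1) = w j := fun j hj =>
    hnext j hj (hcode j (by omega))
  have hlast := hcode S le_rfl
  rw [Nat.sub_self] at hlast
  -- The walk started from state 0 in the last layer, so the final 2K symbols are blank.
  have hzero := eq_zero_of_code (by omega) (hlast.trans (rfl : bk 0 = 0))
  refine ⟨⟨hble, hpre, ?_, ?_⟩, ?_⟩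
  · intro t ht
    by_cases h1 : t < S + 2 * K
    · have := hzero (t - S) (by omega)
      rwa [show S + (t - S) = t by omega] at this
    · rw [hb, padded, if_neg (by omega), if_neg (by omega)]
  · intro j hj
    rw [hwin j hj]
    exact (hw j hj).2.1
  · have hsum : ∀ j ≤ S, D (j * M + bk (S - j)) =
        ∑ i ∈ Finset.range j, gain n K fw H v (code (n + 1) b i (2 * K + 1)) := by
      intro j
      induction j with
      | zero =>
        intro _
        rw [← hcode 0 (by omega), code_eq_zero fun i hi => hpre _ (by omega)]
        simp [h₀.zero]
      | succ j ih =>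
        intro hj
        rw [(hw j (by omega)).2.2.2.2.2, ih (by omega), Finset.sum_range_succ,
          hwin j (by omega)]
    have := hsum S le_rfl
    rw [Nat.sub_self, show bk 0 = 0 from rfl, add_zero] at this
    rw [this, value]

/-! ### Table layers under writes -/

/-- The condition reads only the layers j and j + 1, so it survives the computation of later layers.
-/
theorem TableStep.congr {j m : ℕ} {ok' bp' : ℕ → ℕ} {D' : ℕ → ℝ}
    (hm : m ≤ (n + 1) ^ (2 * K + 1))
    (h : TableStep n K par fw H v j m ok bp D)
    (hag : ∀ a < (j + 2) * (n + 1) ^ (2 * K), ok' a = ok a ∧ bp' a = bp a ∧ D' a = D a) :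
    TableStep n K par fw H v j m ok' bp' D' := by
  have hM : 0 < (n + 1) ^ (2 * K) := by positivity
  have e : (j + 2) * (n + 1) ^ (2 * K) = j * (n + 1) ^ (2 * K) + (n + 1) ^ (2 * K) +
    (n + 1) ^ (2 * K) := by ring
  have e' : (j + 1) * (n + 1) ^ (2 * K) = j * (n + 1) ^ (2 * K) + (n + 1) ^ (2 * K) := by ring
  have hdiv : ∀ w < m, w / (n + 1) < (n + 1) ^ (2 * K) := fun w hw => by
    rw [Nat.div_lt_iff_lt_mul (by omega), ← pow_succ]
    omega
  have hmod : ∀ w, w % (n + 1) ^ (2 * K) < (n + 1) ^ (2 * K) := fun w => Nat.mod_lt _ hM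
  refine ⟨fun w hw hadm hok => ?_, fun c hc hok => ?_⟩
  · have h1 := hag (j * (n + 1) ^ (2 * K) + w / (n + 1)) (by have := hdiv w hw; omega)
    have h2 := hag ((j + 1) * (n + 1) ^ (2 * K) + w % (n + 1) ^ (2 * K))
      (by have := hmod w; omega)
    rw [h1.1] at hok
    rw [h1.2.2, h2.1, h2.2.2]
    exact h.complete w hw hadm hok
  · have h2 := hag ((j + 1) * (n + 1) ^ (2 * K) + c) (by omega)
    rw [h2.1] at hok
    rw [h2.1, h2.2.1, h2.2.2]
    obtain ⟨h3, w, hw, h4, h5, h6, h7, h8⟩ := h.sound c hc hok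
    have h1 := hag (j * (n + 1) ^ (2 * K) + w / (n + 1)) (by have := hdiv w hw; omega)
    refine ⟨h3, w, hw, h4, h5, h6, ?_, ?_⟩
    · rw [h1.1, h7]
    · rw [h1.2.2, h8]

theorem TableStep.init {j : ℕ}
    (h : ∀ c < (n + 1) ^ (2 * K), ok ((j + 1) * (n + 1) ^ (2 * K) + c) = 0) :
    TableStep n K par fw H v j 0 ok bp D :=
  ⟨fun w hw => by omega, fun c hc h' => absurd (h c hc) h'⟩

theorem TableStep.skip {j m : ℕ} (h : TableStep n K par fw H v j m ok bp D)
    (hm : Admissible n K par v j m → ok (j * (n + 1) ^ (2 * K) + m / (n + 1)) = 1 →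
      ok ((j + 1) * (n + 1) ^ (2 * K) + m % (n + 1) ^ (2 * K)) ≠ 0 ∧
      D (j * (n + 1) ^ (2 * K) + m / (n + 1)) + gain n K fw H v m ≤
        D ((j + 1) * (n + 1) ^ (2 * K) + m % (n + 1) ^ (2 * K))) :
    TableStep n K par fw H v j (m + 1) ok bp D := by
  have hM : 0 < (n + 1) ^ (2 * K) := by positivity
  refine ⟨fun w hw hadm hok => ?_, fun c hc hok => ?_⟩
  · rcases Nat.lt_succ_iff_lt_or_eq.mp hw with hw | rfl
    · exact h.complete w hw hadm hok
    · obtain ⟨h1, h2⟩ := hm hadm hok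
      exact ⟨(h.sound _ (Nat.mod_lt _ hM) h1).1, h2⟩
  · obtain ⟨h3, w, hw, h4⟩ := h.sound c hc hok
    exact ⟨h3, w, by omega, h4⟩

theorem TableStep.update {j m : ℕ} (h : TableStep n K par fw H v j m ok bp D)
    (hm : m < (n + 1) ^ (2 * K + 1)) (hadm : Admissible n K par v j m)
    (hok : ok (j * (n + 1) ^ (2 * K) + m / (n + 1)) = 1) {src tgt : ℕ} {x : ℝ}
    (hsrc : src = j * (n + 1) ^ (2 * K) + m / (n + 1))
    (htgt : tgt = (j + 1) * (n + 1) ^ (2 * K) + m % (n + 1) ^ (2 * K))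
    (hx : x = D src + gain n K fw H v m) (hlt : ok tgt = 0 ∨ D tgt < x) :
    TableStep n K par fw H v j (m + 1) (Function.update ok tgt 1) (Function.update bp tgt m)
      (Function.update D tgt x) := by
  have hM : 0 < (n + 1) ^ (2 * K) := by positivity
  have e' : (j + 1) * (n + 1) ^ (2 * K) = j * (n + 1) ^ (2 * K) + (n + 1) ^ (2 * K) := by ring
  -- Sources lie in layer j and the target in layer j + 1, so the write disturbs no source. This
  -- keeps the equation in `sound` exact for cells written earlier.
  have hdiv : ∀ w < m + 1, j * (n + 1) ^ (2 * K) + w / (n + 1) ≠ tgt := fun w hw => by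
    have : w / (n + 1) < (n + 1) ^ (2 * K) := by
      rw [Nat.div_lt_iff_lt_mul (by omega), ← pow_succ]
      omega
    rw [htgt, e']
    exact ne_of_lt (lt_of_lt_of_le (Nat.add_lt_add_left this _) (Nat.le_add_right _ _))
  refine ⟨fun w hw hadm' hok' => ?_, fun c hc hok' => ?_⟩
  · rw [Function.update_of_ne (hdiv w hw)] at hok' ⊢
    rcases Nat.lt_succ_iff_lt_or_eq.mp hw with hw' | rfl
    · obtain ⟨h1, h2⟩ := h.complete w hw' hadm' hok'
      by_cases hc : (j + 1) * (n + 1) ^ (2 * K) + w % (n + 1) ^ (2 * K) = tgt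
      · rw [hc] at h1 h2 ⊢
        rw [Function.update_self, Function.update_self]
        refine ⟨rfl, h2.trans ?_⟩
        rcases hlt with h3 | h3
        · omega
        · exact h3.le
      · rw [Function.update_of_ne hc, Function.update_of_ne hc]
        exact ⟨h1, h2⟩
    · rw [← htgt, Function.update_self, Function.update_self, hx, hsrc]
      exact ⟨rfl, le_rfl⟩
  · by_cases hct : (j + 1) * (n + 1) ^ (2 * K) + c = tgt
    · rw [hct, Function.update_self, Function.update_self, Function.update_self]
      refine ⟨rfl, m, by omega, rfl, hadm, by omega, ?_, ?_⟩
      · rw [Function.update_of_ne (hdiv m (by omega)), hok]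
      · rw [Function.update_of_ne (hdiv m (by omega)), hx, hsrc]
    · rw [Function.update_of_ne hct] at hok'
      rw [Function.update_of_ne hct, Function.update_of_ne hct, Function.update_of_ne hct]
      obtain ⟨h3, w, hw, h4, h5, h6, h7, h8⟩ := h.sound c hc hok'
      refine ⟨h3, w, by omega, h4, h5, h6, ?_, ?_⟩
      · rw [Function.update_of_ne (hdiv w (by omega)), h7]
      · rw [Function.update_of_ne (hdiv w (by omega)), h8]

/-- Guarantees that the final cell of the table is reachable for every top, so the maximum is over a
nonempty set. -/
theorem exists_layout_single {v : ℕ} (hv : 1 ≤ v) (hvn : v ≤ n) : ∃ b, Layout n K par v b := by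
  obtain ⟨b, hb, -⟩ := exists_layout (n := n) (K := K) (v := v) (par := par) (δ := fun x => x)
    (X := {v}) (by simp [hv, hvn]) (by simp [hv, hvn]) (by simp) (by simp) (by simp)
  exact ⟨b, hb⟩

end Tables

end TreeTSP

namespace RAM

/-! ### The program and its verification

In comments, `vᵢ` is the integer variable `i`. -/

/-- `v₄ := n + 1`, `v₃ := min k n`, `v₅ := (n + 1) ^ (2 v₃)`, `v₆ := (n + 1) ^ (2 v₃ + 1)`,
`v₇ := 2 n + 2 v₃`. -/
def setupProg : Prog :=
  .seq (.seq (.setIVar 4 (.add (.var 0) (.lit 1)))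
    (.seq (.ite (.ilt (.var 0) (.var 1)) (.setIVar 3 (.var 0)) (.setIVar 3 (.var 1)))
      (.seq (.setIVar 6 (.lit 1))
        (.setIVar 7 (.add (.add (.var 0) (.var 0)) (.add (.var 3) (.var 3)))))))
    (.for 8 (.add (.add (.var 3) (.var 3)) (.lit 1))
      (.seq (.seq (.setIVar 5 (.var 6)) (.setIVar 6 (.lit 0)))
        (.for 9 (.var 4) (.setIVar 6 (.add (.var 6) (.var 5))))))

theorem setupProg_spec (s : Store) :
    Runs setupProg s ((2 * min (s.ivar 1) (s.ivar 0) + 1) * ((s.ivar 0 + 1) * 12 + 24) + 50)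
      fun s' => s'.ivar 3 = min (s.ivar 1) (s.ivar 0) ∧ s'.ivar 4 = s.ivar 0 + 1 ∧
        s'.ivar 5 = (s.ivar 0 + 1) ^ (2 * min (s.ivar 1) (s.ivar 0)) ∧
        s'.ivar 6 = (s.ivar 0 + 1) ^ (2 * min (s.ivar 1) (s.ivar 0) + 1) ∧
        s'.ivar 7 = 2 * s.ivar 0 + 2 * min (s.ivar 1) (s.ivar 0) := by
  set n := s.ivar 0
  set K := min (s.ivar 1) n with hK
  refine Runs.imp (Runs.seq (T₁ := 40)
    (T₂ := (2 * K + 1) * ((n + 1) * 12 + 24) + 10)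
    (R := fun s' => s'.ivar 3 = K ∧ s'.ivar 4 = n + 1 ∧ s'.ivar 6 = 1 ∧
      s'.ivar 7 = 2 * n + 2 * K)
    (Q := fun s' => s'.ivar 3 = K ∧ s'.ivar 4 = n + 1 ∧
        s'.ivar 5 = (n + 1) ^ (2 * K) ∧ s'.ivar 6 = (n + 1) ^ (2 * K + 1) ∧
        s'.ivar 7 = 2 * n + 2 * K) ?_ ?_) ?_ fun _ _ h => h
  · refine Runs.of_wp rfl (by decide) ?_
    simp [Prog.wp, Store.setIVar, IExp.eval, BExp.eval]
    omega
  · rintro s₁ - ⟨h3, h4, h6, h7⟩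
    refine Runs.imp (Runs.for (x := 8) (m := 2 * K + 1) (T := (n + 1) * 12 + 12)
      (T' := (n + 1) * 12 + 24)
      -- Multiplication by n + 1 is repeated addition. Variable 5 lags one power behind variable 6,
      -- so 2K + 1 rounds leave the number of states and the number of windows side by side.
      (fun i s' => s'.ivar 6 = (n + 1) ^ i ∧ (0 < i → s'.ivar 5 = (n + 1) ^ (i - 1)))
      rfl ?_ (fun _ _ _ h => h) ⟨h6, by simp⟩ ?_ ?_)
      ?_ ?_
    · intro s' hf
      simp only [IExp.eval, hf.ivar 3 rfl, h3]; ring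
    · rintro i hi s₂ hf hx ⟨h6', -⟩
      refine Runs.imp (Runs.seq (T₁ := 6) (T₂ := (n + 1) * 12 + 1 + 5)
        (R := fun s' => s'.ivar 5 = (n + 1) ^ i ∧ s'.ivar 6 = 0)
        (Runs.of_wp rfl (by decide) (by simp [Prog.wp, Store.setIVar, IExp.eval, h6'])) ?_)
        (by omega) fun _ _ h => h
      rintro s₃ hf3 ⟨h5, h6''⟩
      refine Runs.imp (Runs.for (x := 9) (m := n + 1) (T := 4) (T' := 12)
        (fun j s' => s'.ivar 6 = j * (n + 1) ^ i) rfl ?_ (fun _ _ _ h => h) (by simp [h6'']) ?_ ?_)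
        le_rfl ?_
      · intro s' hf'
        simp only [IExp.eval, hf'.ivar 4 rfl, hf3.ivar 4 rfl, hf.ivar 4 rfl, h4]
      · intro j hj s' hf' hx' h
        refine Runs.of_wp rfl (by decide) ?_
        simp [Prog.wp, Store.setIVar, IExp.eval, h, hf'.ivar 5 rfl, h5]
        ring
      · simp [IExp.cost]
      · intro s' hf' h
        refine ⟨by rw [h]; ring, fun _ => by simp [hf'.ivar 5 rfl, h5]⟩
    · simp only [IExp.cost]; omega
    · simp only [IExp.cost]; omega
    · rintro s' hf ⟨h6', h5'⟩
      exact ⟨by rw [hf.ivar 3 rfl, h3], by rw [hf.ivar 4 rfl, h4], by simpa using h5',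
        h6', by rw [hf.ivar 7 rfl, h7]⟩
  · omega

end RAM

namespace TreeTSP

/-! ### Rooting the tree -/

/-- The first `c` vertices `ord 0, …, ord (c - 1)` of a tree rooted at `1`, with their parents and
the weights of the edges to the parents. -/
structure PartialRooting {n : ℕ} (G : SimpleGraph (Fin n)) (wgt : Sym2 (Fin n) → ℝ) (c : ℕ)
    (par ord : ℕ → ℕ) (wt : ℕ → ℝ) : Prop where
  ord_mem : ∀ j < c, 1 ≤ ord j ∧ ord j ≤ n
  ord_inj : ∀ j < c, ∀ j' < c, ord j = ord j' → j = j'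
  par_ne : ∀ x, par x ≠ 0 ↔ ∃ j < c, ord j = x
  ord_zero : ord 0 = 1
  par_root : par 1 = n + 1
  par_ord : ∀ j < c, 0 < j → ∃ j' < j, par (ord j) = ord j'
  edge : ∀ u v : Fin n, (u : ℕ) ≠ 0 → par (u + 1) = v + 1 →
    G.Adj u v ∧ wt (u + 1) = wgt s(u, v)
  wt_zero : wt 0 = 0
  wt_root : wt 1 = 0
  wt_nonneg : ∀ x, 0 ≤ wt x

variable {n : ℕ} {G : SimpleGraph (Fin n)} {wgt : Sym2 (Fin n) → ℝ} {par ord : ℕ → ℕ}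
  {wt : ℕ → ℝ}

theorem PartialRooting.init (hn : 0 < n) (h3 : ∀ x, par x = if x = 1 then n + 1 else 0)
    (h4 : ord 0 = 1) (hwt : ∀ x, wt x = 0) : PartialRooting G wgt 1 par ord wt where
  ord_mem j hj := by
    obtain rfl : j = 0 := by omega
    omega
  ord_inj j hj j' hj' _ := by omega
  par_ne x := by
    rw [h3]
    constructor
    · intro h
      exact ⟨0, one_pos, by rw [h4]; by_contra h'; simp [Ne.symm h'] at h⟩
    · rintro ⟨j, hj, rfl⟩
      obtain rfl : j = 0 := by omega
      rw [h4, if_pos rfl]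
      omega
  ord_zero := h4
  par_root := by rw [h3, if_pos rfl]
  par_ord j hj h0 := by omega
  edge u v hu h := by
    rw [h3, if_neg (by omega)] at h
    omega
  wt_zero := hwt 0
  wt_root := hwt 1
  wt_nonneg x := (hwt x).ge

/-- A nonzero `par` entry marks a vertex as found. Since v was not found before, no earlier entry
refers to it and all other clauses persist. -/
theorem PartialRooting.extend {c : ℕ} (h : PartialRooting G wgt c par ord wt) (hc : 0 < c)
    {u v : Fin n} (hu : par (u + 1) ≠ 0) (hv : par (v + 1) = 0) (hadj : G.Adj u v)
    (hw : 0 < wgt s(u, v)) :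
    PartialRooting G wgt (c + 1) (Function.update par (v + 1) (u + 1))
      (Function.update ord c (v + 1)) (Function.update wt (v + 1) (wgt s(u, v))) := by
  have hroot : (v : ℕ) + 1 ≠ 1 := by
    intro h1
    rw [h1, h.par_root] at hv
    omega
  have hord : ∀ j < c, Function.update ord c ((v : ℕ) + 1) j = ord j := fun j hj =>
    Function.update_of_ne (by omega) _ _
  have hordne : ∀ j < c, ord j ≠ v + 1 := fun j hj h1 =>
    ((h.par_ne _).mpr ⟨j, hj, h1⟩) hv
  have hpar : ∀ x, x ≠ (v : ℕ) + 1 → Function.update par (v + 1) ((u : ℕ) + 1) x = par x :=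
    fun x hx => Function.update_of_ne hx _ _
  constructor
  · intro j hj
    rcases Nat.lt_succ_iff_lt_or_eq.mp hj with hj | rfl
    · rw [hord j hj]; exact h.ord_mem j hj
    · rw [Function.update_self]; omega
  · intro j hj j' hj' he
    rcases Nat.lt_succ_iff_lt_or_eq.mp hj with hj | rfl <;>
      rcases Nat.lt_succ_iff_lt_or_eq.mp hj' with hj' | rfl
    · rw [hord j hj, hord j' hj'] at he
      exact h.ord_inj j hj j' hj' he
    · rw [hord j hj, Function.update_self] at he
      exact absurd he (hordne j hj)
    · rw [hord j' hj', Function.update_self] at he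
      exact absurd he.symm (hordne j' hj')
    · rfl
  · intro x
    by_cases hx : x = v + 1
    · subst hx
      rw [Function.update_self]
      exact ⟨fun _ => ⟨c, by omega, Function.update_self _ _ _⟩, fun _ => by omega⟩
    · rw [hpar x hx, h.par_ne]
      constructor
      · rintro ⟨j, hj, e⟩
        exact ⟨j, by omega, by rw [hord j hj, e]⟩
      · rintro ⟨j, hj, e⟩
        rcases Nat.lt_succ_iff_lt_or_eq.mp hj with hj | rfl
        · exact ⟨j, hj, by rw [← e, hord j hj]⟩
        · rw [Function.update_self] at e
          exact absurd e.symm hx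
  · rw [hord 0 hc, h.ord_zero]
  · rw [hpar 1 (Ne.symm hroot), h.par_root]
  · intro j hj h0
    rcases Nat.lt_succ_iff_lt_or_eq.mp hj with hj | rfl
    · obtain ⟨j', hj', e⟩ := h.par_ord j hj h0
      refine ⟨j', hj', ?_⟩
      rw [hord j hj, hord j' (by omega), hpar _ (hordne j hj), e]
    · obtain ⟨j', hj', e⟩ := (h.par_ne _).mp hu
      refine ⟨j', hj', ?_⟩
      rw [Function.update_self, Function.update_self, hord j' hj', e]
  · intro a b ha hab
    by_cases hav : (a : ℕ) + 1 = v + 1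
    · obtain rfl : a = v := Fin.ext (by omega)
      rw [Function.update_self] at hab ⊢
      obtain rfl : u = b := Fin.ext (by omega)
      exact ⟨hadj.symm, by rw [Sym2.eq_swap]⟩
    · rw [hpar _ hav] at hab
      rw [Function.update_of_ne hav]
      exact h.edge a b ha hab
  · rw [Function.update_of_ne (by omega)]; exact h.wt_zero
  · rw [Function.update_of_ne (Ne.symm hroot)]; exact h.wt_root
  · intro x
    by_cases hx : x = v + 1
    · subst hx
      rw [Function.update_self]
      exact hw.le
    · rw [Function.update_of_ne hx]
      exact h.wt_nonneg x

/-- Only c < n vertices are found, so one is missing, and a walk from the root to it must leave the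
found set along some edge. -/
theorem PartialRooting.exists_crossing {c : ℕ} (h : PartialRooting G wgt c par ord wt)
    (hG : G.Connected) (hc : 0 < c) (hcn : c < n) :
    ∃ u v : Fin n, G.Adj u v ∧ par (u + 1) ≠ 0 ∧ par (v + 1) = 0 := by
  classical
  obtain ⟨v, hv⟩ : ∃ v : Fin n, par (v + 1) = 0 := by
    by_contra hne
    push Not at hne
    have : (Finset.univ : Finset (Fin n)).card ≤ (Finset.range c).card := by
      have hj : ∀ u : Fin n, ∃ j < c, ord j = u + 1 := fun u => (h.par_ne _).mp (hne u)
      choose f hf hf' using hj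
      refine Finset.card_le_card_of_injOn f (fun u _ => by simpa using hf u) ?_
      intro a _ b _ hab
      have := hf' a
      rw [hab, hf' b] at this
      exact Fin.ext (by omega)
    rw [Finset.card_univ, Fintype.card_fin, Finset.card_range] at this
    omega
  obtain ⟨p⟩ := hG.preconnected (⟨0, by omega⟩ : Fin n) v
  obtain ⟨d, hd, h1, h2⟩ := p.exists_boundary_dart {u | par ((u : ℕ) + 1) ≠ 0}
    (by simp [h.par_root]) (by simpa using hv)
  exact ⟨d.fst, d.snd, d.adj, h1, by simpa using h2⟩

/-- The depth order of a complete rooting. -/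
theorem PartialRooting.exists_rooted (h : PartialRooting G wgt n par ord wt) :
    (∀ x, 1 ≤ x → x ≤ n → ∃ j < n, ord j = x) ∧
    ∃ rk, Rooted n par rk ∧ ∀ j < n, rk (ord j) = j := by
  classical
  have hsurj : ∀ x, 1 ≤ x → x ≤ n → ∃ j < n, ord j = x := by
    intro x h1 h2
    have hmaps : Set.MapsTo ord (Finset.range n : Finset ℕ) (Finset.Icc 1 n : Finset ℕ) := by
      intro j hj
      have := h.ord_mem j (by simpa using hj)
      simpa using this
    have hinj : Set.InjOn ord (Finset.range n : Finset ℕ) := by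
      intro j hj j' hj' he
      exact h.ord_inj j (by simpa using hj) j' (by simpa using hj') he
    have := Finset.surjOn_of_injOn_of_card_le ord hmaps hinj (by simp)
    obtain ⟨j, hj, e⟩ := this (by simpa using ⟨h1, h2⟩ : x ∈ (Finset.Icc 1 n : Finset ℕ))
    exact ⟨j, by simpa using hj, e⟩
  -- The rank is the index of discovery; parents are discovered earlier.
  refine ⟨hsurj, fun x => if hx : ∃ j < n, ord j = x then hx.choose else 0, ?_⟩
  have hrk : ∀ j < n, (fun x => if hx : ∃ j < n, ord j = x then hx.choose else 0) (ord j) = j := by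
    intro j hj
    have hx : ∃ j' < n, ord j' = ord j := ⟨j, hj, rfl⟩
    dsimp only
    rw [dif_pos hx]
    exact h.ord_inj _ hx.choose_spec.1 _ hj hx.choose_spec.2
  set rk : ℕ → ℕ := fun x => if hx : ∃ j < n, ord j = x then hx.choose else 0
  have hpar : ∀ x, 1 < x → x ≤ n → ∃ j j', j < n ∧ ord j = x ∧ j' < j ∧ par x = ord j' := by
    intro x h1 h2
    obtain ⟨j, hj, rfl⟩ := hsurj x (by omega) h2
    have h0 : 0 < j := by
      rcases Nat.eq_zero_or_pos j with rfl | h0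
      · rw [h.ord_zero] at h1; omega
      · exact h0
    obtain ⟨j', hj', e⟩ := h.par_ord j hj h0
    exact ⟨j, j', hj, rfl, hj', e⟩
  refine ⟨⟨h.par_root, ?_, ?_, ?_, ?_⟩, hrk⟩
  · intro x h1 h2
    obtain ⟨j, j', hj, rfl, hj', e⟩ := hpar x h1 h2
    rw [e]
    exact (h.ord_mem j' (by omega)).1
  · intro x h1 h2
    obtain ⟨j, j', hj, rfl, hj', e⟩ := hpar x h1 h2
    rw [e]
    exact (h.ord_mem j' (by omega)).2
  · intro x h1 h2
    obtain ⟨j, j', hj, rfl, hj', e⟩ := hpar x h1 h2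
    rw [e, hrk j hj, hrk j' (by omega)]
    exact hj'
  · intro x h1 h2
    obtain ⟨j, hj, rfl⟩ := hsurj x h1 h2
    rw [hrk j hj]
    exact hj

end TreeTSP

namespace RAM

open TreeTSP

/-! ### The rooting program -/

/-- Look for an edge that leaves the set of vertices found so far. -/
def crossingBody : Prog :=
  .seq (.seq (.setIVar 10 (.add (.get 0 (.var 9)) (.lit 1)))
      (.setIVar 11 (.add (.get 1 (.var 9)) (.lit 1))))
    (.ite (.and (.neg (.ieq (.get 3 (.var 10)) (.lit 0))) (.ieq (.get 3 (.var 11)) (.lit 0)))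
      (.seq (.setIVar 12 (.var 10)) (.seq (.setIVar 13 (.var 11)) (.setIVar 14 (.var 9))))
      (.ite (.and (.neg (.ieq (.get 3 (.var 11)) (.lit 0))) (.ieq (.get 3 (.var 10)) (.lit 0)))
        (.seq (.setIVar 12 (.var 11)) (.seq (.setIVar 13 (.var 10)) (.setIVar 14 (.var 9))))
        .skip))

/-- Root the tree at the vertex `1`: array 3 becomes the parent function, array 4 lists the vertices
with parents first, and real array 2 holds the weights of the edges to the parents. -/
def rootProg : Prog :=
  .seq (.seq (.setIArr 3 (.lit 1) (.var 4)) (.setIArr 4 (.lit 0) (.lit 1)))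
    (.for 8 (.sub (.var 0) (.lit 1))
      (.seq (.for 9 (.var 2) crossingBody)
        (.seq (.setIArr 3 (.var 13) (.var 12))
          (.seq (.setRArr 2 (.var 13) (.get 0 (.var 14)))
            (.setIArr 4 (.add (.var 8) (.lit 1)) (.var 13))))))

/-- The scan runs through all edges and remembers the last crossing one. The conclusion is
conditional because the registers mean nothing until a crossing edge has been met. -/
theorem crossing_spec (s : Store) :
    Runs (.for 9 (.var 2) crossingBody) s (s.ivar 2 * 80 + 6) fun s' =>
      (∃ e < s.ivar 2,
        (s.iarr 3 (s.iarr 0 e + 1) ≠ 0 ∧ s.iarr 3 (s.iarr 1 e + 1) = 0) ∨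
        (s.iarr 3 (s.iarr 1 e + 1) ≠ 0 ∧ s.iarr 3 (s.iarr 0 e + 1) = 0)) →
      s'.ivar 14 < s.ivar 2 ∧ s.iarr 3 (s'.ivar 12) ≠ 0 ∧ s.iarr 3 (s'.ivar 13) = 0 ∧
      ((s'.ivar 12 = s.iarr 0 (s'.ivar 14) + 1 ∧ s'.ivar 13 = s.iarr 1 (s'.ivar 14) + 1) ∨
        (s'.ivar 12 = s.iarr 1 (s'.ivar 14) + 1 ∧ s'.ivar 13 = s.iarr 0 (s'.ivar 14) + 1)) := by
  refine Runs.imp (Runs.for (m := s.ivar 2) (T := 72) (T' := 80) (fun i s' => (∃ e < i,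
        (s.iarr 3 (s.iarr 0 e + 1) ≠ 0 ∧ s.iarr 3 (s.iarr 1 e + 1) = 0) ∨
        (s.iarr 3 (s.iarr 1 e + 1) ≠ 0 ∧ s.iarr 3 (s.iarr 0 e + 1) = 0)) →
      s'.ivar 14 < s.ivar 2 ∧ s.iarr 3 (s'.ivar 12) ≠ 0 ∧ s.iarr 3 (s'.ivar 13) = 0 ∧
      ((s'.ivar 12 = s.iarr 0 (s'.ivar 14) + 1 ∧ s'.ivar 13 = s.iarr 1 (s'.ivar 14) + 1) ∨
        (s'.ivar 12 = s.iarr 1 (s'.ivar 14) + 1 ∧ s'.ivar 13 = s.iarr 0 (s'.ivar 14) + 1)))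
    rfl ?_ (fun _ _ _ h => h) ?_ ?_ ?_) ?_ fun _ _ h => h
  · intro s' hf
    exact hf.ivar 2 rfl
  · rintro ⟨e, he, -⟩
    omega
  · intro i hi s' hf hx hinv
    refine Runs.of_wp rfl (by decide) ?_
    simp [crossingBody, Prog.wp, Store.setIVar, IExp.eval, BExp.eval, hx, hf.iarr 0 rfl,
      hf.iarr 1 rfl, hf.iarr 3 rfl]
    refine ⟨fun h1 h2 _ _ _ => ⟨hi, h1, h2⟩, fun h => ⟨fun h1 h2 _ _ _ => ⟨hi, h1, h2⟩, ?_⟩⟩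
    intro h' e he hcr
    refine hinv ⟨e, ?_, hcr⟩
    rcases Nat.lt_or_eq_of_le he with he | rfl
    · exact he
    · rcases hcr with ⟨h1, h2⟩ | ⟨h1, h2⟩
      · exact absurd h2 (h h1)
      · exact absurd h2 (h' h1)
  · simp [IExp.cost]
  · simp [IExp.cost]

theorem rootProg_spec {n : ℕ} {G : SimpleGraph (Fin n)} {wgt : Sym2 (Fin n) → ℝ}
    {l : List (Fin n × Fin n)} (hn : 0 < n) (hG : G.Connected) (hl : IsEdgeList G l)
    (hwgt : ∀ e ∈ G.edgeSet, 0 < wgt e) (s : Store)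
    (h0 : s.ivar 0 = n) (h2 : s.ivar 2 = l.length) (h4 : s.ivar 4 = n + 1)
    (ha : ∀ i (h : i < l.length), s.iarr 0 i = (l[i]).1 ∧ s.iarr 1 i = (l[i]).2 ∧
      s.rarr 0 i = wgt s((l[i]).1, (l[i]).2))
    (h3 : ∀ i, s.iarr 3 i = 0) (hr : ∀ i, s.rarr 2 i = 0) :
    Runs rootProg s (n * (l.length * 80 + 40) + 30) fun s' =>
      PartialRooting G wgt n (s'.iarr 3) (s'.iarr 4) (s'.rarr 2) := by
  refine Runs.imp (Runs.seq (T₁ := 20) (T₂ := (n - 1) * (l.length * 80 + 40) + 3 + 5)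
    (R := fun s' => PartialRooting G wgt 1 (s'.iarr 3) (s'.iarr 4) (s'.rarr 2))
    (Q := fun s' => PartialRooting G wgt n (s'.iarr 3) (s'.iarr 4) (s'.rarr 2)) ?_ ?_) ?_
    fun _ _ h => h
  · refine Runs.of_wp rfl (by decide) ?_
    simp [Prog.wp, Store.setIArr, IExp.eval]
    refine PartialRooting.init hn (fun x => ?_) (by simp) hr
    by_cases hx : x = 1 <;> simp [hx, h3, h4]
  · intro s₁ hf₁ hinit
    refine Runs.imp (Runs.for (m := n - 1) (T := l.length * 80 + 26) (T' := l.length * 80 + 40)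
      (fun i s' => PartialRooting G wgt (i + 1) (s'.iarr 3) (s'.iarr 4) (s'.rarr 2))
      rfl ?_ (fun _ _ _ h => h) hinit ?_ ?_) ?_ ?_
    · intro s' hf
      simp [IExp.eval, hf.ivar 0 rfl, hf₁.ivar 0 rfl, h0]
    · intro i hi s₂ hf₂ hx hinv
      have h2' : s₂.ivar 2 = l.length := by rw [hf₂.ivar 2 rfl, hf₁.ivar 2 rfl, h2]
      have ha' : ∀ i (h : i < l.length), s₂.iarr 0 i = (l[i]).1 ∧ s₂.iarr 1 i = (l[i]).2 ∧
          s₂.rarr 0 i = wgt s((l[i]).1, (l[i]).2) := by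
        intro i h
        rw [hf₂.iarr 0 rfl, hf₁.iarr 0 rfl, hf₂.iarr 1 rfl, hf₁.iarr 1 rfl, hf₂.rarr 0 rfl,
          hf₁.rarr 0 rfl]
        exact ha i h
      refine Runs.imp (Runs.seq (T₂ := 20) (crossing_spec s₂) ?_) (by rw [h2'])
        fun _ _ h => h
      intro s₃ hf₃ hcr
      obtain ⟨u, v, hadj, hu, hv⟩ := hinv.exists_crossing hG (by omega) (by omega)
      obtain ⟨⟨a, b⟩, hp, he⟩ := List.mem_map.mp ((hl.2 u v).mpr hadj)
      obtain ⟨e, he', hget⟩ := List.getElem_of_mem hp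
      obtain ⟨h14, h12, h13, hor⟩ := hcr ⟨e, by rw [h2']; exact he', by
        obtain ⟨e0, e1, -⟩ := ha' e he'
        rw [e0, e1, hget]
        rcases Sym2.eq_iff.mp he with ⟨rfl, rfl⟩ | ⟨rfl, rfl⟩
        · exact Or.inl ⟨hu, hv⟩
        · exact Or.inr ⟨hu, hv⟩⟩
      rw [h2'] at h14
      obtain ⟨e0, e1, e2⟩ := ha' _ h14
      rw [e0, e1] at hor
      have hadj' : G.Adj (l[s₃.ivar 14]).1 (l[s₃.ivar 14]).2 :=
        (hl.2 _ _).mp (List.mem_map.mpr ⟨_, List.getElem_mem h14, rfl⟩)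
      have hw' := hwgt s((l[s₃.ivar 14]).1, (l[s₃.ivar 14]).2) hadj'
      have hx3 : s₃.ivar 8 = i := by rw [hf₃.ivar 8 rfl, hx]
      refine Runs.of_wp rfl (by decide) ?_
      simp [Prog.wp, Store.setIArr, Store.setRArr, IExp.eval, RExp.eval, hx3, hf₃.iarr 3 rfl,
        hf₃.iarr 4 rfl, hf₃.rarr 2 rfl, hf₃.rarr 0 rfl, e2]
      rcases hor with ⟨h5, h6⟩ | ⟨h5, h6⟩
      · rw [h5] at h12 ⊢
        rw [h6] at h13 ⊢
        exact hinv.extend (by omega) h12 h13 hadj' hw'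
      · rw [h5] at h12 ⊢
        rw [h6] at h13 ⊢
        rw [Sym2.eq_swap] at hw' ⊢
        exact hinv.extend (by omega) h12 h13 hadj'.symm hw'
    · simp [IExp.cost]
    · simp [IExp.cost]
    · intro s' _ h
      rwa [Nat.sub_add_cancel hn] at h
  · have := Nat.mul_le_mul_right (l.length * 80 + 40) (Nat.sub_le n 1)
    omega

/-! ### Division tables -/

/-- The machine cannot divide, so quotients and remainders are tabulated by counters that wrap
around as the argument grows by 1. -/
theorem succ_div_mod {i N : ℕ} (hN : 0 < N) :
    (i % N + 1 = N → (i + 1) % N = 0 ∧ (i + 1) / N = i / N + 1) ∧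
    (i % N + 1 ≠ N → (i + 1) % N = i % N + 1 ∧ (i + 1) / N = i / N) := by
  have h1 := Nat.div_add_mod i N
  have h2 := Nat.mod_lt i hN
  constructor
  · intro h
    have e : i + 1 = N * (i / N + 1) := by rw [mul_add, mul_one]; omega
    rw [e]
    exact ⟨Nat.mul_mod_right _ _, Nat.mul_div_cancel_left _ hN⟩
  · intro h
    have h3 : i % N + 1 < N := by omega
    have e : i + 1 = N * (i / N) + (i % N + 1) := by omega
    constructor
    · conv_lhs => rw [e]
      rw [Nat.mul_add_mod, Nat.mod_eq_of_lt h3]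
    · conv_lhs => rw [e]
      rw [Nat.mul_add_div hN, Nat.div_eq_of_lt h3, add_zero]

/-- Arrays 5, 6, 7 become `w / v₄`, `w % v₄`, `w % v₅` for `w < v₆`. -/
def divProg : Prog :=
  .seq (.seq (.setIVar 10 (.lit 0)) (.seq (.setIVar 11 (.lit 0)) (.setIVar 12 (.lit 0))))
    (.for 8 (.var 6)
      (.seq (.seq (.setIArr 5 (.var 8) (.var 10))
          (.seq (.setIArr 6 (.var 8) (.var 11)) (.setIArr 7 (.var 8) (.var 12))))
        (.seq (.seq (.setIVar 11 (.add (.var 11) (.lit 1))) (.setIVar 12 (.add (.var 12) (.lit 1))))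
          (.seq
            (.ite (.ieq (.var 11) (.var 4))
              (.seq (.setIVar 11 (.lit 0)) (.setIVar 10 (.add (.var 10) (.lit 1)))) .skip)
            (.ite (.ieq (.var 12) (.var 5)) (.setIVar 12 (.lit 0)) .skip)))))

theorem divProg_spec (s : Store) (h4 : 0 < s.ivar 4) (h5 : 0 < s.ivar 5) :
    Runs divProg s (s.ivar 6 * 60 + 20) fun s' => ∀ w < s.ivar 6,
      s'.iarr 5 w = w / s.ivar 4 ∧ s'.iarr 6 w = w % s.ivar 4 ∧ s'.iarr 7 w = w % s.ivar 5 := by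
  refine Runs.imp (Runs.seq (T₁ := 10) (T₂ := s.ivar 6 * 60 + 6)
    (R := fun s' => s'.ivar 10 = 0 ∧ s'.ivar 11 = 0 ∧ s'.ivar 12 = 0)
    (Q := fun s' => ∀ w < s.ivar 6,
      s'.iarr 5 w = w / s.ivar 4 ∧ s'.iarr 6 w = w % s.ivar 4 ∧ s'.iarr 7 w = w % s.ivar 5)
    ?_ ?_) (by omega) fun _ _ h => h
  · exact Runs.of_wp rfl (by decide) (by simp [Prog.wp, Store.setIVar, IExp.eval])
  · rintro s₁ hf₁ ⟨h10, h11, h12⟩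
    refine Runs.imp (Runs.for (m := s.ivar 6) (T := 50) (T' := 60)
      (fun i s' => s'.ivar 10 = i / s.ivar 4 ∧ s'.ivar 11 = i % s.ivar 4 ∧
        s'.ivar 12 = i % s.ivar 5 ∧ ∀ w < i,
        s'.iarr 5 w = w / s.ivar 4 ∧ s'.iarr 6 w = w % s.ivar 4 ∧ s'.iarr 7 w = w % s.ivar 5)
      rfl ?_ (fun _ _ _ h => h) ?_ ?_ ?_) ?_ (fun _ _ h => h.2.2.2)
    · intro s' hf
      simp [IExp.eval, hf.ivar 6 rfl, hf₁.ivar 6 rfl]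
    · simp [h10, h11, h12]
    · rintro i hi s₂ hf₂ hx ⟨i10, i11, i12, hinv⟩
      have e4 : s₂.ivar 4 = s.ivar 4 := by rw [hf₂.ivar 4 rfl, hf₁.ivar 4 rfl]
      have e5 : s₂.ivar 5 = s.ivar 5 := by rw [hf₂.ivar 5 rfl, hf₁.ivar 5 rfl]
      have hN := succ_div_mod (i := i) h4
      have hM := succ_div_mod (i := i) h5
      have hw : ∀ w ≤ i,
          Function.update (s₂.iarr 5) i (i / s.ivar 4) w = w / s.ivar 4 ∧
          Function.update (s₂.iarr 6) i (i % s.ivar 4) w = w % s.ivar 4 ∧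
          Function.update (s₂.iarr 7) i (i % s.ivar 5) w = w % s.ivar 5 := by
        intro w hw
        rcases Nat.lt_or_eq_of_le hw with hw | rfl
        · simp only [Function.update_of_ne hw.ne]
          exact hinv w hw
        · simp
      refine Runs.of_wp rfl (by decide) ?_
      simp only [Prog.wp, Store.setIVar, Store.setIArr, IExp.eval, BExp.eval]
      simp [hx, i10, i11, i12, e4, e5]
      refine ⟨fun h => ⟨fun h' => ⟨?_, ?_, ?_, hw⟩, fun h' => ⟨?_, ?_, ?_, hw⟩⟩,
        fun h => ⟨fun h' => ⟨?_, ?_, ?_, hw⟩, fun h' => ⟨?_, ?_, ?_, hw⟩⟩⟩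
      · rw [(hN.1 h).2]
      · rw [(hN.1 h).1]
      · rw [(hM.1 h').1]
      · rw [(hN.1 h).2]
      · rw [(hN.1 h).1]
      · rw [(hM.2 h').1]
      · rw [(hN.2 h).2]
      · rw [(hN.2 h).1]
      · rw [(hM.1 h').1]
      · rw [(hN.2 h).2]
      · rw [(hN.2 h).1]
      · rw [(hM.2 h').1]
    · simp [IExp.cost]
    · simp [IExp.cost]

/-! ### Tables of window properties -/

/-- Inspect the digit number `v₉` of a window with central symbol `v₁₄` and newest symbol `v₁₅`. -/
def windowBody : Prog :=
  .seq (.setIVar 17 (.get 6 (.var 13)))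
    (.seq
      (.ite (.and (.and (.ilt (.lit 0) (.var 9)) (.ilt (.lit 0) (.var 15)))
          (.ieq (.var 17) (.var 15))) (.setIVar 18 (.lit 0)) .skip)
      (.seq
        (.ite (.ieq (.var 17) (.var 16))
          (.seq (.setIVar 19 (.lit 1))
            (.setRVar 0 (.mul (.get 1 (.add (.sub (.var 9) (.var 3)) (.sub (.var 3) (.var 9))))
              (.get 2 (.var 14))))) .skip)
        (.setIVar 13 (.get 5 (.var 13)))))

/-- Arrays 8, 9, 10 and real array 3 become the tables of `WinNew`, `WinFound`, the central symbols
and the edge gains. -/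
def windowProg : Prog :=
  .for 8 (.var 6)
    (.seq (.setIVar 13 (.var 8))
      (.seq (.for 9 (.var 3) (.setIVar 13 (.get 5 (.var 13))))
        (.seq
          (.seq (.setIVar 14 (.get 6 (.var 13)))
            (.seq (.setIVar 16 (.get 3 (.var 14)))
              (.seq (.setIVar 13 (.var 8))
                (.seq (.setIVar 15 (.get 6 (.var 8)))
                  (.seq (.setIVar 18 (.lit 1))
                    (.seq (.setIVar 19 (.lit 0)) (.setRVar 0 (.lit 0))))))))
          (.seq (.for 9 (.add (.add (.var 3) (.var 3)) (.lit 1)) windowBody)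
            (.seq (.setIArr 8 (.var 8) (.var 18))
              (.seq (.setIArr 9 (.var 8) (.var 19))
                (.seq (.setIArr 10 (.var 8) (.var 14)) (.setRArr 3 (.var 8) (.var 0)))))))))

/-- The tables of windows are correct. -/
structure WindowTables (n K : ℕ) (s : Store) : Prop where
  div : ∀ w < (n + 1) ^ (2 * K + 1), s.iarr 5 w = w / (n + 1)
  mod : ∀ w < (n + 1) ^ (2 * K + 1), s.iarr 6 w = w % (n + 1)
  modPow : ∀ w < (n + 1) ^ (2 * K + 1), s.iarr 7 w = w % (n + 1) ^ (2 * K)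
  new : ∀ w < (n + 1) ^ (2 * K + 1), s.iarr 8 w = 1 ↔ WinNew n K w
  found : ∀ w < (n + 1) ^ (2 * K + 1), s.iarr 9 w = 1 ↔ WinFound n K (s.iarr 3) w
  cen : ∀ w < (n + 1) ^ (2 * K + 1), s.iarr 10 w = digit (n + 1) w K
  edge : EdgeGain n K (s.iarr 3) (s.rarr 1) (s.rarr 2) (s.rarr 3)

/-- If the parent symbol occurs several times in the window, the last inspected occurrence fixes the
recorded gain. This is harmless: `EdgeGain` asks only for some occurrence, and in a layout it is
unique. -/
theorem windowLoop_spec {n K w : ℕ} (s : Store) (h3 : s.ivar 3 = K)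
    (h13 : s.ivar 13 = w) (h14 : s.ivar 14 = digit (n + 1) w K)
    (h15 : s.ivar 15 = digit (n + 1) w 0) (h16 : s.ivar 16 = s.iarr 3 (s.ivar 14))
    (h18 : s.ivar 18 = 1) (h19 : s.ivar 19 = 0) (hr : s.rvar 0 = 0)
    (h5 : ∀ w < (n + 1) ^ (2 * K + 1), s.iarr 5 w = w / (n + 1))
    (h6 : ∀ w < (n + 1) ^ (2 * K + 1), s.iarr 6 w = w % (n + 1))
    (hw : w < (n + 1) ^ (2 * K + 1)) :
    Runs (.for 9 (.add (.add (.var 3) (.var 3)) (.lit 1)) windowBody) s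
      ((2 * K + 1) * 80 + 10) fun s' =>
      (s'.ivar 18 = 1 ↔ WinNew n K w) ∧ (s'.ivar 19 = 1 ↔ WinFound n K (s.iarr 3) w) ∧
      (WinFound n K (s.iarr 3) w → ∃ i ≤ 2 * K,
        digit (n + 1) w i = s.iarr 3 (digit (n + 1) w K) ∧
        s'.rvar 0 = s.rarr 1 ((i - K) + (K - i)) * s.rarr 2 (digit (n + 1) w K)) ∧
      (¬ WinFound n K (s.iarr 3) w → s'.rvar 0 = 0) := by
  have hdiv : ∀ i, w / (n + 1) ^ i < (n + 1) ^ (2 * K + 1) := fun i =>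
    lt_of_le_of_lt (Nat.div_le_self _ _) hw
  refine Runs.imp (Runs.for (m := 2 * K + 1) (T := 64) (T' := 80)
    (fun m s' => s'.ivar 13 = w / (n + 1) ^ m ∧
      (s'.ivar 18 = 1 ↔ ∀ i < m, 0 < i → digit (n + 1) w 0 ≠ 0 →
        digit (n + 1) w i ≠ digit (n + 1) w 0) ∧
      (s'.ivar 19 = 1 ↔ ∃ i < m, digit (n + 1) w i = s.iarr 3 (digit (n + 1) w K)) ∧
      ((∃ i < m, digit (n + 1) w i = s.iarr 3 (digit (n + 1) w K)) → ∃ i < m,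
        digit (n + 1) w i = s.iarr 3 (digit (n + 1) w K) ∧
        s'.rvar 0 = s.rarr 1 ((i - K) + (K - i)) * s.rarr 2 (digit (n + 1) w K)) ∧
      ((¬ ∃ i < m, digit (n + 1) w i = s.iarr 3 (digit (n + 1) w K)) → s'.rvar 0 = 0))
    rfl ?_ (fun _ _ _ h => h) ?_ ?_ ?_) ?_ ?_
  · intro s' hf
    simp [IExp.eval, hf.ivar 3 rfl, h3]; ring
  · simp [h13, h18, h19, hr]
  · rintro i hi s₁ hf hx ⟨i13, i18, i19, ir, ir'⟩
    have e17 : s₁.iarr 6 (w / (n + 1) ^ i) = digit (n + 1) w i := by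
      rw [hf.iarr 6 rfl, h6 _ (hdiv i), digit]
    have e13 : s₁.iarr 5 (w / (n + 1) ^ i) = w / (n + 1) ^ (i + 1) := by
      rw [hf.iarr 5 rfl, h5 _ (hdiv i), Nat.div_div_eq_div_mul, pow_succ]
    have hnew : (∀ j < i + 1, 0 < j → digit (n + 1) w 0 ≠ 0 →
        digit (n + 1) w j ≠ digit (n + 1) w 0) ↔
        (∀ j < i, 0 < j → digit (n + 1) w 0 ≠ 0 → digit (n + 1) w j ≠ digit (n + 1) w 0) ∧
        ¬ ((0 < i ∧ 0 < digit (n + 1) w 0) ∧ digit (n + 1) w i = digit (n + 1) w 0) := by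
      constructor
      · exact fun h => ⟨fun j hj => h j (by omega),
          fun h' => h i (by omega) h'.1.1 h'.1.2.ne' h'.2⟩
      · rintro ⟨h, h'⟩ j hj hj0 hd he
        rcases Nat.lt_succ_iff_lt_or_eq.mp hj with hj | rfl
        · exact h j hj hj0 hd he
        · exact h' ⟨⟨hj0, Nat.pos_of_ne_zero hd⟩, he⟩
    have hfound : (∃ j < i + 1, digit (n + 1) w j = s.iarr 3 (digit (n + 1) w K)) ↔
        (∃ j < i, digit (n + 1) w j = s.iarr 3 (digit (n + 1) w K)) ∨
        digit (n + 1) w i = s.iarr 3 (digit (n + 1) w K) := by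
      constructor
      · rintro ⟨j, hj, he⟩
        rcases Nat.lt_succ_iff_lt_or_eq.mp hj with hj | rfl
        · exact Or.inl ⟨j, hj, he⟩
        · exact Or.inr he
      · rintro (⟨j, hj, he⟩ | he)
        · exact ⟨j, by omega, he⟩
        · exact ⟨i, by omega, he⟩
    refine Runs.of_wp rfl (by decide) ?_
    have e3 : s₁.ivar 3 = K := by rw [hf.ivar 3 rfl, h3]
    have e14 : s₁.ivar 14 = digit (n + 1) w K := by rw [hf.ivar 14 rfl, h14]
    have e15 : s₁.ivar 15 = digit (n + 1) w 0 := by rw [hf.ivar 15 rfl, h15]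
    have e16 : s₁.ivar 16 = s.iarr 3 (digit (n + 1) w K) := by rw [hf.ivar 16 rfl, h16, h14]
    have er1 : s₁.rarr 1 = s.rarr 1 := hf.rarr 1 rfl
    have er2 : s₁.rarr 2 = s.rarr 2 := hf.rarr 2 rfl
    rw [hnew, hfound]
    generalize (∀ j < i, 0 < j → digit (n + 1) w 0 ≠ 0 → digit (n + 1) w j ≠ digit (n + 1) w 0) =
      PN at i18 ⊢
    by_cases hB : digit (n + 1) w i = s.iarr 3 (digit (n + 1) w K)
    · simp [windowBody, Prog.wp, Store.setIVar, Store.setRVar, IExp.eval, RExp.eval, BExp.eval, hx,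
        i13, e17, e13, e3, e14, e15, e16, er1, er2, i18, i19, hB]
      exact ⟨fun a b c => ⟨fun _ => ⟨a, b, c⟩, i, le_rfl, hB, Or.inl rfl⟩,
        fun h => ⟨fun _ => h, i, le_rfl, hB, Or.inl rfl⟩⟩
    · have irn : ∀ x < i, digit (n + 1) w x = s.iarr 3 (digit (n + 1) w K) →
          ∃ j ≤ i, digit (n + 1) w j = s.iarr 3 (digit (n + 1) w K) ∧
            s₁.rvar 0 = s.rarr 1 (j - K + (K - j)) * s.rarr 2 (digit (n + 1) w K) := by
        intro x hxi he
        obtain ⟨j, hj, h⟩ := ir ⟨x, hxi, he⟩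
        exact ⟨j, hj.le, h⟩
      have irn' : (∀ x < i, ¬ digit (n + 1) w x = s.iarr 3 (digit (n + 1) w K)) →
          s₁.rvar 0 = 0 := fun h => ir' fun ⟨j, hj, e⟩ => h j hj e
      simp [windowBody, Prog.wp, Store.setIVar, Store.setRVar, IExp.eval, RExp.eval, BExp.eval, hx,
        i13, e17, e13, e3, e14, e15, e16, er1, er2, i18, i19, hB]
      exact ⟨fun a b c => ⟨fun _ => ⟨a, b, c⟩, irn, irn'⟩, fun h => ⟨fun _ => h, irn, irn'⟩⟩
  · simp [IExp.cost]
  · simp [IExp.cost]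
  · rintro s' hf ⟨-, i18, i19, ir, ir'⟩
    have hfound : WinFound n K (s.iarr 3) w ↔
        ∃ i < 2 * K + 1, digit (n + 1) w i = s.iarr 3 (digit (n + 1) w K) := by
      simp only [WinFound, Nat.lt_succ_iff]
    have hnew : WinNew n K w ↔ ∀ i < 2 * K + 1, 0 < i → digit (n + 1) w 0 ≠ 0 →
        digit (n + 1) w i ≠ digit (n + 1) w 0 := by
      simp only [WinNew, Nat.lt_succ_iff]
      exact ⟨fun h i hi h0 => h i h0 hi, fun h i h0 hi => h i hi h0⟩
    rw [hfound, hnew]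
    refine ⟨i18, i19, fun h => ?_, ir'⟩
    obtain ⟨i, hi, h⟩ := ir h
    exact ⟨i, by omega, h⟩

theorem windowProg_spec {n K : ℕ} (s : Store) (h3 : s.ivar 3 = K)
    (h6v : s.ivar 6 = (n + 1) ^ (2 * K + 1))
    (h5 : ∀ w < (n + 1) ^ (2 * K + 1), s.iarr 5 w = w / (n + 1))
    (h6 : ∀ w < (n + 1) ^ (2 * K + 1), s.iarr 6 w = w % (n + 1))
    (h7 : ∀ w < (n + 1) ^ (2 * K + 1), s.iarr 7 w = w % (n + 1) ^ (2 * K)) :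
    Runs windowProg s ((n + 1) ^ (2 * K + 1) * (K * 180 + 200) + 6)
      (WindowTables n K) := by
  refine Runs.imp (Runs.for (m := (n + 1) ^ (2 * K + 1)) (T := K * 180 + 180)
    (T' := K * 180 + 200)
    (fun m s' => ∀ w < m, (s'.iarr 8 w = 1 ↔ WinNew n K w) ∧
      (s'.iarr 9 w = 1 ↔ WinFound n K (s.iarr 3) w) ∧ s'.iarr 10 w = digit (n + 1) w K ∧
      (WinFound n K (s.iarr 3) w → ∃ i ≤ 2 * K,
        digit (n + 1) w i = s.iarr 3 (digit (n + 1) w K) ∧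
        s'.rarr 3 w = s.rarr 1 ((i - K) + (K - i)) * s.rarr 2 (digit (n + 1) w K)) ∧
      (¬ WinFound n K (s.iarr 3) w → s'.rarr 3 w = 0))
    rfl ?_ (fun _ _ _ h => h) ?_ ?_ ?_) ?_ ?_
  · intro s' hf
    simp [IExp.eval, hf.ivar 6 rfl, h6v]
  · intro w hw
    omega
  · intro w hw s₁ hf₁ hx hinv
    have hdiv : ∀ i, w / (n + 1) ^ i < (n + 1) ^ (2 * K + 1) := fun i =>
      lt_of_le_of_lt (Nat.div_le_self _ _) hw
    refine Runs.imp (Runs.seq (T₁ := 2) (R := fun s' => s'.ivar 13 = w)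
      (T₂ := (K * 15 + 6) + (30 + (((2 * K + 1) * 80 + 10) + 12)))
      (Runs.of_wp rfl (by decide) (by simp [Prog.wp, Store.setIVar, IExp.eval, hx]))
      fun s₂ hf₂ h13 => Runs.seq (R := fun s' => s'.ivar 13 = w / (n + 1) ^ K) ?_
      fun s₃ hf₃ h13' => Runs.seq (R := fun s' => s'.ivar 14 = digit (n + 1) w K ∧
        s'.ivar 16 = s.iarr 3 (digit (n + 1) w K) ∧ s'.ivar 13 = w ∧
        s'.ivar 15 = digit (n + 1) w 0 ∧ s'.ivar 18 = 1 ∧ s'.ivar 19 = 0 ∧ s'.rvar 0 = 0)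
        (Runs.of_wp rfl (by decide) ?_)
      fun s₄ hf₄ ⟨h14, h16, h13'', h15, h18, h19, hr⟩ => Runs.seq
        (windowLoop_spec (n := n) (K := K) (w := w) s₄ ?_ h13'' h14 h15 ?_ h18 h19 hr ?_ ?_ hw)
      fun s₅ hf₅ ⟨w8, w9, we, we'⟩ => Runs.of_wp rfl (by decide) ?_) ?_ fun _ _ h => h
    · refine Runs.imp (Runs.for (m := K) (T := 4) (T' := 15)
        (fun i s' => s'.ivar 13 = w / (n + 1) ^ i) rfl ?_ (fun _ _ _ h => h) ?_ ?_ ?_) ?_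
        fun _ _ h => h
      · intro s' hf
        simp [IExp.eval, hf.ivar 3 rfl, hf₂.ivar 3 rfl, hf₁.ivar 3 rfl, h3]
      · simp [h13]
      · intro i hi s' hf hx' h
        refine Runs.of_wp rfl (by decide) ?_
        simp [Prog.wp, Store.setIVar, IExp.eval, h, hf.iarr 5 rfl, hf₂.iarr 5 rfl, hf₁.iarr 5 rfl,
          h5 _ (hdiv i), Nat.div_div_eq_div_mul, pow_succ]
      · simp [IExp.cost]
      · simp [IExp.cost]
    · have e6 : s₃.iarr 6 = s.iarr 6 := by rw [hf₃.iarr 6 rfl, hf₂.iarr 6 rfl, hf₁.iarr 6 rfl]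
      have e3 : s₃.iarr 3 = s.iarr 3 := by rw [hf₃.iarr 3 rfl, hf₂.iarr 3 rfl, hf₁.iarr 3 rfl]
      have e8 : s₃.ivar 8 = w := by rw [hf₃.ivar 8 rfl, hf₂.ivar 8 rfl, hx]
      simp [Prog.wp, Store.setIVar, Store.setRVar, IExp.eval, RExp.eval, h13', e6, e3, e8,
        h6 _ (hdiv K), h6 w hw, digit]
    · rw [hf₄.ivar 3 rfl, hf₃.ivar 3 rfl, hf₂.ivar 3 rfl, hf₁.ivar 3 rfl, h3]
    · rw [h16, h14, hf₄.iarr 3 rfl, hf₃.iarr 3 rfl, hf₂.iarr 3 rfl, hf₁.iarr 3 rfl]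
    · rwa [hf₄.iarr 5 rfl, hf₃.iarr 5 rfl, hf₂.iarr 5 rfl, hf₁.iarr 5 rfl]
    · rwa [hf₄.iarr 6 rfl, hf₃.iarr 6 rfl, hf₂.iarr 6 rfl, hf₁.iarr 6 rfl]
    · have e8 : s₅.ivar 8 = w := by
        rw [hf₅.ivar 8 rfl, hf₄.ivar 8 rfl, hf₃.ivar 8 rfl, hf₂.ivar 8 rfl, hx]
      have e14 : s₅.ivar 14 = digit (n + 1) w K := by rw [hf₅.ivar 14 rfl, h14]
      have a3 : s₄.iarr 3 = s.iarr 3 := by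
        rw [hf₄.iarr 3 rfl, hf₃.iarr 3 rfl, hf₂.iarr 3 rfl, hf₁.iarr 3 rfl]
      have r1 : s₄.rarr 1 = s.rarr 1 := by
        rw [hf₄.rarr 1 rfl, hf₃.rarr 1 rfl, hf₂.rarr 1 rfl, hf₁.rarr 1 rfl]
      have r2 : s₄.rarr 2 = s.rarr 2 := by
        rw [hf₄.rarr 2 rfl, hf₃.rarr 2 rfl, hf₂.rarr 2 rfl, hf₁.rarr 2 rfl]
      have a8 : s₅.iarr 8 = s₁.iarr 8 := by
        rw [hf₅.iarr 8 rfl, hf₄.iarr 8 rfl, hf₃.iarr 8 rfl, hf₂.iarr 8 rfl]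
      have a9 : s₅.iarr 9 = s₁.iarr 9 := by
        rw [hf₅.iarr 9 rfl, hf₄.iarr 9 rfl, hf₃.iarr 9 rfl, hf₂.iarr 9 rfl]
      have a10 : s₅.iarr 10 = s₁.iarr 10 := by
        rw [hf₅.iarr 10 rfl, hf₄.iarr 10 rfl, hf₃.iarr 10 rfl, hf₂.iarr 10 rfl]
      have r3 : s₅.rarr 3 = s₁.rarr 3 := by
        rw [hf₅.rarr 3 rfl, hf₄.rarr 3 rfl, hf₃.rarr 3 rfl, hf₂.rarr 3 rfl]
      rw [a3] at w9 we we'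
      rw [r1, r2] at we
      simp only [Prog.wp, Store.setIArr, Store.setRArr, IExp.eval, RExp.eval]
      intro u hu
      simp only [e8, e14, a8, a9, a10, r3, ne_eq, Nat.reduceEqDiff,
        not_false_eq_true, Function.update_of_ne, Function.update_self]
      rcases Nat.lt_succ_iff_lt_or_eq.mp hu with hu | rfl
      · simp only [Function.update_of_ne hu.ne]
        exact hinv u hu
      · simp only [Function.update_self]
        exact ⟨w8, w9, trivial, we, we'⟩
    · omega
  · simp [IExp.cost]
  · simp [IExp.cost]
  · intro s' hf h
    have a3 : s'.iarr 3 = s.iarr 3 := hf.iarr 3 rfl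
    refine ⟨?_, ?_, ?_, fun w hw => (h w hw).1, ?_, fun w hw => (h w hw).2.2.1, ?_⟩
    · rwa [hf.iarr 5 rfl]
    · rwa [hf.iarr 6 rfl]
    · rwa [hf.iarr 7 rfl]
    · rw [a3]
      exact fun w hw => (h w hw).2.1
    · rw [a3, hf.rarr 1 rfl, hf.rarr 2 rfl]
      exact fun w hw => (h w hw).2.2.2

/-- The sizes that the program computes at the start. -/
structure Params (n K : ℕ) (s : Store) : Prop where
  vertices : s.ivar 0 = n
  radius : s.ivar 3 = K
  base : s.ivar 4 = n + 1
  states : s.ivar 5 = (n + 1) ^ (2 * K)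
  windows : s.ivar 6 = (n + 1) ^ (2 * K + 1)
  steps : s.ivar 7 = 2 * n + 2 * K

theorem Params.of_frame {n K : ℕ} {p : Prog} {s s' : Store} (h : Params n K s)
    (hf : Frame p s s') (hp : ([0, 3, 4, 5, 6, 7].all fun x => !p.writesIVar x) = true) :
    Params n K s' := by
  simp only [List.all_cons, List.all_nil, Bool.and_eq_true, Bool.not_eq_true'] at hp
  obtain ⟨h0, h3, h4, h5, h6, h7, -⟩ := hp
  exact ⟨by rw [hf.ivar 0 h0, h.vertices], by rw [hf.ivar 3 h3, h.radius], by rw [hf.ivar 4 h4, h.base],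
    by rw [hf.ivar 5 h5, h.states], by rw [hf.ivar 6 h6, h.windows],
    by rw [hf.ivar 7 h7, h.steps]⟩

theorem WindowTables.of_frame {n K : ℕ} {p : Prog} {s s' : Store} (h : WindowTables n K s)
    (hf : Frame p s s') (hp : ([3, 5, 6, 7, 8, 9, 10].all fun x => !p.writesIArr x) = true)
    (hr : ([1, 2, 3].all fun x => !p.writesRArr x) = true) :
    WindowTables n K s' := by
  simp only [List.all_cons, List.all_nil, Bool.and_eq_true, Bool.not_eq_true'] at hp hr
  obtain ⟨a3, a5, a6, a7, a8, a9, a10, -⟩ := hp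
  obtain ⟨r1, r2, r3, -⟩ := hr
  constructor
  · rw [hf.iarr 5 a5]; exact h.div
  · rw [hf.iarr 6 a6]; exact h.mod
  · rw [hf.iarr 7 a7]; exact h.modPow
  · rw [hf.iarr 8 a8]; exact h.new
  · rw [hf.iarr 9 a9, hf.iarr 3 a3]; exact h.found
  · rw [hf.iarr 10 a10]; exact h.cen
  · rw [hf.iarr 3 a3, hf.rarr 1 r1, hf.rarr 2 r2, hf.rarr 3 r3]; exact h.edge

/-! ### Filling the dynamic programming tables -/

/-- Use the window `v₁₀` to improve its target state in the next layer. -/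
def relaxBody : Prog :=
  .seq (.seq (.setIVar 11 (.add (.var 20) (.get 5 (.var 10))))
      (.seq (.setIVar 12 (.add (.add (.var 20) (.var 5)) (.get 7 (.var 10))))
        (.setIVar 13 (.get 10 (.var 10)))))
    (.ite
      (.and
        (.and (.ieq (.get 11 (.var 11)) (.lit 1)) (.ieq (.get 8 (.var 10)) (.lit 1)))
        (.and
          (.or (.and (.ieq (.get 6 (.var 10)) (.var 22)) (.ieq (.var 9) (.var 0)))
            (.and (.neg (.ieq (.get 6 (.var 10)) (.var 22))) (.neg (.ieq (.var 9) (.var 0)))))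
          (.or (.or (.ieq (.var 13) (.lit 0)) (.ieq (.var 13) (.var 22)))
            (.ieq (.get 9 (.var 10)) (.lit 1)))))
      (.seq
        (.ite (.ieq (.var 13) (.var 22))
          (.setRVar 0 (.add (.get 4 (.var 11)) (.lit 0)))
          (.setRVar 0 (.add (.get 4 (.var 11)) (.add (.get 3 (.var 10)) (.get 5 (.var 13))))))
        (.ite (.or (.ieq (.get 11 (.var 12)) (.lit 0)) (.rlt (.get 4 (.var 12)) (.var 0)))
          (.seq (.setIArr 11 (.var 12) (.lit 1))
            (.seq (.setIArr 12 (.var 12) (.var 10)) (.setRArr 4 (.var 12) (.var 0))))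
          .skip))
      .skip)

/-- Windows are tried in increasing order, with `TableStep` up to the current window as invariant.
Only the reachability flags need clearing beforehand: stale values and back pointers from earlier
tops are never read while the flag is 0. -/
theorem relaxLoop_spec {n K v j : ℕ} (s : Store) (P : Params n K s) (W : WindowTables n K s)
    (h20 : s.ivar 20 = j * (n + 1) ^ (2 * K)) (h22 : s.ivar 22 = v) (h9 : s.ivar 9 = j)
    (hok : ∀ c < (n + 1) ^ (2 * K), s.iarr 11 ((j + 1) * (n + 1) ^ (2 * K) + c) = 0) :
    Runs (.for 10 (.var 6) relaxBody) s ((n + 1) ^ (2 * K + 1) * 300 + 6) fun s' =>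
      TableStep n K (s.iarr 3) (s.rarr 3) (s.rarr 5) v j ((n + 1) ^ (2 * K + 1)) (s'.iarr 11)
        (s'.iarr 12) (s'.rarr 4) ∧
      ∀ a < (j + 1) * (n + 1) ^ (2 * K), s'.iarr 11 a = s.iarr 11 a ∧
        s'.iarr 12 a = s.iarr 12 a ∧ s'.rarr 4 a = s.rarr 4 a := by
  refine Runs.imp (Runs.for (m := (n + 1) ^ (2 * K + 1)) (T := 250) (T' := 300)
    (fun m s' => TableStep n K (s.iarr 3) (s.rarr 3) (s.rarr 5) v j m (s'.iarr 11)
        (s'.iarr 12) (s'.rarr 4) ∧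
      ∀ a < (j + 1) * (n + 1) ^ (2 * K), s'.iarr 11 a = s.iarr 11 a ∧
        s'.iarr 12 a = s.iarr 12 a ∧ s'.rarr 4 a = s.rarr 4 a)
    rfl ?_ (fun _ _ _ h => h) ⟨TableStep.init hok, fun _ _ => ⟨rfl, rfl, rfl⟩⟩ ?_ ?_) ?_
    fun _ _ h => h
  · intro s' hf
    simp [IExp.eval, hf.ivar 6 rfl, P.windows]
  · rintro w hw s₁ hf hx ⟨hT, hag⟩
    have a10 : s₁.iarr 10 w = digit (n + 1) w K := by rw [hf.iarr 10 rfl, W.cen w hw]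
    refine Runs.imp (Runs.seq (T₁ := 30) (T₂ := 220)
      (R := fun s' => s'.ivar 11 = j * (n + 1) ^ (2 * K) + w / (n + 1) ∧
        s'.ivar 12 = (j + 1) * (n + 1) ^ (2 * K) + w % (n + 1) ^ (2 * K) ∧
        s'.ivar 13 = digit (n + 1) w K) (Runs.of_wp rfl (by decide) ?_) ?_) le_rfl
      fun _ _ h => h
    · have a5 : s₁.iarr 5 w = w / (n + 1) := by rw [hf.iarr 5 rfl, W.div w hw]
      have a7 : s₁.iarr 7 w = w % (n + 1) ^ (2 * K) := by rw [hf.iarr 7 rfl, W.modPow w hw]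
      have e20 : s₁.ivar 20 = j * (n + 1) ^ (2 * K) := by rw [hf.ivar 20 rfl, h20]
      have e5 : s₁.ivar 5 = (n + 1) ^ (2 * K) := by rw [hf.ivar 5 rfl, P.states]
      simp [Prog.wp, Store.setIVar, IExp.eval, hx, a5, a7, a10, e20, e5]
      ring
    · rintro s₂ hf₂ ⟨e11, e12, e13⟩
      have e22 : s₂.ivar 22 = v := by rw [hf₂.ivar 22 rfl, hf.ivar 22 rfl, h22]
      have e9 : s₂.ivar 9 = j := by rw [hf₂.ivar 9 rfl, hf.ivar 9 rfl, h9]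
      have e0 : s₂.ivar 0 = n := by rw [hf₂.ivar 0 rfl, hf.ivar 0 rfl, P.vertices]
      have e10 : s₂.ivar 10 = w := by rw [hf₂.ivar 10 rfl, hx]
      have a6 : s₂.iarr 6 w = digit (n + 1) w 0 := by
        rw [hf₂.iarr 6 rfl, hf.iarr 6 rfl, W.mod w hw, digit, pow_zero, Nat.div_one]
      have a8 : s₂.iarr 8 w = 1 ↔ WinNew n K w := by
        rw [hf₂.iarr 8 rfl, hf.iarr 8 rfl, W.new w hw]
      have a9 : s₂.iarr 9 w = 1 ↔ WinFound n K (s.iarr 3) w := by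
        rw [hf₂.iarr 9 rfl, hf.iarr 9 rfl, W.found w hw]
      have r3 : s₂.rarr 3 = s.rarr 3 := by rw [hf₂.rarr 3 rfl, hf.rarr 3 rfl]
      have r5 : s₂.rarr 5 = s.rarr 5 := by rw [hf₂.rarr 5 rfl, hf.rarr 5 rfl]
      rw [← hf₂.iarr 11 rfl, ← hf₂.iarr 12 rfl, ← hf₂.rarr 4 rfl] at hT
      rw [← hf₂.iarr 11 rfl, ← hf₂.iarr 12 rfl, ← hf₂.rarr 4 rfl] at hag
      have hcond : Admissible n K (s.iarr 3) v j w ↔ (WinNew n K w ∧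
          ((digit (n + 1) w 0 = v ∧ j = n) ∨ (¬ digit (n + 1) w 0 = v ∧ ¬ j = n)) ∧
          ((digit (n + 1) w K = 0 ∨ digit (n + 1) w K = v) ∨ WinFound n K (s.iarr 3) w)) := by
        rw [Admissible, or_assoc]
        tauto
      have hadd : ∀ x : ℝ,
          x = s₂.rarr 4 (j * (n + 1) ^ (2 * K) + w / (n + 1)) +
            gain n K (s.rarr 3) (s.rarr 5) v w →
          Admissible n K (s.iarr 3) v j w →
          s₂.iarr 11 (j * (n + 1) ^ (2 * K) + w / (n + 1)) = 1 →
          (Prog.ite (.or (.ieq (.get 11 (.var 12)) (.lit 0)) (.rlt (.get 4 (.var 12)) (.var 0)))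
            (.seq (.setIArr 11 (.var 12) (.lit 1))
              (.seq (.setIArr 12 (.var 12) (.var 10)) (.setRArr 4 (.var 12) (.var 0))))
            .skip).wp (fun s' => TableStep n K (s.iarr 3) (s.rarr 3) (s.rarr 5) v j (w + 1)
              (s'.iarr 11) (s'.iarr 12) (s'.rarr 4) ∧
            ∀ a < (j + 1) * (n + 1) ^ (2 * K), s'.iarr 11 a = s.iarr 11 a ∧
              s'.iarr 12 a = s.iarr 12 a ∧ s'.rarr 4 a = s.rarr 4 a) (s₂.setRVar 0 x) := by
        intro x hxe hadm hok1
        simp only [Prog.wp, BExp.eval, IExp.eval, RExp.eval, Store.setRVar, Store.setIArr,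
          Store.setRArr, e12, e10, Function.update_self]
        refine ⟨fun hlt => ⟨?_, fun a ha => ?_⟩, fun hlt => ⟨hT.skip fun _ _ => ?_, hag⟩⟩
        · simpa using hT.update hw hadm hok1 rfl rfl hxe hlt
        · have hne : a ≠ (j + 1) * (n + 1) ^ (2 * K) + w % (n + 1) ^ (2 * K) :=
            (lt_of_lt_of_le ha (Nat.le_add_right _ _)).ne
          simpa [Function.update_of_ne hne] using hag a ha
        · rw [not_or, not_lt, hxe] at hlt
          exact hlt
      refine Runs.of_wp rfl (by decide) ?_
      simp only [Prog.wp]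
      refine ⟨fun hc => ?_, fun hc => ?_⟩
      · simp only [BExp.eval, IExp.eval, e11, e10, e13, e22, e9, e0, a6, a8, a9] at hc
        obtain ⟨⟨hok1, hc1⟩, hc2, hc3⟩ := hc
        have hadm := hcond.mpr ⟨hc1, hc2, hc3⟩
        refine ⟨fun hv => hadd _ ?_ hadm hok1, fun hv => hadd _ ?_ hadm hok1⟩
        · simp only [BExp.eval, IExp.eval, e13, e22] at hv
          simp [RExp.eval, IExp.eval, e11, gain, hv]
        · simp only [BExp.eval, IExp.eval, e13, e22] at hv
          simp [RExp.eval, IExp.eval, e11, e10, e13, r3, r5, gain, hv]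
      · simp only [BExp.eval, IExp.eval, e11, e10, e13, e22, e9, e0, a6, a8, a9] at hc
        exact ⟨hT.skip fun hadm hok1 => absurd ⟨⟨hok1, (hcond.mp hadm).1⟩, (hcond.mp hadm).2⟩ hc,
          hag⟩
  · simp [IExp.cost]
  · simp [IExp.cost]

/-- Compute the layer `v₉ + 1` of the tables from the layer `v₉`. -/
def layerBody : Prog :=
  .seq (.for 10 (.var 5) (.setIArr 11 (.add (.add (.var 20) (.var 5)) (.var 10)) (.lit 0)))
    (.seq (.for 10 (.var 6) relaxBody) (.setIVar 20 (.add (.var 20) (.var 5))))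

/-- Compute all layers of the tables for the top `v₂₂`. -/
def tableProg : Prog :=
  .seq (.setIVar 20 (.lit 0))
    (.seq (.for 10 (.var 5) (.setIArr 11 (.var 10) (.lit 0)))
      (.seq (.seq (.setIArr 11 (.lit 0) (.lit 1)) (.setRArr 4 (.lit 0) (.lit 0)))
        (.for 9 (.var 7) layerBody)))

theorem layerBody_spec {n K v j : ℕ} (s : Store) (P : Params n K s) (W : WindowTables n K s)
    (h20 : s.ivar 20 = j * (n + 1) ^ (2 * K)) (h22 : s.ivar 22 = v) (h9 : s.ivar 9 = j) :
    Runs layerBody s ((n + 1) ^ (2 * K + 1) * 330 + 20) fun s' =>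
      TableStep n K (s.iarr 3) (s.rarr 3) (s.rarr 5) v j ((n + 1) ^ (2 * K + 1)) (s'.iarr 11)
        (s'.iarr 12) (s'.rarr 4) ∧
      (∀ a < (j + 1) * (n + 1) ^ (2 * K), s'.iarr 11 a = s.iarr 11 a ∧
        s'.iarr 12 a = s.iarr 12 a ∧ s'.rarr 4 a = s.rarr 4 a) ∧
      s'.ivar 20 = (j + 1) * (n + 1) ^ (2 * K) := by
  have hle : (n + 1) ^ (2 * K) ≤ (n + 1) ^ (2 * K + 1) :=
    Nat.pow_le_pow_right (by omega) (by omega)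
  refine Runs.imp (Runs.seq (T₁ := (n + 1) ^ (2 * K) * 30 + 1 + 5)
    (R := fun s' => (∀ c < (n + 1) ^ (2 * K), s'.iarr 11 ((j + 1) * (n + 1) ^ (2 * K) + c) = 0) ∧
      ∀ a < (j + 1) * (n + 1) ^ (2 * K), s'.iarr 11 a = s.iarr 11 a) ?_
    fun s₁ hf₁ ⟨hc, hag₁⟩ => Runs.seq (T₂ := 5) (relaxLoop_spec (v := v) (j := j) s₁
      (P.of_frame hf₁ rfl) (W.of_frame hf₁ rfl rfl) ?_ ?_ ?_ hc)
    fun s₂ hf₂ ⟨hT, hag₂⟩ => Runs.of_wp rfl (by decide) ?_) (by omega) fun _ _ h => h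
  · refine Runs.imp (Runs.for (m := (n + 1) ^ (2 * K)) (T := 10) (T' := 30)
      (fun i s' => (∀ c < i, s'.iarr 11 ((j + 1) * (n + 1) ^ (2 * K) + c) = 0) ∧
        ∀ a < (j + 1) * (n + 1) ^ (2 * K), s'.iarr 11 a = s.iarr 11 a)
      rfl ?_ (fun _ _ _ h => h) ?_ ?_ ?_) ?_ fun _ _ h => h
    · intro s' hf
      simp [IExp.eval, hf.ivar 5 rfl, P.states]
    · simp
    · rintro i hi s' hf hx ⟨h1, h2⟩
      refine Runs.of_wp rfl (by decide) ?_
      have e : s'.ivar 20 + s'.ivar 5 + s'.ivar 10 = (j + 1) * (n + 1) ^ (2 * K) + i := by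
        rw [hf.ivar 20 rfl, hf.ivar 5 rfl, h20, P.states, hx]; ring
      simp only [Prog.wp, Store.setIArr, IExp.eval, e, Function.update_self]
      refine ⟨fun c hc => ?_, fun a ha => ?_⟩
      · by_cases hci : c = i
        · rw [hci, Function.update_self]
        · rw [Function.update_of_ne (by omega)]
          exact h1 c (by omega)
      · rw [Function.update_of_ne (by omega)]
        exact h2 a ha
    · simp [IExp.cost]
    · simp [IExp.cost]
  · rw [hf₁.ivar 20 rfl, h20]
  · rw [hf₁.ivar 22 rfl, h22]
  · rw [hf₁.ivar 9 rfl, h9]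
  · rw [hf₁.iarr 3 rfl, hf₁.rarr 3 rfl, hf₁.rarr 5 rfl] at hT
    simp only [Prog.wp, Store.setIVar, IExp.eval, Function.update_self]
    refine ⟨hT, fun a ha => ?_, ?_⟩
    · obtain ⟨h1, h2, h3⟩ := hag₂ a ha
      rw [h1, h2, h3, hag₁ a ha, hf₁.iarr 12 rfl, hf₁.rarr 4 rfl]
      exact ⟨rfl, rfl, rfl⟩
    · rw [hf₂.ivar 20 rfl, hf₂.ivar 5 rfl, hf₁.ivar 20 rfl, hf₁.ivar 5 rfl, h20, P.states]
      ring

theorem tableProg_spec {n K v : ℕ} (s : Store) (P : Params n K s) (W : WindowTables n K s)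
    (h22 : s.ivar 22 = v) :
    Runs tableProg s ((2 * n + 2 * K) * ((n + 1) ^ (2 * K + 1) * 330 + 40) +
        (n + 1) ^ (2 * K + 1) * 30 + 30) fun s' =>
      TableBase ((n + 1) ^ (2 * K)) (s'.iarr 11) (s'.rarr 4) ∧
      (∀ j < 2 * n + 2 * K, TableStep n K (s.iarr 3) (s.rarr 3) (s.rarr 5) v j
        ((n + 1) ^ (2 * K + 1)) (s'.iarr 11) (s'.iarr 12) (s'.rarr 4)) ∧
      s'.ivar 20 = (2 * n + 2 * K) * (n + 1) ^ (2 * K) := by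
  have hM : 0 < (n + 1) ^ (2 * K) := by positivity
  have hle : (n + 1) ^ (2 * K) ≤ (n + 1) ^ (2 * K + 1) :=
    Nat.pow_le_pow_right (by omega) (by omega)
  refine Runs.imp (Runs.seq (T₁ := 2) (R := fun s' => s'.ivar 20 = 0)
    (Runs.of_wp rfl (by decide) (by simp [Prog.wp, Store.setIVar, IExp.eval]))
    fun s₁ hf₁ i20 => Runs.seq (T₁ := (n + 1) ^ (2 * K) * 30 + 1 + 5)
      (R := fun s' => ∀ c < (n + 1) ^ (2 * K), s'.iarr 11 c = 0) ?_
    fun s₂ hf₂ hc => Runs.seq (T₁ := 10)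
      (T₂ := (2 * n + 2 * K) * ((n + 1) ^ (2 * K + 1) * 330 + 40) + 1 + 5)
      (R := fun s' => TableBase ((n + 1) ^ (2 * K)) (s'.iarr 11) (s'.rarr 4))
      (Runs.of_wp rfl (by decide) ?_)
    fun s₃ hf₃ hbase => ?_) (by omega) fun _ _ h => h
  · refine Runs.imp (Runs.for (m := (n + 1) ^ (2 * K)) (T := 10) (T' := 30)
      (fun i s' => ∀ c < i, s'.iarr 11 c = 0)
      rfl ?_ (fun _ _ _ h => h) ?_ ?_ ?_) ?_ fun _ _ h => h
    · intro s' hf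
      simp [IExp.eval, hf.ivar 5 rfl, hf₁.ivar 5 rfl, P.states]
    · simp
    · intro i hi s' hf hx h1
      refine Runs.of_wp rfl (by decide) ?_
      simp only [Prog.wp, Store.setIArr, IExp.eval, hx, Function.update_self]
      intro c hc
      by_cases hci : c = i
      · rw [hci, Function.update_self]
      · rw [Function.update_of_ne (by omega)]
        exact h1 c (by omega)
    · simp [IExp.cost]
    · simp [IExp.cost]
  · simp only [Prog.wp, Store.setIArr, Store.setRArr, IExp.eval, RExp.eval, Function.update_self]
    refine ⟨fun c hcM => ?_, by simp⟩
    by_cases h0 : c = 0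
    · simp [h0]
    · simp [h0, hc c hcM]
  · have hfr : ∀ s', Frame (.for 9 (.var 7) layerBody) s₃ s' →
        Params n K s' ∧ WindowTables n K s' ∧ s'.ivar 22 = v ∧ s'.iarr 3 = s.iarr 3 ∧
        s'.rarr 3 = s.rarr 3 ∧ s'.rarr 5 = s.rarr 5 := by
      intro s' hf
      refine ⟨(((P.of_frame hf₁ rfl).of_frame hf₂ rfl).of_frame hf₃ rfl).of_frame hf rfl,
        (((W.of_frame hf₁ rfl rfl).of_frame hf₂ rfl rfl).of_frame hf₃ rfl rfl).of_frame hf rfl rfl,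
        ?_, ?_, ?_, ?_⟩
      · rw [hf.ivar 22 rfl, hf₃.ivar 22 rfl, hf₂.ivar 22 rfl, hf₁.ivar 22 rfl, h22]
      · rw [hf.iarr 3 rfl, hf₃.iarr 3 rfl, hf₂.iarr 3 rfl, hf₁.iarr 3 rfl]
      · rw [hf.rarr 3 rfl, hf₃.rarr 3 rfl, hf₂.rarr 3 rfl, hf₁.rarr 3 rfl]
      · rw [hf.rarr 5 rfl, hf₃.rarr 5 rfl, hf₂.rarr 5 rfl, hf₁.rarr 5 rfl]
    refine Runs.imp (Runs.for (m := 2 * n + 2 * K) (T := (n + 1) ^ (2 * K + 1) * 330 + 20)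
      (T' := (n + 1) ^ (2 * K + 1) * 330 + 40)
      (fun i s' => TableBase ((n + 1) ^ (2 * K)) (s'.iarr 11) (s'.rarr 4) ∧
        (∀ j < i, TableStep n K (s.iarr 3) (s.rarr 3) (s.rarr 5) v j
          ((n + 1) ^ (2 * K + 1)) (s'.iarr 11) (s'.iarr 12) (s'.rarr 4)) ∧
        s'.ivar 20 = i * (n + 1) ^ (2 * K))
      rfl ?_ (fun _ _ _ h => h) ?_ ?_ ?_) ?_ fun _ _ h => h
    · intro s' hf
      exact (hfr s' hf).1.steps
    · refine ⟨hbase, by simp, ?_⟩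
      rw [hf₃.ivar 20 rfl, hf₂.ivar 20 rfl, i20, zero_mul]
    · rintro j hj s' hf hx ⟨hb, hst, h20⟩
      obtain ⟨P', W', h22', a3, r3, r5⟩ := hfr s' hf
      refine (layerBody_spec (v := v) (j := j) s' P' W' h20 h22' hx).imp le_rfl ?_
      rintro s'' hf' ⟨hT, hag, h20'⟩
      rw [a3, r3, r5] at hT
      have hge : (n + 1) ^ (2 * K) ≤ (j + 1) * (n + 1) ^ (2 * K) := Nat.le_mul_of_pos_left _ (by omega)
      refine ⟨⟨fun c hc => ?_, ?_⟩, fun i hi => ?_, h20'⟩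
      · rw [(hag c (by omega)).1]
        exact hb.ok_iff c hc
      · rw [(hag 0 (by omega)).2.2]
        exact hb.zero
      · rcases Nat.lt_succ_iff_lt_or_eq.mp hi with hi | rfl
        · refine (hst i hi).congr le_rfl fun a ha => hag a (lt_of_lt_of_le ha ?_)
          exact Nat.mul_le_mul_right _ (by omega)
        · exact hT
    · simp [IExp.cost]
    · simp [IExp.cost]

/-! ### Reading off the best layout -/

/-- Follow the back pointers and write the symbols of the best layout into array 13, from the
cell `v₂₁` on. -/
def backProg : Prog :=
  .seq (.setIVar 25 (.var 20))
    (.for 9 (.var 7)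
      (.seq (.setIVar 26 (.get 12 (.var 25)))
        (.seq (.setIVar 20 (.sub (.var 20) (.var 5)))
          (.seq (.setIVar 25 (.add (.var 20) (.get 5 (.var 26))))
            (.setIArr 13 (.add (.var 21) (.sub (.sub (.var 7) (.lit 1)) (.var 9)))
              (.get 6 (.var 26)))))))

theorem backProg_spec {n K : ℕ} (s : Store) (P : Params n K s) (W : WindowTables n K s)
    (h20 : s.ivar 20 = (2 * n + 2 * K) * (n + 1) ^ (2 * K))
    (hlt : ∀ i < 2 * n + 2 * K, s.iarr 12 ((2 * n + 2 * K - i) * (n + 1) ^ (2 * K) +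
      back (n + 1) ((n + 1) ^ (2 * K)) (2 * n + 2 * K) (s.iarr 12) i) < (n + 1) ^ (2 * K + 1)) :
    Runs backProg s ((2 * n + 2 * K) * 60 + 20) fun s' =>
      (∀ i < 2 * n + 2 * K, s'.iarr 13 (s.ivar 21 + (2 * n + 2 * K - 1 - i)) =
        s.iarr 12 ((2 * n + 2 * K - i) * (n + 1) ^ (2 * K) +
          back (n + 1) ((n + 1) ^ (2 * K)) (2 * n + 2 * K) (s.iarr 12) i) % (n + 1)) ∧
      ∀ a < s.ivar 21, s'.iarr 13 a = s.iarr 13 a := by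
  set S := 2 * n + 2 * K with hS
  set M := (n + 1) ^ (2 * K) with hM
  set bk := back (n + 1) M S (s.iarr 12) with hbk
  refine Runs.imp (Runs.seq (T₁ := 5) (T₂ := S * 60 + 6) (R := fun s' => s'.ivar 25 = S * M)
    (Runs.of_wp rfl (by decide) (by simp [Prog.wp, Store.setIVar, IExp.eval, h20])) ?_)
    (by omega) fun _ _ h => h
  intro s₁ hf₁ i25
  refine Runs.imp (Runs.for (m := S) (T := 40) (T' := 60)
    (fun i s' => s'.ivar 20 = (S - i) * M ∧ s'.ivar 25 = (S - i) * M + bk i ∧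
      (∀ i' < i, s'.iarr 13 (s.ivar 21 + (S - 1 - i')) =
        s.iarr 12 ((S - i') * M + bk i') % (n + 1)) ∧
      ∀ a < s.ivar 21, s'.iarr 13 a = s.iarr 13 a)
    rfl ?_ (fun _ _ _ h => h) ?_ ?_ ?_) ?_ fun _ _ h => h.2.2
  · intro s' hf
    simp [IExp.eval, hf.ivar 7 rfl, hf₁.ivar 7 rfl, P.steps, hS]
  · refine ⟨by rw [hf₁.ivar 20 rfl, h20]; simp, by rw [i25]; simp [hbk, back], by simp, ?_⟩
    rw [hf₁.iarr 13 rfl]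
    exact fun _ _ => rfl
  · rintro i hi s₂ hf₂ hx ⟨e20, e25, hY, hag⟩
    have e5 : s₂.ivar 5 = M := by rw [hf₂.ivar 5 rfl, hf₁.ivar 5 rfl, P.states]
    have e7 : s₂.ivar 7 = S := by rw [hf₂.ivar 7 rfl, hf₁.ivar 7 rfl, P.steps]
    have e21 : s₂.ivar 21 = s.ivar 21 := by rw [hf₂.ivar 21 rfl, hf₁.ivar 21 rfl]
    have a12 : s₂.iarr 12 = s.iarr 12 := by rw [hf₂.iarr 12 rfl, hf₁.iarr 12 rfl]
    have a5 : s₂.iarr 5 = s.iarr 5 := by rw [hf₂.iarr 5 rfl, hf₁.iarr 5 rfl]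
    have a6 : s₂.iarr 6 = s.iarr 6 := by rw [hf₂.iarr 6 rfl, hf₁.iarr 6 rfl]
    have esub : (S - i) * M - M = (S - (i + 1)) * M := by
      rw [show S - (i + 1) = S - i - 1 by omega, Nat.sub_mul (S - i) 1, one_mul]
    refine Runs.of_wp rfl (by decide) ?_
    simp [Prog.wp, Store.setIVar, Store.setIArr, IExp.eval, e20, e25, e5, e7, e21, a12, a5, a6, hx,
      esub, W.div _ (hlt i hi), W.mod _ (hlt i hi)]
    refine ⟨rfl, fun i' hi' => ?_, fun a ha => ?_⟩
    · by_cases hii : i' = i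
      · subst hii
        rw [Function.update_self]
      · rw [Function.update_of_ne (by omega)]
        exact hY i' (by omega)
    · rw [Function.update_of_ne (by omega)]
      exact hag a ha
  · simp [IExp.cost]
  · simp [IExp.cost]

/-! ### Potentials of all vertices -/

/-- Find a best layout with the top number `n - 1 - v₈` in the order of array 4. -/
def topBody : Prog :=
  .seq (.setIVar 22 (.get 4 (.sub (.sub (.var 0) (.lit 1)) (.var 8))))
    (.seq tableProg
      (.seq (.setRArr 5 (.var 22) (.sub (.lit 0) (.get 4 (.var 20))))
        (.seq backProg (.setIVar 21 (.add (.var 21) (.var 7))))))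

/-- Find best layouts with all tops, children before parents. -/
def topsProg : Prog := .seq (.setIVar 21 (.lit 0)) (.for 8 (.var 0) topBody)

/-- The potential `H` is correct at `v`: no layout with top `v` beats it, and `y` attains it. -/
structure Optimal (n K : ℕ) (par : ℕ → ℕ) (fw H : ℕ → ℝ) (v : ℕ) (y : ℕ → ℕ) : Prop where
  layout : Layout n K par v (padded n K y)
  value_eq : H v + value n K fw H v (padded n K y) = 0
  le : ∀ b, Layout n K par v b → H v + value n K fw H v b ≤ 0

theorem padded_congr {n K : ℕ} {y y' : ℕ → ℕ} (h : ∀ j < 2 * n + 2 * K, y j = y' j) :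
    padded n K y = padded n K y' := by
  funext t
  rw [padded, padded]
  split_ifs with h1 h2
  · rfl
  · exact h _ (by omega)
  · rfl

/-- Optimality at v involves only `H v` and potentials of higher rank, so it is not affected when
the ancestors of v receive theirs. -/
theorem Optimal.congr {n K : ℕ} {par rk : ℕ → ℕ} {fw H H' : ℕ → ℝ} {v : ℕ} {y y' : ℕ → ℕ}
    (h : Optimal n K par fw H v y) (hT : Rooted n par rk)
    (hy : ∀ j < 2 * n + 2 * K, y' j = y j) (h0 : H' 0 = H 0) (hv : H' v = H v)
    (hH : ∀ x, x ≤ n → rk v < rk x → H' x = H x) : Optimal n K par fw H' v y' := by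
  have e := padded_congr hy
  refine ⟨by rw [e]; exact h.layout, ?_, fun b hb => ?_⟩
  · rw [e, hv, h.layout.value_congr hT h0 hH, h.value_eq]
  · rw [hv, hb.value_congr hT h0 hH]
    exact h.le b hb

theorem topBody_spec {n K i : ℕ} {rk : ℕ → ℕ} (s : Store) (P : Params n K s)
    (W : WindowTables n K s) (hT : Rooted n (s.iarr 3) rk) (hi : i < n) (h8 : s.ivar 8 = i)
    (hord : ∀ j < n, 1 ≤ s.iarr 4 j ∧ s.iarr 4 j ≤ n) (hrk : ∀ j < n, rk (s.iarr 4 j) = j)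
    (h21 : s.ivar 21 = i * (2 * n + 2 * K)) (hH0 : s.rarr 5 0 = 0)
    (hopt : ∀ i' < i, Optimal n K (s.iarr 3) (s.rarr 3) (s.rarr 5) (s.iarr 4 (n - 1 - i'))
      fun j => s.iarr 13 (i' * (2 * n + 2 * K) + j)) :
    Runs topBody s ((2 * n + 2 * K) * ((n + 1) ^ (2 * K + 1) * 330 + 100) +
        (n + 1) ^ (2 * K + 1) * 30 + 80) fun s' =>
      s'.ivar 21 = (i + 1) * (2 * n + 2 * K) ∧ s'.rarr 5 0 = 0 ∧
      ∀ i' < i + 1, Optimal n K (s.iarr 3) (s.rarr 3) (s'.rarr 5) (s.iarr 4 (n - 1 - i'))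
        fun j => s'.iarr 13 (i' * (2 * n + 2 * K) + j) := by
  set S := 2 * n + 2 * K with hS
  set v := s.iarr 4 (n - 1 - i) with hv
  obtain ⟨hv1, hvn⟩ := hord (n - 1 - i) (by omega)
  have hrkv : rk v = n - 1 - i := hrk _ (by omega)
  refine Runs.imp (Runs.seq (T₁ := 10) (R := fun s' => s'.ivar 22 = v)
    (Runs.of_wp rfl (by decide) ?_)
    fun s₁ hf₁ h22 => Runs.seq (tableProg_spec (v := v) s₁ (P.of_frame hf₁ rfl)
      (W.of_frame hf₁ rfl rfl) h22)
    fun s₂ hf₂ ⟨hbase, hstep, h20⟩ => Runs.seq (T₁ := 10)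
      (R := fun s' => s'.rarr 5 = Function.update (s.rarr 5) v
        (-s₂.rarr 4 (S * (n + 1) ^ (2 * K)))) (Runs.of_wp rfl (by decide) ?_)
    fun s₃ hf₃ hH => Runs.seq (T₂ := 10) (backProg_spec s₃
      (((P.of_frame hf₁ rfl).of_frame hf₂ rfl).of_frame hf₃ rfl)
      (((W.of_frame hf₁ rfl rfl).of_frame hf₂ rfl rfl).of_frame hf₃ rfl rfl) ?_ ?_)
    fun s₄ hf₄ ⟨hY, hag⟩ => Runs.of_wp rfl (by decide) ?_) ?_ fun _ _ h => h
  · simp [Prog.wp, Store.setIVar, IExp.eval, P.vertices, h8, hv]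
  · simp [Prog.wp, Store.setRArr, IExp.eval, RExp.eval, hf₂.ivar 22 rfl, h22, h20,
      hf₂.rarr 5 rfl, hf₁.rarr 5 rfl, hS]
  · rw [hf₃.ivar 20 rfl, h20]
  -- The one-vertex layout makes the last cell reachable, so its back pointers are genuine windows.
  · obtain ⟨b₀, hb₀⟩ := exists_layout_single (K := K) (par := s₁.iarr 3) hv1 hvn
    rw [hf₃.iarr 12 rfl]
    intro i hi
    exact back_pointer_lt hstep (value_le_table hbase hstep hb₀).1 hi
  · have a3 : s₁.iarr 3 = s.iarr 3 := hf₁.iarr 3 rfl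
    have r3 : s₁.rarr 3 = s.rarr 3 := hf₁.rarr 3 rfl
    have r5 : s₁.rarr 5 = s.rarr 5 := hf₁.rarr 5 rfl
    have e21 : s₃.ivar 21 = i * S := by
      rw [hf₃.ivar 21 rfl, hf₂.ivar 21 rfl, hf₁.ivar 21 rfl, h21]
    have a13 : s₃.iarr 13 = s.iarr 13 := by
      rw [hf₃.iarr 13 rfl, hf₂.iarr 13 rfl, hf₁.iarr 13 rfl]
    have e4 : s₄.rarr 5 = s₃.rarr 5 := hf₄.rarr 5 rfl
    rw [a3, r3, r5] at hstep
    rw [e21, hf₃.iarr 12 rfl] at hY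
    rw [e21, a13] at hag
    simp only [Prog.wp, Store.setIVar, IExp.eval, Function.update_self]
    rw [e4, hH]
    set H' := Function.update (s.rarr 5) v (-s₂.rarr 4 (S * (n + 1) ^ (2 * K))) with hH'
    -- Storing the potential of v does not change the values it was computed from, since the top
    -- contributes no gain.
    have hval : ∀ b, Layout n K (s.iarr 3) v b →
        value n K (s.rarr 3) H' v b = value n K (s.rarr 3) (s.rarr 5) v b := by
      intro b hb
      refine hb.value_congr hT (Function.update_of_ne (by omega) _ _) fun x _ hx => ?_
      refine Function.update_of_ne ?_ _ _
      rintro rfl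
      omega
    refine ⟨?_, ?_, ?_⟩
    · rw [hf₄.ivar 21 rfl, e21, hf₄.ivar 7 rfl,
        (((P.of_frame hf₁ rfl).of_frame hf₂ rfl).of_frame hf₃ rfl).steps, ← hS]
      ring
    · rw [hH', Function.update_of_ne (by omega), hH0]
    · intro i' hi'
      rcases Nat.lt_succ_iff_lt_or_eq.mp hi' with hi' | rfl
      -- Tops handled earlier have higher rank, and their layouts occupy lower blocks of array 13,
      -- so both parts of their certificate survive.
      · have hrk' : rk (s.iarr 4 (n - 1 - i')) = n - 1 - i' := hrk _ (by omega)
        refine (hopt i' hi').congr hT (fun j hj => ?_) ?_ ?_ fun x _ hx => ?_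
        · refine hag _ ?_
          have := Nat.mul_le_mul_right S (show i' + 1 ≤ i by omega)
          rw [Nat.succ_mul] at this
          omega
        · exact Function.update_of_ne (by omega) _ _
        · refine Function.update_of_ne ?_ _ _
          intro h
          rw [h] at hrk'
          omega
        · refine Function.update_of_ne ?_ _ _
          rintro rfl
          omega
      · obtain ⟨b₀, hb₀⟩ := exists_layout_single (K := K) (par := s.iarr 3) hv1 hvn
        have hok := (value_le_table hbase hstep hb₀).1
        obtain ⟨hl, hlv⟩ := layout_of_table hbase hstep hok
          (y := fun j => s₄.iarr 13 (i' * S + j)) hY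
        refine ⟨hl, ?_, fun b hb => ?_⟩
        · rw [hval _ hl, hlv, hH', Function.update_self]
          ring
        · rw [hval _ hb, hH', Function.update_self]
          have := (value_le_table hbase hstep hb).2
          linarith
  · have e : S * ((n + 1) ^ (2 * K + 1) * 330 + 100) =
        S * ((n + 1) ^ (2 * K + 1) * 330 + 40) + S * 60 := by ring
    rw [← hS, e]
    omega

theorem topsProg_spec {n K : ℕ} {rk : ℕ → ℕ} (s : Store) (P : Params n K s)
    (W : WindowTables n K s) (hT : Rooted n (s.iarr 3) rk)
    (hord : ∀ j < n, 1 ≤ s.iarr 4 j ∧ s.iarr 4 j ≤ n) (hrk : ∀ j < n, rk (s.iarr 4 j) = j)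
    (hH0 : s.rarr 5 0 = 0) :
    Runs topsProg s (n * ((2 * n + 2 * K) * ((n + 1) ^ (2 * K + 1) * 330 + 100) +
        (n + 1) ^ (2 * K + 1) * 30 + 100) + 20) fun s' =>
      s'.ivar 21 = n * (2 * n + 2 * K) ∧ s'.rarr 5 0 = 0 ∧
      ∀ i < n, Optimal n K (s.iarr 3) (s.rarr 3) (s'.rarr 5) (s.iarr 4 (n - 1 - i))
        fun j => s'.iarr 13 (i * (2 * n + 2 * K) + j) := by
  refine Runs.imp (Runs.seq (T₁ := 5) (R := fun s' => s'.ivar 21 = 0)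
    (Runs.of_wp rfl (by decide) (by simp [Prog.wp, Store.setIVar, IExp.eval]))
    fun s₁ hf₁ h21 => Runs.for (m := n)
      (T := (2 * n + 2 * K) * ((n + 1) ^ (2 * K + 1) * 330 + 100) +
        (n + 1) ^ (2 * K + 1) * 30 + 80)
      (T' := (2 * n + 2 * K) * ((n + 1) ^ (2 * K + 1) * 330 + 100) +
        (n + 1) ^ (2 * K + 1) * 30 + 100)
      (fun i s' => s'.ivar 21 = i * (2 * n + 2 * K) ∧ s'.rarr 5 0 = 0 ∧
        ∀ i' < i, Optimal n K (s.iarr 3) (s.rarr 3) (s'.rarr 5) (s.iarr 4 (n - 1 - i'))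
          fun j => s'.iarr 13 (i' * (2 * n + 2 * K) + j))
      rfl ?_ (fun _ _ _ h => h) ?_ ?_ ?_) ?_ fun _ _ h => h
  · intro s' hf
    exact ((P.of_frame hf₁ rfl).of_frame hf rfl).vertices
  · refine ⟨by rw [h21, zero_mul], by rw [hf₁.rarr 5 rfl, hH0], by simp⟩
  · rintro i hi s' hf hx ⟨i21, i0, hopt⟩
    have a3 : s'.iarr 3 = s.iarr 3 := by rw [hf.iarr 3 rfl, hf₁.iarr 3 rfl]
    have a4 : s'.iarr 4 = s.iarr 4 := by rw [hf.iarr 4 rfl, hf₁.iarr 4 rfl]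
    have r3 : s'.rarr 3 = s.rarr 3 := by rw [hf.rarr 3 rfl, hf₁.rarr 3 rfl]
    rw [← a3, ← a4, ← r3] at hopt ⊢
    exact topBody_spec s' ((P.of_frame hf₁ rfl).of_frame hf rfl)
      ((W.of_frame hf₁ rfl rfl).of_frame hf rfl rfl) (by rw [a3]; exact hT) hi hx
      (by rw [a4]; exact hord) (by rw [a4]; exact hrk) i21 i0 hopt
  · simp [IExp.cost]
  · simp [IExp.cost]
    omega

end RAM

namespace TreeTSP

/-! ### Writing out the positions -/

theorem count_eq_of_le {p : ℕ → Prop} [DecidablePred p] {a c : ℕ} (h : ∀ t, a ≤ t → ¬ p t)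
    (hac : a ≤ c) : Nat.count p c = Nat.count p a := by
  induction c, hac using Nat.le_induction with
  | base => rfl
  | succ c hc ih => rw [Nat.count_succ, if_neg (h c hc), ih, add_zero]

end TreeTSP

namespace RAM

open TreeTSP

/-- Place the vertices of the layout that starts at the cell `v₂₁` of array 13. -/
def placeProg : Prog :=
  .for 9 (.var 7)
    (.seq (.setIVar 10 (.get 13 (.add (.var 21) (.var 9))))
      (.ite (.ieq (.var 10) (.lit 0)) .skip
        (.seq (.setIVar 20 (.add (.var 20) (.lit 1)))
          (.setIArr 2 (.sub (.var 10) (.lit 1)) (.var 20)))))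

/-- The counter in variable 20 is the number of vertices placed so far, so blanks are skipped and
positions are consecutive. Only the symbols after the 2K leading blanks are stored, which shifts
array indices by 2K against `b`. -/
theorem placeProg_spec {n K : ℕ} {b : ℕ → ℕ} (s : Store) (h7 : s.ivar 7 = 2 * n + 2 * K)
    (hb : b = padded n K fun j => s.iarr 13 (s.ivar 21 + j))
    (hinj : ∀ t t', b t ≠ 0 → b t = b t' → t = t') (hpost : ∀ t, 2 * n + 2 * K ≤ t → b t = 0) :
    Runs placeProg s ((2 * n + 2 * K) * 50 + 10) fun s' =>
      s'.ivar 20 = s.ivar 20 + Nat.count (fun t => b t ≠ 0) (2 * n + 2 * K) ∧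
      (∀ t, b t ≠ 0 → s'.iarr 2 (b t - 1) = s.ivar 20 + Nat.count (fun t => b t ≠ 0) t + 1) ∧
      ∀ x, x ≠ 0 → (∀ t, b t ≠ x) → s'.iarr 2 (x - 1) = s.iarr 2 (x - 1) := by
  have hpre : ∀ t < 2 * K, b t = 0 := fun t ht => by rw [hb]; exact if_pos ht
  have hcpre : Nat.count (fun t => b t ≠ 0) (2 * K) = 0 := by
    rw [Nat.count_eq_card_filter_range, Finset.card_eq_zero, Finset.filter_eq_empty_iff]
    intro t ht
    simp [hpre t (by simpa using ht)]
  refine Runs.imp (Runs.for (m := 2 * n + 2 * K) (T := 30) (T' := 50)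
    (fun i s' => s'.ivar 20 = s.ivar 20 + Nat.count (fun t => b t ≠ 0) (i + 2 * K) ∧
      (∀ t < i + 2 * K, b t ≠ 0 →
        s'.iarr 2 (b t - 1) = s.ivar 20 + Nat.count (fun t => b t ≠ 0) t + 1) ∧
      ∀ x, x ≠ 0 → (∀ t < i + 2 * K, b t ≠ x) → s'.iarr 2 (x - 1) = s.iarr 2 (x - 1))
    rfl ?_ (fun _ _ _ h => h) ?_ ?_ ?_) ?_ ?_
  · intro s' hf
    simp [IExp.eval, hf.ivar 7 rfl, h7]
  · refine ⟨by rw [zero_add, hcpre, add_zero], fun t ht h0 => ?_, fun _ _ _ => rfl⟩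
    exact absurd (hpre t (by omega)) h0
  · rintro i hi s' hf hx ⟨i20, hpos, hold⟩
    have hy : s'.iarr 13 (s'.ivar 21 + i) = b (i + 2 * K) := by
      rw [hf.iarr 13 rfl, hf.ivar 21 rfl, hb, padded_add hi]
    have hcs : Nat.count (fun t => b t ≠ 0) (i + 1 + 2 * K) =
        Nat.count (fun t => b t ≠ 0) (i + 2 * K) + if b (i + 2 * K) ≠ 0 then 1 else 0 := by
      rw [show i + 1 + 2 * K = i + 2 * K + 1 by ring, Nat.count_succ]
    refine Runs.of_wp rfl (by decide) ?_
    simp only [Prog.wp, Store.setIVar, Store.setIArr, IExp.eval, BExp.eval, Function.update_self,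
      hx, hy, hcs]
    refine ⟨fun h0 => ⟨?_, fun t ht h => ?_, fun x hx0 h => ?_⟩,
      fun h0 => ⟨?_, fun t ht h => ?_, fun x hx0 h => ?_⟩⟩
    · simp [h0, i20]
    · refine hpos t ?_ h
      by_contra hlt
      obtain rfl : t = i + 2 * K := by omega
      exact h h0
    · exact hold x hx0 fun t ht => h t (by omega)
    · simp [h0, i20]; ring
    · by_cases hti : t = i + 2 * K
      · subst hti
        simp [i20]
      -- By injectivity of the layout, the current write does not overwrite the position of an
      -- earlier symbol.
      · have hne : b t ≠ b (i + 2 * K) := fun e => hti (hinj t _ h e)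
        have h1 := hpos t (by omega) h
        simp only [ne_eq, Nat.reduceEqDiff, not_false_eq_true, Function.update_of_ne]
        rw [Function.update_self 10, Function.update_of_ne (by omega)]
        exact h1
    · have h1 := hold x hx0 fun t ht => h t (by omega)
      have hne := h (i + 2 * K) (by omega)
      simp only [ne_eq, Nat.reduceEqDiff, not_false_eq_true, Function.update_of_ne]
      rw [Function.update_self 10, Function.update_of_ne (by omega)]
      exact h1
  · simp [IExp.cost]
  · simp [IExp.cost]
  · rintro s' hf ⟨i20, hpos, hold⟩
    have hlt : ∀ t, b t ≠ 0 → t < 2 * n + 2 * K + 2 * K := by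
      intro t h
      by_contra hlt
      exact h (hpost t (by omega))
    refine ⟨?_, fun t h => hpos t (hlt t h) h, fun x hx h => hold x hx fun t _ => h t⟩
    rw [i20, count_eq_of_le (a := 2 * n + 2 * K) (fun t ht => by simp [hpost t ht]) (by omega)]

/-- Place the layout with top number `v₈` if its top has not been placed before. -/
def emitBody : Prog :=
  .seq (.seq (.setIVar 21 (.sub (.var 21) (.var 7))) (.setIVar 22 (.get 4 (.var 8))))
    (.ite (.ieq (.get 2 (.sub (.var 22) (.lit 1))) (.lit 0)) placeProg .skip)

/-- Write the positions of all vertices into array 2. -/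
def emitProg : Prog := .seq (.setIVar 20 (.lit 0)) (.for 8 (.var 0) emitBody)

theorem emitProg_spec {n K : ℕ} {G : SimpleGraph (Fin n)} {wgt : Sym2 (Fin n) → ℝ} {rk : ℕ → ℕ}
    {F H fw wt : ℕ → ℝ} (s : Store) (P : Params n K s)
    (hR : PartialRooting G wgt n (s.iarr 3) (s.iarr 4) wt) (hT : Rooted n (s.iarr 3) rk)
    (hfw : EdgeGain n K (s.iarr 3) F wt fw) (hH : H 0 = 0) (hF0 : ∀ a, 0 ≤ F a)
    (hF : ∀ a a', 1 ≤ a → a ≤ a' → F a' ≤ F a) (h2 : ∀ i, s.iarr 2 i = 0)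
    (h21 : s.ivar 21 = n * (2 * n + 2 * K))
    (hopt : ∀ i < n, Optimal n K (s.iarr 3) fw H (s.iarr 4 (n - 1 - i))
      fun j => s.iarr 13 (i * (2 * n + 2 * K) + j)) :
    Runs emitProg s (n * ((2 * n + 2 * K) * 50 + 70) + 20) fun s' =>
      ∃ Q cnt, Placed n (s.iarr 3) F wt H Q (fun x => s'.iarr 2 (x - 1)) cnt ∧
        ∀ i < n, s.iarr 4 i ∈ Q := by
  set S := 2 * n + 2 * K with hS
  refine Runs.imp (Runs.seq (T₁ := 5) (R := fun s' => s'.ivar 20 = 0)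
    (Runs.of_wp rfl (by decide) (by simp [Prog.wp, Store.setIVar, IExp.eval]))
    fun s₁ hf₁ h20 => Runs.for (m := n) (T := S * 50 + 50) (T' := S * 50 + 70)
      (fun i s' => s'.ivar 21 = (n - i) * S ∧
        ∃ Q, Placed n (s.iarr 3) F wt H Q (fun x => s'.iarr 2 (x - 1)) (s'.ivar 20) ∧
          ∀ i' < i, s.iarr 4 i' ∈ Q)
      rfl ?_ (fun _ _ _ h => h) ?_ ?_ ?_) ?_ ?_
  · intro s' hf
    exact ((P.of_frame hf₁ rfl).of_frame hf rfl).vertices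
  · refine ⟨by rw [hf₁.ivar 21 rfl, h21]; simp, ∅, ?_, by simp⟩
    rw [h20]
    exact Placed.empty _ _ _ _ _ fun x _ _ => by rw [hf₁.iarr 2 rfl, h2]
  · rintro i hi s' hf hx ⟨i21, Q, hQ, hmem⟩
    have P' := (P.of_frame hf₁ rfl).of_frame hf rfl
    have a4 : s'.iarr 4 = s.iarr 4 := by rw [hf.iarr 4 rfl, hf₁.iarr 4 rfl]
    have a13 : s'.iarr 13 = s.iarr 13 := by rw [hf.iarr 13 rfl, hf₁.iarr 13 rfl]
    set v := s.iarr 4 i with hv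
    obtain ⟨hv1, hvn⟩ := hR.ord_mem i hi
    -- Tops were computed in reverse order, so the layout of vertex number i is block n - 1 - i and
    -- the block pointer moves down.
    have esub : (n - i) * S - S = (n - 1 - i) * S := by
      rw [show n - 1 - i = n - i - 1 by omega, Nat.sub_mul (n - i) 1, one_mul]
    refine Runs.imp (Runs.seq (T₁ := 10) (R := fun s'' => s''.ivar 21 = (n - 1 - i) * S ∧
        s''.ivar 22 = v) (Runs.of_wp rfl (by decide) ?_)
      fun s₂ hf₂ ⟨e21, e22⟩ => Runs.ite (T := S * 50 + 10) (fun hc => ?_) (fun hc => ?_)) ?_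
      fun _ _ h => h
    · simp [Prog.wp, Store.setIVar, IExp.eval, i21, P'.steps, hx, a4, esub, ← hS, hv]
    · have hc' : s'.iarr 2 (v - 1) = 0 := by
        simpa [BExp.eval, IExp.eval, e22, hf₂.iarr 2 rfl] using hc
      have hvQ : v ∉ Q := fun h => ((hQ.mem v).mp h).2.2 hc'
      have ho := hopt (n - 1 - i) (by omega)
      rw [show n - 1 - (n - 1 - i) = i by omega, ← hv] at ho
      refine (placeProg_spec s₂ (P'.of_frame hf₂ rfl).steps rfl ?_ ?_).imp (by rw [hS]) ?_
      · rw [e21, hf₂.iarr 13 rfl, a13]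
        exact ho.layout.inj hT (by omega) hvn
      · rw [e21, hf₂.iarr 13 rfl, a13]
        exact ho.layout.post
      · rw [e21, hf₂.iarr 13 rfl, a13, hf₂.ivar 20 rfl, hf₂.iarr 2 rfl]
        rintro s₃ hf₃ ⟨e20, h₁, h₂⟩
        -- The order lists parents first, so the parent of v was treated in an earlier round and is
        -- placed by now.
        have hvpar : v ≠ 1 → s.iarr 3 v ∈ Q := by
          intro h1
          have hi0 : 0 < i := by
            rcases Nat.eq_zero_or_pos i with rfl | h
            · exact absurd hR.ord_zero h1
            · exact h
          obtain ⟨j, hj, e⟩ := hR.par_ord i hi hi0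
          rw [hv, e]
          exact hmem j hj
        obtain ⟨Q', hsub, hvQ', hQ'⟩ := hQ.place (pos' := fun x => s₃.iarr 2 (x - 1)) hT hfw
          hR.wt_zero hR.wt_root hR.wt_nonneg hH hF0 hF ho.layout hv1 hvn hvQ hvpar
          ho.value_eq.ge h₁ h₂
        refine ⟨?_, Q', ?_, fun i' hi' => ?_⟩
        · rw [hf₃.ivar 21 rfl, e21, show n - (i + 1) = n - 1 - i by omega]
        · rw [e20]
          exact hQ'
        · rcases Nat.lt_succ_iff_lt_or_eq.mp hi' with hi' | rfl
          · exact hsub (hmem i' hi')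
          · exact hvQ'
    · refine Runs.of_wp rfl (Nat.le_add_left _ _ |>.trans' (by decide)) ?_
      refine ⟨by rw [e21, show n - (i + 1) = n - 1 - i by omega], Q, ?_, fun i' hi' => ?_⟩
      · rw [hf₂.iarr 2 rfl, hf₂.ivar 20 rfl]
        exact hQ
      · rcases Nat.lt_succ_iff_lt_or_eq.mp hi' with hi' | rfl
        · exact hmem i' hi'
        · refine (hQ.mem _).mpr ⟨hv1, hvn, ?_⟩
          simpa [BExp.eval, IExp.eval, e22, hf₂.iarr 2 rfl] using hc
    · simp only [BExp.cost, IExp.cost]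
      omega
  · simp [IExp.cost]
  · simp [IExp.cost]
    omega
  · rintro s' - ⟨-, Q, hQ, hmem⟩
    exact ⟨Q, _, hQ, hmem⟩

/-! ### Running time -/

/-- Since K ≤ n, (1 + 1/n)^(2K) ≤ e² ≤ 9; the remaining factor n + 1 ≤ 2n doubles this to 18.
Capping the parameter at n is what keeps the constant absolute. -/
theorem windows_le {n K : ℕ} (hn : 0 < n) (hK : K ≤ n) :
    (n + 1) ^ (2 * K + 1) ≤ 18 * n ^ (2 * K + 1) := by
  have hnr : (0 : ℝ) < n := by exact_mod_cast hn
  have h1 : ((n : ℝ) + 1) ^ (2 * K) ≤ 9 * (n : ℝ) ^ (2 * K) := by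
    have h2 : (n : ℝ) + 1 ≤ n * Real.exp (1 / n) := by
      have := mul_le_mul_of_nonneg_left (Real.add_one_le_exp (1 / (n : ℝ))) hnr.le
      rwa [mul_add, mul_one, mul_one_div, div_self hnr.ne', add_comm] at this
    have h3 : Real.exp (1 / n) ^ (2 * K) ≤ 9 := by
      rw [← Real.exp_nat_mul]
      have h4 : ((2 * K : ℕ) : ℝ) * (1 / n) ≤ 1 + 1 := by
        rw [mul_one_div, div_le_iff₀ hnr]
        have : (K : ℝ) ≤ n := by exact_mod_cast hK
        push_cast
        linarith
      refine (Real.exp_le_exp.mpr h4).trans ?_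
      rw [Real.exp_add]
      have h5 : Real.exp 1 ≤ 3 := by
        have := Real.exp_one_lt_d9
        linarith
      have h6 := (Real.exp_pos 1).le
      nlinarith
    calc ((n : ℝ) + 1) ^ (2 * K) ≤ (n * Real.exp (1 / n)) ^ (2 * K) :=
          pow_le_pow_left₀ (by positivity) h2 _
      _ = Real.exp (1 / n) ^ (2 * K) * (n : ℝ) ^ (2 * K) := by rw [mul_pow, mul_comm]
      _ ≤ 9 * (n : ℝ) ^ (2 * K) := mul_le_mul_of_nonneg_right h3 (by positivity)
  have h2 : (n + 1) ^ (2 * K) ≤ 9 * n ^ (2 * K) := by exact_mod_cast h1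
  calc (n + 1) ^ (2 * K + 1) = (n + 1) ^ (2 * K) * (n + 1) := pow_succ _ _
    _ ≤ 9 * n ^ (2 * K) * (2 * n) := Nat.mul_le_mul h2 (by omega)
    _ = 18 * n ^ (2 * K + 1) := by ring

/-- Every term is at most a multiple of n² (n+1)^(2K+1), with total coefficient below 3000; the
factor 18 from `windows_le` yields 54000. -/
theorem total_time_le {n k K m : ℕ} (hn : 0 < n) (hKn : K ≤ n) (hKk : K ≤ k) (hm : m ≤ n) :
    ((2 * K + 1) * ((n + 1) * 12 + 24) + 50) + ((n * (m * 80 + 40) + 30) +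
      (((n + 1) ^ (2 * K + 1) * 60 + 20) + (((n + 1) ^ (2 * K + 1) * (K * 180 + 200) + 6) +
        ((n * ((2 * n + 2 * K) * ((n + 1) ^ (2 * K + 1) * 330 + 100) +
          (n + 1) ^ (2 * K + 1) * 30 + 100) + 20) +
        (n * ((2 * n + 2 * K) * 50 + 70) + 20))))) ≤ 54000 * n ^ (2 * k + 3) := by
  set B := (n + 1) ^ (2 * K + 1) with hB
  have hB1 : 1 ≤ B := Nat.one_le_pow _ _ (by omega)
  have hn2 : 1 ≤ n * n := Nat.mul_pos hn hn
  have hnn : n ≤ n * n := Nat.le_mul_of_pos_left n hn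
  have hX : n * n ≤ n * n * B := Nat.le_mul_of_pos_right _ hB1
  have hBX : B ≤ n * n * B := Nat.le_mul_of_pos_left _ hn2
  have hnBX : n * B ≤ n * n * B := Nat.mul_le_mul_right B hnn
  have t1 : (2 * K + 1) * ((n + 1) * 12 + 24) ≤ 3 * n * (48 * n) :=
    Nat.mul_le_mul (by omega) (by omega)
  have t2 : n * (m * 80 + 40) ≤ n * (120 * n) := Nat.mul_le_mul_left _ (by omega)
  have t3 : B * (K * 180 + 200) ≤ B * (380 * n) := Nat.mul_le_mul_left _ (by omega)
  have t4 : n * ((2 * n + 2 * K) * (B * 330 + 100) + B * 30 + 100) ≤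
      n * (4 * n * (430 * B) + 130 * B) := by
    refine Nat.mul_le_mul_left _ ?_
    have := Nat.mul_le_mul (show 2 * n + 2 * K ≤ 4 * n by omega)
      (show B * 330 + 100 ≤ 430 * B by omega)
    linarith
  have t5 : n * ((2 * n + 2 * K) * 50 + 70) ≤ n * (270 * n) := Nat.mul_le_mul_left _ (by omega)
  have e1 : 3 * n * (48 * n) = 144 * (n * n) := by ring
  have e2 : n * (120 * n) = 120 * (n * n) := by ring
  have e3 : B * (380 * n) = 380 * (n * B) := by ring
  have e4 : n * (4 * n * (430 * B) + 130 * B) = 1720 * (n * n * B) + 130 * (n * B) := by ring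
  have e5 : n * (270 * n) = 270 * (n * n) := by ring
  have hsum : ((2 * K + 1) * ((n + 1) * 12 + 24) + 50) + ((n * (m * 80 + 40) + 30) +
      ((B * 60 + 20) + ((B * (K * 180 + 200) + 6) +
        ((n * ((2 * n + 2 * K) * (B * 330 + 100) + B * 30 + 100) + 20) +
        (n * ((2 * n + 2 * K) * 50 + 70) + 20))))) ≤ 3000 * (n * n * B) := by
    omega
  refine hsum.trans ?_
  calc 3000 * (n * n * B) ≤ 3000 * (n * n * (18 * n ^ (2 * K + 1))) := by
        gcongr
        exact windows_le hn hKn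
    _ = 54000 * n ^ (2 * K + 3) := by ring
    _ ≤ 54000 * n ^ (2 * k + 3) := by
        gcongr

/-! ### The whole algorithm and its optimality -/

/-- The whole algorithm. -/
def mainProg : Prog :=
  .seq setupProg (.seq rootProg (.seq divProg (.seq windowProg (.seq topsProg emitProg))))

end RAM

theorem IsEdgeList.length_le {n : ℕ} {G : SimpleGraph (Fin n)} {l : List (Fin n × Fin n)}
    (hl : IsEdgeList G l) (hG : G.IsTree) : l.length ≤ n := by
  classical
  have h1 := hG.card_edgeFinset
  have h2 : (l.map fun p => s(p.1, p.2)).toFinset = G.edgeFinset := by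
    ext e
    rw [List.mem_toFinset, SimpleGraph.mem_edgeFinset]
    induction e with
    | _ u v => exact hl.2 u v
  have h3 := List.toFinset_card_of_nodup hl.1
  rw [h2, List.length_map] at h3
  rw [Fintype.card_fin] at h1
  omega

namespace RAM

open TreeTSP

theorem mainProg_spec {n : ℕ} (I : ExtTSP n) (l : List (Fin n × Fin n)) (hI : I.graph.IsTree)
    (hl : IsEdgeList I.graph l) :
    Runs mainProg (I.input l) (54000 * n ^ (2 * I.k + 3)) fun s =>
      ∃ d : Sequencing n, Outputs s d ∧ I.IsOptimal d := by
  have hn : 0 < n := by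
    obtain ⟨u⟩ := hI.1.nonempty
    exact u.pos
  set K := min I.k n with hK
  set s := I.input l with hs
  have i0 : s.ivar 0 = n := rfl
  have i1 : s.ivar 1 = I.k := rfl
  have i2 : s.ivar 2 = l.length := rfl
  have hedges : ∀ i (h : i < l.length), s.iarr 0 i = (l[i]).1 ∧ s.iarr 1 i = (l[i]).2 ∧
      s.rarr 0 i = I.weight s((l[i]).1, (l[i]).2) := by
    intro i h
    simp [hs, ExtTSP.input, h]
  have hzero : ∀ a, 2 ≤ a → ∀ i, s.iarr a i = 0 := by
    intro a ha i
    simp [hs, ExtTSP.input, show a ≠ 0 by omega, show a ≠ 1 by omega]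
  have hrzero : ∀ a, 2 ≤ a → ∀ i, s.rarr a i = 0 := by
    intro a ha i
    simp [hs, ExtTSP.input, show a ≠ 0 by omega, show a ≠ 1 by omega]
  set F := s.rarr 1 with hFdef
  have hFin : ∀ a, 1 ≤ a → F a = I.f a := by
    intro a ha
    by_cases h : a ≤ I.k
    · simp [hFdef, hs, ExtTSP.input, ha, h]
    · simp [hFdef, hs, ExtTSP.input, h, I.f_far a (by omega)]
  have hFfar : ∀ a, I.k < a → F a = 0 := by
    intro a ha
    rw [hFin a (by omega), I.f_far a ha]
  have hFanti : ∀ a a', 1 ≤ a → a ≤ a' → F a' ≤ F a := by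
    intro a a' h h'
    rw [hFin a h, hFin a' (by omega)]
    exact I.f_anti h (Set.mem_Ici.mpr (by omega)) h'
  have hF0 : ∀ a, 0 ≤ F a := by
    intro a
    by_cases h : 1 ≤ a
    · rw [← hFfar (a + I.k + 1) (by omega)]
      exact hFanti _ _ h (by omega)
    · simp [hFdef, hs, ExtTSP.input, h]
  refine Runs.imp (Runs.seq (T₂ := (n * (l.length * 80 + 40) + 30) +
      (((n + 1) ^ (2 * K + 1) * 60 + 20) + (((n + 1) ^ (2 * K + 1) * (K * 180 + 200) + 6) +
        ((n * ((2 * n + 2 * K) * ((n + 1) ^ (2 * K + 1) * 330 + 100) +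
          (n + 1) ^ (2 * K + 1) * 30 + 100) + 20) +
        (n * ((2 * n + 2 * K) * 50 + 70) + 20)))))
    (setupProg_spec s) fun s₁ hf₁ ⟨p3, p4, p5, p6, p7⟩ => ?_) ?_ fun _ _ h => h
  · have P₁ : Params n K s₁ := ⟨by rw [hf₁.ivar 0 rfl, i0], p3, p4, p5, p6, p7⟩
    refine Runs.seq (rootProg_spec hn hI.1 hl I.weight_pos s₁ P₁.vertices ?_ P₁.base ?_ ?_ ?_)
      fun s₂ hf₂ hR => ?_
    · rw [hf₁.ivar 2 rfl, i2]
    · rw [hf₁.iarr 0 rfl, hf₁.iarr 1 rfl, hf₁.rarr 0 rfl]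
      exact hedges
    · rw [hf₁.iarr 3 rfl]
      exact hzero 3 (by omega)
    · rw [hf₁.rarr 2 rfl]
      exact hrzero 2 le_rfl
    have P₂ : Params n K s₂ := P₁.of_frame hf₂ rfl
    have hdivs := divProg_spec s₂ (by rw [P₂.base]; omega) (by rw [P₂.states]; positivity)
    rw [P₂.base, P₂.states, P₂.windows] at hdivs
    refine Runs.seq hdivs fun s₃ hf₃ hdiv => ?_
    have P₃ : Params n K s₃ := P₂.of_frame hf₃ rfl
    refine Runs.seq (windowProg_spec (n := n) (K := K) s₃ P₃.radius P₃.windows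
      (fun w hw => (hdiv w hw).1) (fun w hw => (hdiv w hw).2.1) (fun w hw => (hdiv w hw).2.2))
      fun s₄ hf₄ hW => ?_
    have P₄ : Params n K s₄ := P₃.of_frame hf₄ rfl
    rw [← hf₃.iarr 3 rfl, ← hf₃.iarr 4 rfl, ← hf₃.rarr 2 rfl, ← hf₄.iarr 3 rfl,
      ← hf₄.iarr 4 rfl, ← hf₄.rarr 2 rfl] at hR
    obtain ⟨hsurj, rk, hT, hrk⟩ := hR.exists_rooted
    have hr1 : s₄.rarr 1 = F := by
      rw [hf₄.rarr 1 rfl, hf₃.rarr 1 rfl, hf₂.rarr 1 rfl, hf₁.rarr 1 rfl]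
    have hedge := hW.edge
    rw [hr1] at hedge
    refine Runs.seq (topsProg_spec s₄ P₄ hW hT hR.ord_mem hrk ?_) fun s₅ hf₅ ⟨h21, hH0, hopt⟩ => ?_
    · rw [hf₄.rarr 5 rfl, hf₃.rarr 5 rfl, hf₂.rarr 5 rfl, hf₁.rarr 5 rfl]
      exact hrzero 5 (by omega) 0
    · have hoptv : ∀ v, 1 ≤ v → v ≤ n → ∀ b, Layout n K (s₄.iarr 3) v b →
          s₅.rarr 5 v + value n K (s₄.rarr 3) (s₅.rarr 5) v b ≤ 0 := by
        intro v h1 h2 b hb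
        obtain ⟨j, hj, rfl⟩ := hsurj v h1 h2
        have := (hopt (n - 1 - j) (by omega)).le
        rw [show n - 1 - (n - 1 - j) = j by omega] at this
        exact this b hb
      have a3 : s₅.iarr 3 = s₄.iarr 3 := hf₅.iarr 3 rfl
      have a4 : s₅.iarr 4 = s₄.iarr 4 := hf₅.iarr 4 rfl
      rw [← a3] at hedge hT hoptv
      rw [← a3, ← a4] at hopt hR
      refine (emitProg_spec s₅ (P₄.of_frame hf₅ rfl) hR hT hedge hH0 hF0 hFanti ?_ h21
        hopt).imp le_rfl ?_
      · rw [hf₅.iarr 2 rfl, hf₄.iarr 2 rfl, hf₃.iarr 2 rfl, hf₂.iarr 2 rfl, hf₁.iarr 2 rfl]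
        exact hzero 2 le_rfl
      rintro s₆ - ⟨Q, cnt, hQ, hall⟩
      rw [a4] at hall
      have hall' : ∀ x, 1 ≤ x → x ≤ n → x ∈ Q := by
        intro x h1 h2
        obtain ⟨j, hj, rfl⟩ := hsurj x h1 h2
        exact hall j hj
      obtain ⟨d, hd⟩ := hQ.exists_sequencing hall'
      have hQe : Q = Finset.Icc 1 n := by
        ext x
        rw [Finset.mem_Icc]
        exact ⟨fun h => ⟨((hQ.mem x).mp h).1, ((hQ.mem x).mp h).2.1⟩, fun h => hall' x h.1 h.2⟩
      refine ⟨d, fun v => hd v, fun d' => ?_⟩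
      let δ : ℕ → ℕ := fun x => if h : 1 ≤ x ∧ x ≤ n then d' ⟨x - 1, by omega⟩ else 0
      have hδ : ∀ u : Fin n, δ (u + 1) = d' u := by
        intro u
        exact dif_pos ⟨by omega, u.2⟩
      have hδ' : ∀ x ∈ Finset.Icc 1 n, ∃ u : Fin n, x = u + 1 := by
        intro x hx
        rw [Finset.mem_Icc] at hx
        exact ⟨⟨x - 1, by omega⟩, by dsimp only; omega⟩
      rw [objective_eq_sum I hI hT hn hR.edge hR.wt_root hFin d' hδ,
        objective_eq_sum I hI hT hn hR.edge hR.wt_root hFin d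
          (δ := fun x => s₆.iarr 2 (x - 1)) hd]
      -- The competitor `d'` earns at most -Σ H, and the output earns at least -Σ H by
      -- `Placed.potential`.
      refine (sum_le_neg_potential hT hedge hR.wt_zero hR.wt_root hH0 ?_ hoptv ?_ ?_).trans ?_
      -- If k ≤ n then K = k and f vanishes beyond it; otherwise K = n and no a lies strictly
      -- between K and n.
      · intro a h1 h2
        exact hFfar a (by omega)
      · intro x hx
        obtain ⟨u, rfl⟩ := hδ' x hx
        rw [hδ]
        exact Finset.mem_Icc.mp (d' u).2
      · intro x hx y hy h
        obtain ⟨u, rfl⟩ := hδ' x hx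
        obtain ⟨w, rfl⟩ := hδ' y hy
        rw [hδ, hδ] at h
        rw [d'.injective (Subtype.ext h)]
      · have := hQ.potential
        rw [hQe, Finset.sum_add_distrib] at this
        linarith
  · refine le_trans (le_of_eq ?_) (total_time_le hn (min_le_right I.k n) (min_le_left I.k n)
      (hl.length_le hI))
    rw [i0, i1]

end RAM

theorem mainTheorem2 :
    ∃ (P : RAM.Prog) (C : ℕ),
      ∀ (n : ℕ) (I : ExtTSP n) (l : List (Fin n × Fin n)),
        I.graph.IsTree → IsEdgeList I.graph l →
          ∃ (s : RAM.Store) (t : ℕ),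
            RAM.Exec P (I.input l) s t ∧
            t ≤ C * n ^ (2 * I.k + 3) ∧
            ∃ d : Sequencing n, Outputs s d ∧ I.IsOptimal d :=
  ⟨RAM.mainProg, 54000, fun _ I l hI hl => RAM.mainProg_spec I l hI hl⟩
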